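/- Let $n\ge 1$ and let $\Omega\subset\mathbb R^{n+1}$ be a convex body (compact, convex, non-empty interior) with $C^\infty$ boundary $M=\partial\Omega$, outer unit normal $\nu:M\to\mathbb S^n$, Gauss curvature $K=\det(d\nu)\ge 0$ and induced surface measure $d\sigma$. Let $V$ denote volume, $B(1)$ the closed unit ball, $d\theta$ the surface measure of $\mathbb S^n$ and $\omega_n=\int_{\mathbb S^n}d\theta$. For $z_0\in\Omega$ put $u_{z_0}(x)=\max_{z\in\Omega}\langle x,z-z_0\rangle$, $x\in\mathbb S^n$, and define $$\mathcal E(\Omega)=\sup_{z_0\in\Omega,\ u_{z_0}>0}\frac1{\omega_n}\int_{\mathbb S^n}\log u_{z_0}\,d\theta,\qquad \mathcal E_C(\Omega)=\frac1{\omega_n}\int_M K\log K\,d\sigma\quad(0\log 0=0).$$ (a) Suppose $V(\Omega)=V(B(1))$. Then $\mathcal E_C(\Omega)\ge\mathcal E(\Omega)\ge 0$. There is a unique point $z_e\in\Omega$ with $u_{z_e}>0$ on $\mathbb S^n$ at which the supremum defining $\mathcal E(\Omega)$ is attained; writing $u_e=u_{z_e}$, one has $\mathcal E_C(\Omega)=\mathcal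 E(\Omega)$ if and only if $K(p)=u_e(\nu(p))$ for all $p\in M$. Moreover $\mathcal E_C(\Omega)=0$ if and only if $\Omega$ is a unit ball, that is, a translate of $B(1)$. (b) Without the volume normalization, $$\mathcal E_C(\Omega)\ge\mathcal E(\Omega)-\log\frac{V(\Omega)}{V(B(1))}.$$ -/

import Mathlib

open MeasureTheory Set Metric
open scoped ContDiff RealInnerProductSpace

noncomputable section

namespace GaussEntropy

/-- The Euclidean space `ℝ^{n+1}`. -/
abbrev E (n : ℕ) : Type := EuclideanSpace ℝ (Fin (n + 1))

variable {n : ℕ}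

/-- The support function of `Ω` with respect to `z₀`: `u_{z₀}(x) = max_{z ∈ Ω} ⟨x, z - z₀⟩`
(the maximum is attained when `Ω` is compact and nonempty). -/
def supportFun (Ω : Set (E n)) (z₀ x : E n) : ℝ :=
  sSup ((fun z => ⟪x, z - z₀⟫) '' Ω)

/-- The surface measure `dθ` of the unit sphere `𝕊ⁿ ⊂ ℝ^{n+1}`. -/
abbrev sphereMeasure (n : ℕ) : Measure (sphere (0 : E n) 1) :=
  (volume : Measure (E n)).toSphere

/-- The area `ω_n` of `𝕊ⁿ`. -/
def sphereArea (n : ℕ) : ℝ := (sphereMeasure n).real univ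

/-- `(1/ω_n) ∫_{𝕊ⁿ} log u_{z₀}(x) dθ(x)`. -/
def meanLogSupport (Ω : Set (E n)) (z₀ : E n) : ℝ :=
  (1 / sphereArea n) *
    ∫ x : sphere (0 : E n) 1, Real.log (supportFun Ω z₀ (x : E n)) ∂(sphereMeasure n)

/-- The points `z₀ ∈ Ω` whose support function `u_{z₀}` is positive on the whole sphere. -/
def positivePoints (Ω : Set (E n)) : Set (E n) :=
  {z₀ | z₀ ∈ Ω ∧ ∀ x ∈ sphere (0 : E n) 1, 0 < supportFun Ω z₀ x}

/-- The entropy `𝓔(Ω) = sup_{u_{z₀} > 0} (1/ω_n) ∫_{𝕊ⁿ} log u_{z₀} dθ`. -/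
def entropy (Ω : Set (E n)) : ℝ :=
  sSup (meanLogSupport Ω '' positivePoints Ω)

/-- `z` is an entropy point of `Ω`: its support function is positive and attains the supremum
that defines the entropy. -/
def IsEntropyPoint (Ω : Set (E n)) (z : E n) : Prop :=
  z ∈ positivePoints Ω ∧ meanLogSupport Ω z = entropy Ω

/-- `Ω` has smooth boundary: near each boundary point, `Ω` is the sublevel set `{f ≤ 0}` of a
`C^∞` function `f` with nonvanishing differential. (For a convex body with `n ≥ 1` this forces the
interior to be nonempty.) -/
def HasSmoothBoundary (Ω : Set (E n)) : Prop :=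
  ∀ p ∈ frontier Ω, ∃ (U : Set (E n)) (f : E n → ℝ), IsOpen U ∧ p ∈ U ∧
    ContDiffOn ℝ ∞ f U ∧ fderiv ℝ f p ≠ 0 ∧ Ω ∩ U = {x ∈ U | f x ≤ 0}

/-- `v` is an outer unit normal of the convex set `Ω` at `p`. -/
def IsOuterUnitNormal (Ω : Set (E n)) (p v : E n) : Prop :=
  ‖v‖ = 1 ∧ ∀ z ∈ Ω, ⟪v, z - p⟫ ≤ 0

/-- The Gauss map `ν` of `∂Ω`: the outer unit normal at `p ∈ ∂Ω`. It exists at every boundary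
point of a convex body and it is unique when the boundary is smooth. -/
def gaussMap (Ω : Set (E n)) (p : E n) : E n :=
  Classical.epsilon (IsOuterUnitNormal Ω p)

/-- The tangent space `T_p ∂Ω = ν(p)^⊥`. -/
abbrev tangentSpace (Ω : Set (E n)) (p : E n) : Submodule ℝ (E n) :=
  (Submodule.span ℝ {gaussMap Ω p})ᗮ

/-- The Weingarten map `W = dν : T_p ∂Ω → T_p ∂Ω`. The derivative of `ν` within the hypersurface
`∂Ω` is determined only on tangent vectors, so it is restricted to the tangent space; its values on
tangent vectors are tangent since `‖ν‖ = 1` on `∂Ω`, and the orthogonal projection only serves to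
express this in the type. -/
def weingarten (Ω : Set (E n)) (p : E n) : tangentSpace Ω p →L[ℝ] tangentSpace Ω p :=
  (tangentSpace Ω p).orthogonalProjectionOnto ∘L
    (fderivWithin ℝ (gaussMap Ω) (frontier Ω) p) ∘L (tangentSpace Ω p).subtypeL

/-- The Gauss curvature `K = det W` of `∂Ω` at `p`. -/
def gaussCurvature (Ω : Set (E n)) (p : E n) : ℝ :=
  LinearMap.det (weingarten Ω p : tangentSpace Ω p →ₗ[ℝ] tangentSpace Ω p)

/-- Chow's entropy `𝓔_C(Ω) = (1/ω_n) ∫_{∂Ω} K log K dσ`, where the surface measure `dσ` is the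
`n`-dimensional Hausdorff measure, normalized to agree with Lebesgue measure on `ℝⁿ`
(and `0 log 0 = 0`). -/
def chowEntropy (Ω : Set (E n)) : ℝ :=
  (1 / sphereArea n) *
    ∫ p in frontier Ω, gaussCurvature Ω p * Real.log (gaussCurvature Ω p)
      ∂(Measure.euclideanHausdorffMeasure n : Measure (E n))

end GaussEntropy

end

open MeasureTheory Set Metric
open scoped ContDiff RealInnerProductSpace ENNReal NNReal Pointwise

noncomputable section

namespace GaussEntropy

/-! ### The one-dimensional Prékopa–Leindler inequality -/

/-! The chain `𝓔_C ≥ 𝓔 ≥ 0` rests on two independent comparisons, and the entropy point on a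
variational argument.

Upper bound for `𝓔`. For `z` in the interior of `Ω`, compare two measures on the boundary: `K dσ`,
which the Gauss map pushes forward to `dθ`, and `u_z(ν) dσ`, which is `n + 1` times the cone measure
with apex `z` and so has mass `(n+1) V(Ω)`. With `c = V(B(1)) / V(Ω)`, the measures `K dσ` and `c
u_z(ν) dσ` both have mass `ω_n`, and the integral of the nonnegative function `k log k - k log b - k
+ b` at `k = K`, `b = c u_z(ν)` is `ω_n` times `𝓔_C - mean log u_z - log c`. This gives (b), the
first inequality of (a), and its equality case, since the integrand vanishes only for `k = b`. Two
measure identities carry this. The cone measure has density `⟪ν(p), p⟫`, by comparing small pieces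
of the boundary with their tangent hyperplanes (`HasSmoothBoundary.volume_cone_eq`). The degree-one
extension `y ↦ g(y) ν(y / g(y))` of the Gauss map, `g` the gauge, carries the body onto the unit
ball with Jacobian `K / ⟪ν, p⟫` and is injective off `K = 0`
(`HasSmoothBoundary.lintegral_radialGaussMap`).

Lower bound for `𝓔`. At the centroid `c`, polar coordinates turn `∫ u_c^{-(n+1)} dθ` into `n + 1`
times the volume of the polar body, which Blaschke–Santaló bounds by `ω_n` when `V(Ω) = V(B(1))`.
Then `log t ≤ t - 1` gives a nonnegative mean of `log u_c`, with equality only for `u_c ≡ 1`; hence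
`𝓔_C = 0` forces a unit ball. Blaschke–Santaló itself comes from its functional form by induction on
the dimension: one function is halved by a median hyperplane, each half is reduced to its marginal
along a slanted direction, and the fibres are handled by Prékopa–Leindler on the half-line.

Entropy point. Maximise over shrunken copies of `Ω` and pass to a limit `z`. The first-order
condition `∫ u_w / u_z dθ ≤ ω_n` survives by Fatou. At a boundary point it fails, as reflecting the
sphere in the tangent hyperplane shows; at an interior point, concavity of `log` turns it into
global maximality. Strict concavity gives uniqueness. -/

theorem volume_add_volume_le_of_isCompact {K L C : Set ℝ} (hK : IsCompact K) (hL : IsCompact L)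
    (hK0 : K.Nonempty) (hL0 : L.Nonempty) (h : K + L ⊆ C) :
    volume K + volume L ≤ volume C := by
  set k := sSup K
  set l := sInf L
  have hk : k ∈ K := hK.sSup_mem hK0
  have hl : l ∈ L := hL.sInf_mem hL0
  have h1 : (fun x => l + x) '' K ⊆ Iic (k + l) := by
    rintro _ ⟨x, hx, rfl⟩
    have := le_csSup hK.bddAbove hx
    simp only [mem_Iic]; linarith
  have h2 : (fun x => k + x) '' L ⊆ Ici (k + l) := by
    rintro _ ⟨x, hx, rfl⟩
    have := csInf_le hL.bddBelow hx
    simp only [mem_Ici]; linarith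
  -- One-dimensional Brunn–Minkowski: the translates `min L + K` and `K.max + L` both lie in `K + L`
  -- and meet only at their common endpoint.
  have hsub : (fun x => l + x) '' K ∪ (fun x => k + x) '' L ⊆ C := by
    rintro _ (⟨x, hx, rfl⟩ | ⟨x, hx, rfl⟩)
    · exact h (by simpa [add_comm] using add_mem_add hx hl)
    · exact h (add_mem_add hk hx)
  have hd : AEDisjoint volume ((fun x => l + x) '' K) ((fun x => k + x) '' L) := by
    refine measure_mono_null (t := {k + l}) ?_ (by simp)
    rintro x ⟨hx1, hx2⟩
    exact le_antisymm (h1 hx1) (h2 hx2)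
  have hm : MeasurableSet ((fun x => k + x) '' L) :=
    (hL.image (by fun_prop)).measurableSet
  calc volume K + volume L
      = volume ((fun x => l + x) '' K) + volume ((fun x => k + x) '' L) := by
        rw [image_add_left, image_add_left, measure_preimage_add, measure_preimage_add]
    _ = volume ((fun x => l + x) '' K ∪ (fun x => k + x) '' L) :=
        (measure_union₀ hm.nullMeasurableSet hd).symm
    _ ≤ volume C := measure_mono hsub

theorem volume_add_volume_le {A B C : Set ℝ} (hA : MeasurableSet A) (hB : MeasurableSet B)
    (hA0 : A.Nonempty) (hB0 : B.Nonempty) (h : A + B ⊆ C) :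
    volume A + volume B ≤ volume C := by
  have key : ∀ (K : Set ℝ), K ⊆ A → IsCompact K → ∀ (L : Set ℝ), L ⊆ B → IsCompact L →
      volume K + volume L ≤ volume C := by
    intro K hKA hK L hLB hL
    obtain ⟨a, ha⟩ := hA0
    obtain ⟨b, hb⟩ := hB0
    -- The approximating compact sets may be empty; adding one point of `A` and of `B` repairs this
    -- without leaving them.
    calc volume K + volume L ≤ volume (insert a K) + volume (insert b L) :=
          add_le_add (measure_mono (subset_insert _ _)) (measure_mono (subset_insert _ _))
      _ ≤ volume C := volume_add_volume_le_of_isCompact (hK.insert a) (hL.insert b)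
          ⟨a, mem_insert _ _⟩ ⟨b, mem_insert _ _⟩
          ((add_subset_add (insert_subset ha hKA) (insert_subset hb hLB)).trans h)
  rcases eq_or_ne (volume C) ⊤ with hC | hC
  · simp [hC]
  have hBC : ∀ K ⊆ A, IsCompact K → volume B ≤ volume C - volume K := fun K hKA hK => by
    rw [hB.measure_eq_iSup_isCompact]
    exact iSup₂_le fun L hL => iSup_le fun hLc =>
      ENNReal.le_sub_of_add_le_left (ne_top_of_le_ne_top hC
        (le_self_add.trans (key K hKA hK L hL hLc))) (key K hKA hK L hL hLc)
  have hBfin : volume B ≠ ⊤ := ne_top_of_le_ne_top hC (by simpa using hBC ∅ (by simp) (by simp))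
  have hAC : volume A ≤ volume C - volume B := by
    rw [hA.measure_eq_iSup_isCompact]
    refine iSup₂_le fun K hK => iSup_le fun hKc => ENNReal.le_sub_of_add_le_right hBfin ?_
    have hKC : volume K ≤ volume C := by simpa using key K hK hKc ∅ (by simp) (by simp)
    rw [add_comm]
    exact add_le_of_le_tsub_right_of_le hKC (hBC K hK hKc)
  exact add_le_of_le_tsub_right_of_le (by simpa using hBC ∅ (by simp) (by simp)) hAC

/-- If `φ a > t` and `ψ b > t`, then `h > t` at the midpoint, so Brunn–Minkowski applies to
superlevel sets and the layer-cake formula integrates the result over `t`. Normalising both suprema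
to `1` makes the two level sets nonempty for every `t < 1` and empty for `t ≥ 1`. -/
theorem prekopaLeindler_normalized {φ ψ h : ℝ → ℝ} (hφ : Measurable φ) (hψ : Measurable ψ)
    (hh : Measurable h) (hφ0 : ∀ x, 0 ≤ φ x) (hψ0 : ∀ x, 0 ≤ ψ x) (hh0 : ∀ x, 0 ≤ h x)
    (hφ1 : ∀ x, φ x ≤ 1) (hψ1 : ∀ x, ψ x ≤ 1) (hφs : ∀ t < 1, ∃ x, t < φ x)
    (hψs : ∀ t < 1, ∃ x, t < ψ x) (H : ∀ a b, φ a * ψ b ≤ h ((a + b) / 2) ^ 2) :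
    (∫⁻ x, ENNReal.ofReal (φ x)) + (∫⁻ x, ENNReal.ofReal (ψ x)) ≤
      2 * ∫⁻ x, ENNReal.ofReal (h x) := by
  have key : ∀ t ∈ Ioi (0 : ℝ), volume {x | t < φ x} + volume {x | t < ψ x} ≤
      2 * volume {x | t < h x} := by
    intro t ht
    rcases lt_or_ge t 1 with h1 | h1
    -- The level sets add up to sums `a + b`, not midpoints; rescaling by `2` is the source of the
    -- factor `2`.
    · have e : volume {x | t < h (x / 2)} = 2 * volume {x | t < h x} := by
        have := Real.volume_preimage_mul_right (a := (1 / 2 : ℝ)) (by norm_num) {x | t < h x}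
        simp only [preimage_ofPred_eq, mul_one_div] at this
        rw [this]; norm_num
      rw [← e]
      refine volume_add_volume_le (measurableSet_lt measurable_const hφ)
        (measurableSet_lt measurable_const hψ) (hφs t h1) (hψs t h1) ?_
      rintro _ ⟨a, ha, b, hb, rfl⟩
      simp only [mem_ofPred_eq] at ha hb ⊢
      have ht' : (0 : ℝ) < t := ht
      by_contra hc
      push Not at hc
      have h2 := H a b
      have h3 := hh0 ((a + b) / 2)
      nlinarith [mul_lt_mul'' ha hb ht'.le ht'.le]
    · have e1 : {x | t < φ x} = ∅ := by
        ext x; simpa using (hφ1 x).trans h1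
      have e2 : {x | t < ψ x} = ∅ := by
        ext x; simpa using (hψ1 x).trans h1
      simp [e1, e2]
  rw [lintegral_eq_lintegral_meas_lt _ (ae_of_all _ hφ0) hφ.aemeasurable,
    lintegral_eq_lintegral_meas_lt _ (ae_of_all _ hψ0) hψ.aemeasurable,
    lintegral_eq_lintegral_meas_lt _ (ae_of_all _ hh0) hh.aemeasurable,
    ← lintegral_const_mul' _ _ (by norm_num), ← lintegral_add_left]
  · exact setLIntegral_mono' measurableSet_Ioi key
  · exact Antitone.measurable fun s t hst => measure_mono fun x hx => lt_of_le_of_lt hst hx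

theorem mul_le_sq_of_add_le {x y z : ℝ≥0∞} (hz : z ≠ ⊤) (h : x + y ≤ 2 * z) : x * y ≤ z ^ 2 := by
  have hz2 : 2 * z ≠ ⊤ := ENNReal.mul_ne_top (by norm_num) hz
  have hx : x ≠ ⊤ := ne_top_of_le_ne_top hz2 (le_self_add.trans h)
  have hy : y ≠ ⊤ := ne_top_of_le_ne_top hz2 (le_add_self.trans h)
  lift x to ℝ≥0 using hx
  lift y to ℝ≥0 using hy
  lift z to ℝ≥0 using hz
  norm_cast at h ⊢
  rw [← NNReal.coe_le_coe] at h ⊢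
  push_cast at h ⊢
  nlinarith [sq_nonneg ((x : ℝ) - y), x.2, y.2, z.2]

/-- Dividing by the suprema `A`, `B` and by `√(AB)` preserves the hypothesis and reduces to the
normalised case; the arithmetic–geometric mean inequality then turns the bound on the sum into one
on the product. -/
theorem prekopaLeindler_of_bounded {φ ψ h : ℝ → ℝ} (hφ : Measurable φ) (hψ : Measurable ψ)
    (hh : Measurable h) (hφ0 : ∀ x, 0 ≤ φ x) (hψ0 : ∀ x, 0 ≤ ψ x) (hh0 : ∀ x, 0 ≤ h x)
    (hφb : BddAbove (range φ)) (hψb : BddAbove (range ψ))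
    (hfin : ∫⁻ x, ENNReal.ofReal (h x) ≠ ⊤) (H : ∀ a b, φ a * ψ b ≤ h ((a + b) / 2) ^ 2) :
    (∫⁻ x, ENNReal.ofReal (φ x)) * (∫⁻ x, ENNReal.ofReal (ψ x)) ≤
      (∫⁻ x, ENNReal.ofReal (h x)) ^ 2 := by
  set A := sSup (range φ)
  set B := sSup (range ψ)
  have hAle : ∀ x, φ x ≤ A := fun x => le_csSup hφb (mem_range_self x)
  have hBle : ∀ x, ψ x ≤ B := fun x => le_csSup hψb (mem_range_self x)
  rcases ((hφ0 0).trans (hAle 0)).eq_or_lt with hA | hA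
  · have : ∀ x, φ x = 0 := fun x => le_antisymm (hA ▸ hAle x) (hφ0 x)
    simp [this]
  rcases ((hψ0 0).trans (hBle 0)).eq_or_lt with hB | hB
  · have : ∀ x, ψ x = 0 := fun x => le_antisymm (hB ▸ hBle x) (hψ0 x)
    simp [this]
  set D := Real.sqrt (A * B)
  have hAB : 0 < A * B := mul_pos hA hB
  have hD : 0 < D := Real.sqrt_pos.2 hAB
  have hD2 : D ^ 2 = A * B := Real.sq_sqrt hAB.le
  have scale : ∀ (f : ℝ → ℝ) (c : ℝ), 0 < c → ∫⁻ x, ENNReal.ofReal (f x) =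
      ENNReal.ofReal c * ∫⁻ x, ENNReal.ofReal (f x / c) := by
    intro f c hc
    rw [← lintegral_const_mul' _ _ ENNReal.ofReal_ne_top]
    congr 1 with x
    rw [← ENNReal.ofReal_mul hc.le, mul_div_cancel₀ _ hc.ne']
  have sup : ∀ (f : ℝ → ℝ), 0 < sSup (range f) → ∀ t < 1, ∃ x, t < f x / sSup (range f) := by
    intro f hf t ht
    obtain ⟨_, ⟨x, rfl⟩, hx⟩ := exists_lt_of_lt_csSup (range_nonempty f)
      (show t * sSup (range f) < sSup (range f) by nlinarith)
    exact ⟨x, by rwa [lt_div_iff₀ hf]⟩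
  have hfin' : ∫⁻ x, ENNReal.ofReal (h x / D) ≠ ⊤ := by
    intro h0
    apply hfin
    rw [scale h D hD, h0, ENNReal.mul_top]
    simpa using hD
  have main := mul_le_sq_of_add_le hfin' <|
    prekopaLeindler_normalized (φ := fun x => φ x / A) (ψ := fun x => ψ x / B)
    (h := fun x => h x / D) (hφ.div_const _) (hψ.div_const _) (hh.div_const _)
    (fun x => div_nonneg (hφ0 x) hA.le) (fun x => div_nonneg (hψ0 x) hB.le)
    (fun x => div_nonneg (hh0 x) hD.le) (fun x => (div_le_one hA).2 (hAle x))
    (fun x => (div_le_one hB).2 (hBle x)) (sup φ hA) (sup ψ hB) (by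
      intro a b
      rw [div_pow, hD2, div_mul_div_comm]
      exact div_le_div_of_nonneg_right (H a b) hAB.le)
  rw [scale φ A hA, scale ψ B hB, scale h D hD, mul_pow, ← ENNReal.ofReal_pow hD.le, hD2,
    mul_mul_mul_comm, ← ENNReal.ofReal_mul hA.le]
  gcongr

theorem lintegral_eq_iSup_min_natCast {α : Type*} [MeasurableSpace α] {μ : Measure α}
    {f : α → ℝ≥0∞} (hf : Measurable f) :
    ∫⁻ x, f x ∂μ = ⨆ k : ℕ, ∫⁻ x, min (f x) k ∂μ := by
  rw [← lintegral_iSup (fun k => hf.min measurable_const)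
    (fun i j hij x => min_le_min le_rfl (by exact_mod_cast hij))]
  congr 1 with x
  have : (⨆ k : ℕ, min (f x) k) = min (f x) (⨆ k : ℕ, (k : ℝ≥0∞)) := (inf_iSup_eq _ _).symm
  rw [this, ENNReal.iSup_natCast]
  simp

/-- The one-dimensional Prékopa–Leindler inequality at the midpoint. -/
theorem prekopaLeindler {φ ψ : ℝ → ℝ≥0∞} {h : ℝ → ℝ} (hφ : Measurable φ) (hψ : Measurable ψ)
    (hh : Measurable h) (hh0 : ∀ x, 0 ≤ h x) (hfin : ∫⁻ x, ENNReal.ofReal (h x) ≠ ⊤)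
    (H : ∀ a b, φ a * ψ b ≤ ENNReal.ofReal (h ((a + b) / 2) ^ 2)) :
    (∫⁻ x, φ x) * (∫⁻ x, ψ x) ≤ (∫⁻ x, ENNReal.ofReal (h x)) ^ 2 := by
  have trunc : ∀ (f : ℝ → ℝ≥0∞) (k : ℕ) (x : ℝ), min (f x) k ≠ ⊤ := fun f k x =>
    ne_top_of_le_ne_top (ENNReal.natCast_ne_top k) (min_le_right _ _)
  have bdd : ∀ (f : ℝ → ℝ≥0∞) (k : ℕ), BddAbove (range fun x => (min (f x) k).toReal) := by
    rintro f k
    refine ⟨k, ?_⟩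
    rintro _ ⟨x, rfl⟩
    simpa using ENNReal.toReal_mono (ENNReal.natCast_ne_top k) (min_le_right (f x) (k : ℝ≥0∞))
  rw [lintegral_eq_iSup_min_natCast hφ, lintegral_eq_iSup_min_natCast hψ, ENNReal.iSup_mul]
  refine iSup_le fun k => ?_
  rw [ENNReal.mul_iSup]
  refine iSup_le fun l => ?_
  have main := prekopaLeindler_of_bounded (φ := fun x => (min (φ x) k).toReal)
    (ψ := fun x => (min (ψ x) l).toReal) (hφ.min measurable_const).ennreal_toReal
    (hψ.min measurable_const).ennreal_toReal hh (fun _ => ENNReal.toReal_nonneg)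
    (fun _ => ENNReal.toReal_nonneg) hh0 (bdd φ k) (bdd ψ l) hfin (by
      intro a b
      rw [← ENNReal.toReal_mul]
      refine ENNReal.toReal_le_of_le_ofReal (sq_nonneg _) (le_trans ?_ (H a b))
      gcongr
      · exact min_le_left _ _
      · exact min_le_left _ _)
  simpa only [ENNReal.ofReal_toReal (trunc _ _ _)] using main

theorem lintegral_Ioi_zero_eq_lintegral_exp (φ : ℝ → ℝ≥0∞) :
    ∫⁻ s in Ioi (0 : ℝ), φ s = ∫⁻ a, ENNReal.ofReal (Real.exp a) * φ (Real.exp a) := by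
  have := lintegral_image_eq_lintegral_abs_deriv_mul (s := univ) MeasurableSet.univ
    (fun x _ => (Real.hasDerivAt_exp x).hasDerivWithinAt) Real.exp_injective.injOn φ
  rw [image_univ, Real.range_exp] at this
  simpa [abs_of_pos (Real.exp_pos _)] using this

theorem lintegral_Ioi_exp_neg_sq_div_two :
    ∫⁻ r in Ioi (0 : ℝ), ENNReal.ofReal (Real.exp (-(r ^ 2) / 2)) =
      ENNReal.ofReal (Real.sqrt (Real.pi / 2)) := by
  have e : (fun r : ℝ => Real.exp (-(r ^ 2) / 2)) = fun r => Real.exp (-(1 / 2) * r ^ 2) := by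
    ext r; ring_nf
  rw [← ofReal_integral_eq_lintegral_ofReal]
  · rw [e, integral_gaussian_Ioi]
    congr 1
    rw [show Real.pi / (1 / 2) = (Real.pi / 2) * 2 ^ 2 by ring, Real.sqrt_mul (by positivity),
      Real.sqrt_sq (by norm_num)]
    ring
  · rw [e]; exact (integrable_exp_neg_mul_sq (by norm_num)).integrableOn
  · exact ae_of_all _ fun r => (Real.exp_pos _).le

/-- With `s = e^a`, `t = e^b`, the product `s t` is the square of the exponential at the midpoint,
so Prékopa–Leindler applies with `h` the Gaussian `√c e^{-r²/2}` in the variable `r = e^x`, Jacobian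
included. The constant is `π / 2 = (∫_0^∞ e^{-r²/2} dr)²`. -/
theorem lintegral_mul_lintegral_Ioi_le {φ ψ : ℝ → ℝ≥0∞} (hφ : Measurable φ) (hψ : Measurable ψ)
    {c : ℝ} (hc : 0 < c)
    (H : ∀ s > 0, ∀ t > 0, φ s * ψ t ≤ ENNReal.ofReal (c * Real.exp (-(s * t)))) :
    (∫⁻ s in Ioi (0 : ℝ), φ s) * (∫⁻ t in Ioi (0 : ℝ), ψ t) ≤
      ENNReal.ofReal (c * (Real.pi / 2)) := by
  set h : ℝ → ℝ := fun a => Real.sqrt c * (Real.exp a * Real.exp (-(Real.exp a ^ 2) / 2))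
  have hint : ∫⁻ a, ENNReal.ofReal (h a) = ENNReal.ofReal (Real.sqrt c * Real.sqrt (Real.pi / 2)) := by
    rw [ENNReal.ofReal_mul (Real.sqrt_nonneg _), ← lintegral_Ioi_exp_neg_sq_div_two,
      lintegral_Ioi_zero_eq_lintegral_exp, ← lintegral_const_mul' _ _ ENNReal.ofReal_ne_top]
    congr 1 with a
    rw [← ENNReal.ofReal_mul (Real.exp_pos _).le, ← ENNReal.ofReal_mul (Real.sqrt_nonneg _)]
  have main := prekopaLeindler (φ := fun a => ENNReal.ofReal (Real.exp a) * φ (Real.exp a))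
    (ψ := fun a => ENNReal.ofReal (Real.exp a) * ψ (Real.exp a)) (h := h) (by fun_prop)
    (by fun_prop) (by fun_prop) (fun x => by positivity) (by rw [hint]; exact ENNReal.ofReal_ne_top)
    (by
      intro a b
      rw [mul_mul_mul_comm, ← ENNReal.ofReal_mul (Real.exp_pos _).le]
      have h1 := H _ (Real.exp_pos a) _ (Real.exp_pos b)
      calc _ ≤ ENNReal.ofReal (Real.exp a * Real.exp b) *
            ENNReal.ofReal (c * Real.exp (-(Real.exp a * Real.exp b))) := by gcongr
        _ = _ := by
          rw [← ENNReal.ofReal_mul (by positivity)]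
          congr 1
          simp only [h, mul_pow, Real.sq_sqrt hc.le, ← Real.exp_add, ← Real.exp_nat_mul]
          rw [mul_left_comm, ← Real.exp_add]
          congr 2
          push_cast
          rw [show (2 : ℝ) * ((a + b) / 2) = a + b by ring]
          ring)
  rw [hint, ← ENNReal.ofReal_pow (by positivity), mul_pow, Real.sq_sqrt hc.le,
    Real.sq_sqrt (by positivity)] at main
  rwa [lintegral_Ioi_zero_eq_lintegral_exp, lintegral_Ioi_zero_eq_lintegral_exp]

theorem lintegral_mul_lintegral_Iio_le {φ ψ : ℝ → ℝ≥0∞} (hφ : Measurable φ) (hψ : Measurable ψ)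
    {c : ℝ} (hc : 0 < c)
    (H : ∀ s < 0, ∀ t < 0, φ s * ψ t ≤ ENNReal.ofReal (c * Real.exp (-(s * t)))) :
    (∫⁻ s in Iio (0 : ℝ), φ s) * (∫⁻ t in Iio (0 : ℝ), ψ t) ≤
      ENNReal.ofReal (c * (Real.pi / 2)) := by
  have e : ∀ f : ℝ → ℝ≥0∞, ∫⁻ s in Iio (0 : ℝ), f s = ∫⁻ s in Ioi (0 : ℝ), f (-s) := by
    intro f
    have := (Measure.measurePreserving_neg (volume : Measure ℝ)).setLIntegral_comp_preimage_emb
      (MeasurableEquiv.neg ℝ).measurableEmbedding f (Iio 0)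
    simpa using this.symm
  rw [e, e]
  refine lintegral_mul_lintegral_Ioi_le (by fun_prop) (by fun_prop) hc fun s hs t ht => ?_
  simpa using H (-s) (by simpa using hs) (-t) (by simpa using ht)

/-! ### The functional Blaschke–Santaló inequality -/

/-- The functional Santaló inequality with constant `C` for the bilinear form `B` on `W`. -/
def FunctionalSantalo (W : Type*) [NormedAddCommGroup W] [NormedSpace ℝ W] [MeasureSpace W]
    (B : W →L[ℝ] W →L[ℝ] ℝ) (C : ℝ) : Prop :=
  ∀ f g : W → ℝ≥0∞, Measurable f → Measurable g → ∫⁻ x, f x ≠ ⊤ →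
    Integrable (fun x => x) (volume.withDensity f) → ∫ x, x ∂(volume.withDensity f) = 0 →
    (∀ x y, f x * g y ≤ ENNReal.ofReal (Real.exp (-B x y))) →
    (∫⁻ x, f x) * (∫⁻ y, g y) ≤ ENNReal.ofReal C

/-- Without atoms the distribution function is continuous, so a median that splits the mass exactly
exists by the intermediate value theorem. -/
theorem exists_measure_Iic_eq_half (ρ : Measure ℝ) [IsFiniteMeasure ρ] [NullSingletonClass ρ] :
    ∃ m, ρ.real (Iic m) = ρ.real univ / 2 := by
  have hcont : Continuous fun b => ρ.real (Iic b) := by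
    have h1 := intervalIntegral.continuous_primitive (μ := ρ) (f := fun _ => (1 : ℝ))
      (fun a b => intervalIntegrable_const) 0
    have h2 : (fun b => ρ.real (Iic b)) = fun b => (∫ _ in (0 : ℝ)..b, (1 : ℝ) ∂ρ) + ρ.real (Iic 0) := by
      ext b
      have := intervalIntegral.integral_Iic_sub_Iic (μ := ρ) (f := fun _ => (1 : ℝ)) (a := 0) (b := b)
        (integrable_const _).integrableOn (integrable_const _).integrableOn
      simp only [setIntegral_const, smul_eq_mul, mul_one] at this
      linarith
    rw [h2]
    exact h1.add continuous_const
  rcases (measureReal_nonneg (μ := ρ) (s := univ)).eq_or_lt with h0 | h0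
  · refine ⟨0, ?_⟩
    have := measureReal_mono (μ := ρ) (subset_univ (Iic (0 : ℝ)))
    have := measureReal_nonneg (μ := ρ) (s := Iic 0)
    linarith
  have htop : Filter.Tendsto (fun b => ρ.real (Iic b)) Filter.atTop (nhds (ρ.real univ)) :=
    (ENNReal.tendsto_toReal (measure_ne_top _ _)).comp (tendsto_measure_Iic_atTop ρ)
  have hbot : Filter.Tendsto (fun b => ρ.real (Iic b)) Filter.atBot (nhds 0) := by
    have h1 : Filter.Tendsto (fun b => ρ.real (Ici b)) Filter.atBot (nhds (ρ.real univ)) :=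
      (ENNReal.tendsto_toReal (measure_ne_top _ _)).comp (tendsto_measure_Ici_atBot ρ)
    have h2 : (fun b => ρ.real (Iic b)) = fun b => ρ.real univ - ρ.real (Ici b) := by
      ext b
      rw [← measureReal_congr (Ioi_ae_eq_Ici (a := b)), ← compl_Iic, measureReal_compl measurableSet_Iic]
      ring
    rw [h2, ← sub_self (ρ.real univ)]
    exact h1.const_sub _
  obtain ⟨b1, h1⟩ := (htop.eventually (lt_mem_nhds (half_lt_self h0))).exists
  obtain ⟨b2, h2⟩ := (hbot.eventually (gt_mem_nhds (half_pos h0))).exists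
  exact mem_range_of_exists_le_of_exists_ge hcont ⟨b2, h2.le⟩ ⟨b1, h1.le⟩

/-- Since `e^t ≥ 1 + t` and linear forms integrate to zero against a centred measure, exponential
tilting cannot decrease the mass. -/
theorem measure_univ_le_lintegral_exp {W : Type*} [NormedAddCommGroup W] [NormedSpace ℝ W]
    [CompleteSpace W]
    [MeasurableSpace W] [BorelSpace W] (ρ : Measure W) [IsFiniteMeasure ρ]
    (hint : Integrable (fun x => x) ρ) (h0 : ∫ x, x ∂ρ = 0) (ℓ : W →L[ℝ] ℝ) :
    ρ univ ≤ ∫⁻ x, ENNReal.ofReal (Real.exp (ℓ x)) ∂ρ := by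
  by_cases hfin : ∫⁻ x, ENNReal.ofReal (Real.exp (ℓ x)) ∂ρ = ⊤
  · simp [hfin]
  have hm : Measurable fun x => Real.exp (ℓ x) := by fun_prop
  have hexp : Integrable (fun x => Real.exp (ℓ x)) ρ := by
    refine ⟨hm.aestronglyMeasurable, ?_⟩
    rw [hasFiniteIntegral_iff_ofReal (ae_of_all _ fun x => (Real.exp_pos _).le)]
    exact lt_top_iff_ne_top.2 hfin
  rw [← ofReal_integral_eq_lintegral_ofReal hexp (ae_of_all _ fun x => (Real.exp_pos _).le)]
  have hl : Integrable (fun x => ℓ x) ρ := ℓ.integrable_comp hint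
  have e : ∫ x, ℓ x ∂ρ = 0 := by
    rw [ℓ.integral_comp_comm hint, h0, map_zero]
  have : ρ.real univ ≤ ∫ x, Real.exp (ℓ x) ∂ρ := by
    calc ρ.real univ = ∫ x, (ℓ x + 1) ∂ρ := by
          rw [integral_add hl (integrable_const _), e]; simp
      _ ≤ _ := integral_mono (hl.add (integrable_const _)) hexp fun x => Real.add_one_le_exp _
  rw [← ofReal_measureReal]
  exact ENNReal.ofReal_le_ofReal this

section step

variable {W : Type*} [NormedAddCommGroup W] [NormedSpace ℝ W] [FiniteDimensional ℝ W]
  [MeasureSpace W] [BorelSpace W] [(volume : Measure W).IsAddHaarMeasure]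

/-- The bilinear form `(s, x), (t, y) ↦ s * t + B x y` on `ℝ × W`. -/
def prodForm (B : W →L[ℝ] W →L[ℝ] ℝ) : (ℝ × W) →L[ℝ] (ℝ × W) →L[ℝ] ℝ :=
  (ContinuousLinearMap.mul ℝ ℝ).bilinearComp (ContinuousLinearMap.fst ℝ ℝ W)
      (ContinuousLinearMap.fst ℝ ℝ W) +
    B.bilinearComp (ContinuousLinearMap.snd ℝ ℝ W) (ContinuousLinearMap.snd ℝ ℝ W)

omit [FiniteDimensional ℝ W] [MeasureSpace W] [BorelSpace W]
  [(volume : Measure W).IsAddHaarMeasure] in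
theorem prodForm_apply (B : W →L[ℝ] W →L[ℝ] ℝ) (p q : ℝ × W) :
    prodForm B p q = p.1 * q.1 + B p.2 q.2 := rfl

/-- Slanted coordinates based at `(m, z)` with first axis `(1, w)`. Paired with the dual shear `(t,
y) ↦ (t - B w y, y)`, they give `s t + B x y` plus the pairing of `(m, z)` with the second point, a
term that a tilt absorbs. -/
theorem measurePreserving_shear_right (m : ℝ) (z w : W) :
    MeasurePreserving (fun p : ℝ × W => (m + p.1, z + p.2 + p.1 • w)) volume volume := by
  have := (measurePreserving_add_left (volume : Measure ℝ) m).skew_product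
    (g := fun s x => (z + s • w) + x) (μc := (volume : Measure W)) (μd := (volume : Measure W))
    (Continuous.measurable (by fun_prop)) (ae_of_all _ fun s => (measurePreserving_add_left volume (z + s • w)).map_eq)
  have e : (fun p : ℝ × W => (m + p.1, z + p.2 + p.1 • w)) =
      fun p => (m + p.1, (z + p.1 • w) + p.2) := by
    funext p
    exact Prod.ext rfl (by simp only; abel)
  rw [e]
  exact this

theorem measurePreserving_shear_left (ℓ : W →L[ℝ] ℝ) :
    MeasurePreserving (fun p : ℝ × W => (p.1 - ℓ p.2, p.2)) volume volume := by
  have h := (MeasurePreserving.id (volume : Measure W)).skew_product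
    (g := fun y t => -ℓ y + t) (μc := (volume : Measure ℝ)) (μd := (volume : Measure ℝ))
    (by fun_prop) (ae_of_all _ fun y => (measurePreserving_add_left volume (-ℓ y)).map_eq)
  have h2 := (Measure.measurePreserving_swap (μ := (volume : Measure W))
    (ν := (volume : Measure ℝ))).comp (h.comp (Measure.measurePreserving_swap
      (μ := (volume : Measure ℝ)) (ν := (volume : Measure W))))
  have e : (fun p : ℝ × W => (p.1 - ℓ p.2, p.2)) = fun p => (-ℓ p.2 + p.1, p.2) := by
    funext p
    exact Prod.ext (sub_eq_neg_add _ _) rfl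
  rw [e]
  exact h2

/-- The marginal of a piece of `g` along the direction `(1, w)` is a pushforward, so its mass,
integrability and barycentre can be read off from `g`. -/
theorem withDensity_lintegral_shear {g : ℝ × W → ℝ≥0∞} (hg : Measurable g) (m : ℝ) (z w : W)
    {S : Set ℝ} (hS : MeasurableSet S) :
    (volume : Measure W).withDensity (fun x => ∫⁻ s in S, g (m + s, z + x + s • w)) =
      Measure.map (fun p : ℝ × W => p.2 - z - (p.1 - m) • w)
        ((volume.withDensity g).restrict {p | p.1 - m ∈ S}) := by
  have hT : Measurable fun p : ℝ × W => p.2 - z - (p.1 - m) • w := by fun_prop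
  have hH : MeasurableSet {p : ℝ × W | p.1 - m ∈ S} :=
    (measurable_fst.sub_const m) hS
  ext A hA
  have hΘ := measurePreserving_shear_right (W := W) m z w
  rw [Measure.map_apply hT hA, Measure.restrict_apply (hT hA), withDensity_apply _ hA,
    withDensity_apply _ ((hT hA).inter hH), ← hΘ.setLIntegral_comp_preimage ((hT hA).inter hH) hg]
  have e : (fun p : ℝ × W => (m + p.1, z + p.2 + p.1 • w)) ⁻¹'
      ((fun p : ℝ × W => p.2 - z - (p.1 - m) • w) ⁻¹' A ∩ {p | p.1 - m ∈ S}) = S ×ˢ A := by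
    ext p
    simp only [mem_preimage, mem_inter_iff, mem_ofPred_eq, mem_prod, add_sub_cancel_left]
    rw [show z + p.2 + p.1 • w - z - p.1 • w = p.2 by abel, and_comm]
  rw [e, Measure.volume_eq_prod, ← Measure.prod_restrict, lintegral_prod_symm']
  exact hg.comp (by fun_prop)

/-- One half of the induction step. On each pair of fibres the one-dimensional inequality `hS1`
bounds the product of the marginals `K` of `g` and `L` of the tilted `f` by `(π / 2) e^{-B x y}`.
The slant `w` has been chosen so that `K` is centred, and the inductive hypothesis on `W` applies.
-/
theorem functionalSantalo_half {B : W →L[ℝ] W →L[ℝ] ℝ} (hB : ∀ x y, B x y = B y x) {C : ℝ}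
    (hW : FunctionalSantalo W B C) {f g : ℝ × W → ℝ≥0∞} (hf : Measurable f)
    (hg : Measurable g) (hgfin : ∫⁻ p, g p ≠ ⊤)
    (hgint : Integrable (fun p => p) (volume.withDensity g))
    (H : ∀ p q, f p * g q ≤ ENNReal.ofReal (Real.exp (-prodForm B p q))) (m : ℝ) (z w : W)
    {S : Set ℝ} (hS : MeasurableSet S)
    (hS1 : ∀ φ ψ : ℝ → ℝ≥0∞, Measurable φ → Measurable ψ → ∀ c : ℝ, 0 < c →
      (∀ s ∈ S, ∀ t ∈ S, φ s * ψ t ≤ ENNReal.ofReal (c * Real.exp (-(s * t)))) →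
      (∫⁻ s in S, φ s) * (∫⁻ t in S, ψ t) ≤ ENNReal.ofReal (c * (Real.pi / 2)))
    (hbar : ∫ p in {p : ℝ × W | p.1 - m ∈ S}, (p.2 - z - (p.1 - m) • w)
      ∂(volume.withDensity g) = 0) :
    (volume.withDensity g {p | p.1 - m ∈ S}) *
      (∫⁻ p in {p : ℝ × W | p.1 + B w p.2 ∈ S},
        f p * ENNReal.ofReal (Real.exp (prodForm B (m, z) p))) ≤
      ENNReal.ofReal (C * (Real.pi / 2)) := by
  have hpi : 0 < Real.pi / 2 := by positivity
  set μ := (volume : Measure (ℝ × W)).withDensity g with hμ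
  set F : ℝ × W → ℝ≥0∞ := fun p => f p * ENNReal.ofReal (Real.exp (prodForm B (m, z) p)) with hF
  have hFm : Measurable F := by
    refine hf.mul (ENNReal.measurable_ofReal.comp (Real.measurable_exp.comp ?_))
    exact (prodForm B (m, z)).continuous.measurable
  set K : W → ℝ≥0∞ := fun x => ∫⁻ s in S, g (m + s, z + x + s • w) with hK
  set L : W → ℝ≥0∞ := fun y => ∫⁻ t in S, F (t - B w y, y) with hL
  have hKm : Measurable K := by
    refine Measurable.lintegral_prod_left' (f := fun p : ℝ × W => g (m + p.1, z + p.2 + p.1 • w)) ?_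
    exact hg.comp (by fun_prop)
  have hLm : Measurable L := by
    refine Measurable.lintegral_prod_left' (f := fun p : ℝ × W => F (p.1 - B w p.2, p.2)) ?_
    exact hFm.comp (by fun_prop)
  have hKd := withDensity_lintegral_shear hg m z w hS
  have hT : Measurable fun p : ℝ × W => p.2 - z - (p.1 - m) • w := by fun_prop
  have : IsFiniteMeasure μ := isFiniteMeasure_withDensity hgfin
  have hTint : Integrable (fun p : ℝ × W => p.2 - z - (p.1 - m) • w) μ := by
    refine (hgint.snd.sub (integrable_const z)).sub ?_
    exact (hgint.fst.sub (integrable_const m)).smul_const w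
  have hKint : ∫⁻ x, K x = μ {p | p.1 - m ∈ S} := by
    have := congrArg (fun ρ => ρ univ) hKd
    simpa [withDensity_apply, Measure.map_apply hT MeasurableSet.univ] using this
  have hLint : ∫⁻ y, L y = ∫⁻ p in {p : ℝ × W | p.1 + B w p.2 ∈ S}, F p := by
    have hΘ := measurePreserving_shear_left (B w)
    have hm : MeasurableSet {p : ℝ × W | p.1 + B w p.2 ∈ S} := by
      have : Measurable fun p : ℝ × W => p.1 + B w p.2 := by fun_prop
      exact this hS
    rw [← hΘ.setLIntegral_comp_preimage hm hFm]
    have e : (fun p : ℝ × W => (p.1 - B w p.2, p.2)) ⁻¹' {p | p.1 + B w p.2 ∈ S} = S ×ˢ univ := by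
      ext p; simp
    rw [e, Measure.volume_eq_prod, ← Measure.prod_restrict, lintegral_prod_symm',
      Measure.restrict_univ]
    exact hFm.comp (by fun_prop)
  have main := hW K (fun y => ENNReal.ofReal (Real.pi / 2)⁻¹ * L y) hKm (hLm.const_mul _)
    (by rw [hKint]; exact measure_ne_top _ _)
    (by
      rw [hKd, integrable_map_measure (by fun_prop) hT.aemeasurable]
      exact hTint.restrict)
    (by
      rw [hKd, integral_map hT.aemeasurable (by fun_prop)]
      exact hbar)
    (by
      intro x y
      have h1 := hS1 (fun s => g (m + s, z + x + s • w)) (fun t => F (t - B w y, y))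
        (hg.comp (by fun_prop)) (hFm.comp (by fun_prop)) (Real.exp (-B x y)) (Real.exp_pos _) (by
          intro s _ t _
          -- The tilt cancels every term involving the base point, and symmetry of `B` cancels `s B
          -- w y`; what is left of the exponent is `-(s t) - B x y`.
          have h2 := H (t - B w y, y) (m + s, z + x + s • w)
          simp only [hF]
          rw [← mul_assoc, mul_comm (g _)]
          calc _ ≤ _ := mul_le_mul_left h2 _
            _ = _ := by
              rw [← ENNReal.ofReal_mul (Real.exp_pos _).le, ← Real.exp_add, ← Real.exp_add]
              congr 2
              simp only [prodForm_apply, map_add, map_smul, smul_eq_mul]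
              rw [hB y z, hB y x, hB y w]
              ring)
      calc K x * (ENNReal.ofReal (Real.pi / 2)⁻¹ * L y)
          = ENNReal.ofReal (Real.pi / 2)⁻¹ * (K x * L y) := by ring
        _ ≤ ENNReal.ofReal (Real.pi / 2)⁻¹ * ENNReal.ofReal (Real.exp (-B x y) * (Real.pi / 2)) := by
          gcongr
        _ = _ := by
          rw [← ENNReal.ofReal_mul (by positivity)]
          congr 1
          field_simp)
  rw [hKint, lintegral_const_mul _ hLm, hLint] at main
  calc _ = ENNReal.ofReal (Real.pi / 2) * (μ {p | p.1 - m ∈ S} *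
        (ENNReal.ofReal (Real.pi / 2)⁻¹ * ∫⁻ p in {p : ℝ × W | p.1 + B w p.2 ∈ S}, F p)) := by
        rw [mul_left_comm (μ _), ← mul_assoc, ← ENNReal.ofReal_mul hpi.le,
          mul_inv_cancel₀ hpi.ne', ENNReal.ofReal_one, one_mul]
    _ ≤ ENNReal.ofReal (Real.pi / 2) * ENNReal.ofReal C := by gcongr
    _ = _ := by rw [← ENNReal.ofReal_mul hpi.le, mul_comm]

theorem volume_setOf_fst_add_eq_zero (ℓ : W →L[ℝ] ℝ) (m : ℝ) :
    volume {p : ℝ × W | p.1 + ℓ p.2 = m} = 0 := by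
  have h := (measurePreserving_shear_left (W := W) (-ℓ)).measure_preimage
    (s := {m} ×ˢ (univ : Set W)) ((measurableSet_singleton m).prod MeasurableSet.univ).nullMeasurableSet
  rw [Measure.volume_eq_prod, Measure.prod_prod, Real.volume_singleton, zero_mul] at h
  rw [← h, Measure.volume_eq_prod]
  congr 1
  ext p
  simp

/-- Halve the mass of `g` by the hyperplane with first coordinate `m`, and let the line through the
barycentres of the halves determine its point `(m, z)` and direction `(1, w)`. Both half
inequalities then hold for the same tilted `f`, whose mass is at least that of `f` because `f` is
centred. -/
theorem FunctionalSantalo.prod_aux {B : W →L[ℝ] W →L[ℝ] ℝ} (hB : ∀ x y, B x y = B y x) {C : ℝ}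
    (hW : FunctionalSantalo W B C) {f g : ℝ × W → ℝ≥0∞} (hf : Measurable f)
    (hg : Measurable g) (hfin : ∫⁻ p, f p ≠ ⊤)
    (hfint : Integrable (fun p => p) (volume.withDensity f))
    (hbar : ∫ p, p ∂(volume.withDensity f) = 0) (hgfin : ∫⁻ p, g p ≠ ⊤)
    (hgint : Integrable (fun p => p) (volume.withDensity g))
    (H : ∀ p q, f p * g q ≤ ENNReal.ofReal (Real.exp (-prodForm B p q))) :
    (∫⁻ p, f p) * (∫⁻ p, g p) ≤ ENNReal.ofReal (2 * Real.pi * C) := by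
  set μ := (volume : Measure (ℝ × W)).withDensity g with hμ
  have hac : μ ≪ volume := withDensity_absolutelyContinuous _ _
  have : IsFiniteMeasure μ := isFiniteMeasure_withDensity hgfin
  have : IsFiniteMeasure ((volume : Measure (ℝ × W)).withDensity f) :=
    isFiniteMeasure_withDensity hfin
  have hMu : ∫⁻ p, g p = μ univ := by simp [hμ, withDensity_apply]
  have hnull (m : ℝ) : μ {p : ℝ × W | p.1 = m} = 0 := by
    have := volume_setOf_fst_add_eq_zero (W := W) 0 m
    simp only [zero_apply, add_zero] at this
    exact hac this
  have : NullSingletonClass (μ.map Prod.fst) := ⟨fun m => by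
    rw [Measure.map_apply measurable_fst (measurableSet_singleton m)]
    exact hnull m⟩
  obtain ⟨m, hm⟩ := exists_measure_Iic_eq_half (μ.map Prod.fst)
  rw [map_measureReal_apply measurable_fst measurableSet_Iic,
    map_measureReal_apply measurable_fst MeasurableSet.univ, preimage_univ] at hm
  set P : Set (ℝ × W) := {p | p.1 - m ∈ Ioi 0} with hP
  set N : Set (ℝ × W) := {p | p.1 - m ∈ Iio 0} with hN
  have hPm : MeasurableSet P := (measurable_fst.sub_const m) measurableSet_Ioi
  have hNm : MeasurableSet N := (measurable_fst.sub_const m) measurableSet_Iio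
  have hPc : P = (Prod.fst ⁻¹' Iic m)ᶜ := by ext p; simp [hP]
  have hPM : μ.real P = μ.real univ / 2 := by
    rw [hPc, measureReal_compl (measurable_fst measurableSet_Iic), hm]
    ring
  have hNM : μ.real N = μ.real univ / 2 := by
    rw [← hm]
    refine measureReal_congr ?_
    have : ∀ᵐ p ∂μ, p ∉ {p : ℝ × W | p.1 = m} := measure_eq_zero_iff_ae_notMem.1 (hnull m)
    filter_upwards [this] with p hp
    refine propext ?_
    change p.1 - m < 0 ↔ p.1 ≤ m
    rw [sub_neg]
    exact ⟨le_of_lt, fun h => lt_of_le_of_ne h hp⟩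
  rcases eq_or_ne (μ univ) 0 with h0 | h0
  · rw [hMu, h0, mul_zero]; exact zero_le
  have hMpos : 0 < μ.real univ := ENNReal.toReal_pos h0 (measure_ne_top _ _)
  set h := μ.real univ / 2 with hh
  have hhpos : 0 < h := by positivity
  have h1int : Integrable (fun p : ℝ × W => p.1 - m) μ := hgint.fst.sub (integrable_const m)
  set a := ∫ p in P, (p.1 - m) ∂μ with ha
  set a' := ∫ p in N, (p.1 - m) ∂μ with ha'
  have hapos : 0 < a := by
    rw [ha, setIntegral_pos_iff_support_of_nonneg_ae _ h1int.integrableOn]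
    · have : (Function.support fun p : ℝ × W => p.1 - m) ∩ P = P := by
        refine inter_eq_right.2 fun p hp => ?_
        exact (ne_of_gt hp : p.1 - m ≠ 0)
      rw [this]
      refine pos_iff_ne_zero.2 fun h1 => ?_
      simp [measureReal_def, h1] at hPM
      linarith
    · filter_upwards [ae_restrict_mem hPm] with p hp
      exact le_of_lt hp
  have ha'neg : a' ≤ 0 := setIntegral_nonpos hNm fun p hp => le_of_lt hp
  set Ip := ∫ p in P, p.2 ∂μ with hIp
  set Im := ∫ p in N, p.2 ∂μ with hIm
  -- Centring the two slanted marginals means `Ip = h z + a w` and `Im = h z + a' w`; as `a > 0 ≥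
  -- a'`, this system has the solution below.
  set w := (a - a')⁻¹ • (Ip - Im) with hw
  set z := h⁻¹ • (Ip - a • w) with hz
  have hzw : h • z = Ip - a • w := by rw [hz, smul_inv_smul₀ hhpos.ne']
  have hw' : (a - a') • w = Ip - Im := by
    rw [hw, smul_inv_smul₀ (by linarith : a - a' ≠ 0)]
  have hcalc (S : Set (ℝ × W)) : ∫ p in S, (p.2 - z - (p.1 - m) • w) ∂μ =
      (∫ p in S, p.2 ∂μ) - μ.real S • z - (∫ p in S, (p.1 - m) ∂μ) • w := by
    have i1 : Integrable (fun p : ℝ × W => p.2) (μ.restrict S) := hgint.snd.restrict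
    have i2 : Integrable (fun _ : ℝ × W => z) (μ.restrict S) := integrable_const z
    have i3 : Integrable (fun p : ℝ × W => (p.1 - m) • w) (μ.restrict S) :=
      (h1int.smul_const w).restrict
    have i12 : Integrable (fun p : ℝ × W => p.2 - z) (μ.restrict S) := i1.sub i2
    rw [integral_sub i12 i3, integral_sub i1 i2, setIntegral_const,
      integral_smul_const (fun p : ℝ × W => p.1 - m) w]
  have hp := functionalSantalo_half hB hW hf hg hgfin hgint H m z w measurableSet_Ioi
    (fun φ ψ hφ hψ c hc Hc => lintegral_mul_lintegral_Ioi_le hφ hψ hc Hc)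
    (by rw [hcalc, hPM, hzw, ← ha, ← hIp]; abel)
  have hn := functionalSantalo_half hB hW hf hg hgfin hgint H m z w measurableSet_Iio
    (fun φ ψ hφ hψ c hc Hc => lintegral_mul_lintegral_Iio_le hφ hψ hc Hc)
    (by
      rw [hcalc, hNM, hzw, ← ha', ← hIm]
      rw [sub_smul] at hw'
      have : Ip = (a • w - a' • w) + Im := by rw [hw']; abel
      rw [this]; abel)
  set F : ℝ × W → ℝ≥0∞ := fun p => f p * ENNReal.ofReal (Real.exp (prodForm B (m, z) p)) with hF
  have hFf : ∫⁻ p, f p ≤ ∫⁻ p, F p := by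
    have := measure_univ_le_lintegral_exp _ hfint hbar (prodForm B (m, z))
    rw [lintegral_withDensity_eq_lintegral_mul _ hf (by fun_prop)] at this
    simpa [withDensity_apply] using this
  have hFsplit : ∫⁻ p, F p ≤ (∫⁻ p in {p : ℝ × W | p.1 + B w p.2 ∈ Ioi 0}, F p) +
      ∫⁻ p in {p : ℝ × W | p.1 + B w p.2 ∈ Iio 0}, F p := by
    rw [← setLIntegral_univ]
    refine le_trans (le_of_eq ?_) (lintegral_union_le _ _ _)
    refine setLIntegral_congr ?_
    have h1 : ∀ᵐ p : ℝ × W, p ∉ {p : ℝ × W | p.1 + B w p.2 = 0} :=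
      measure_eq_zero_iff_ae_notMem.1 (volume_setOf_fst_add_eq_zero (B w) 0)
    filter_upwards [h1] with p hp
    refine propext (iff_of_true trivial ?_)
    exact (lt_or_gt_of_ne hp).symm
  have hPN : μ N = μ P := by
    rw [← ofReal_measureReal, ← ofReal_measureReal, hPM, hNM]
  have hM : μ univ = 2 * μ P := by
    rw [← ofReal_measureReal (s := univ), ← ofReal_measureReal (s := P), hPM,
      show (2 : ℝ≥0∞) = ENNReal.ofReal 2 by norm_num, ← ENNReal.ofReal_mul (by norm_num)]
    congr 1
    ring
  rw [hPN] at hn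
  -- Each half carries half the mass of `g`, so the total is at most `2 (C π/2 + C π/2) = 2 π C`.
  calc (∫⁻ p, f p) * (∫⁻ p, g p) = 2 * (μ P * ∫⁻ p, f p) := by rw [hMu, hM]; ring
    _ ≤ 2 * (μ P * ∫⁻ p, F p) := by gcongr
    _ ≤ 2 * (μ P * ((∫⁻ p in {p : ℝ × W | p.1 + B w p.2 ∈ Ioi 0}, F p) +
      ∫⁻ p in {p : ℝ × W | p.1 + B w p.2 ∈ Iio 0}, F p)) := by gcongr
    _ ≤ 2 * (ENNReal.ofReal (C * (Real.pi / 2)) + ENNReal.ofReal (C * (Real.pi / 2))) := by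
      rw [mul_add]
      gcongr
    _ = 2 * (2 * ENNReal.ofReal (C * (Real.pi / 2))) := by rw [two_mul (ENNReal.ofReal _)]
    _ = _ := by
      rw [show (2 : ℝ≥0∞) = ENNReal.ofReal 2 by norm_num, ← ENNReal.ofReal_mul (by norm_num),
        ← ENNReal.ofReal_mul (by norm_num)]
      congr 1
      ring

/-- The induction step for the functional Santaló inequality: from `W` to `ℝ × W`. -/
theorem FunctionalSantalo.prod {B : W →L[ℝ] W →L[ℝ] ℝ} (hB : ∀ x y, B x y = B y x) {C : ℝ}
    (hW : FunctionalSantalo W B C) :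
    FunctionalSantalo (ℝ × W) (prodForm B) (2 * Real.pi * C) := by
  intro f g hf hg hfin hfint hbar H
  -- The argument needs finite mass and first moments of `g`, which are not assumed: truncate in
  -- height and in space, then use monotone convergence.
  set G : ℕ → ℝ × W → ℝ≥0∞ := fun k => (closedBall 0 k).indicator fun p => min (g p) k with hG
  have hGm (k : ℕ) : Measurable (G k) :=
    (hg.min measurable_const).indicator isClosed_closedBall.measurableSet
  have hGg (k : ℕ) (p : ℝ × W) : G k p ≤ g p :=
    (indicator_le_self _ _ p).trans (min_le_left _ _)
  have hmono : Monotone G := by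
    intro i j hij p
    by_cases hp : p ∈ closedBall (0 : ℝ × W) i
    · have hp' : p ∈ closedBall (0 : ℝ × W) j :=
        closedBall_subset_closedBall (by exact_mod_cast hij) hp
      simp only [hG, indicator_of_mem hp, indicator_of_mem hp']
      exact min_le_min le_rfl (by exact_mod_cast hij)
    · simp only [hG, indicator_of_notMem hp]
      exact zero_le
  have hsup : ∫⁻ p, g p = ⨆ k, ∫⁻ p, G k p := by
    rw [lintegral_eq_iSup_min_natCast hg]
    rw [← lintegral_iSup (fun k => hg.min measurable_const)
      (fun i j hij p => min_le_min le_rfl (by exact_mod_cast hij)), ← lintegral_iSup hGm hmono]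
    congr 1 with p
    refine le_antisymm (iSup_le fun k => ?_) (iSup_mono fun k => indicator_le_self _ _ p)
    refine le_iSup_of_le (max k ⌈‖p‖⌉₊) ?_
    have hp : p ∈ closedBall (0 : ℝ × W) ((max k ⌈‖p‖⌉₊ : ℕ) : ℝ) := by
      rw [mem_closedBall_zero_iff]
      exact (Nat.le_ceil _).trans (by exact_mod_cast le_max_right _ _)
    simp only [hG, indicator_of_mem hp]
    exact min_le_min le_rfl (by exact_mod_cast le_max_left _ _)
  rw [hsup, ENNReal.mul_iSup]
  refine iSup_le fun k => ?_
  have hGfin : ∫⁻ p, G k p ≠ ⊤ := by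
    rw [lintegral_indicator isClosed_closedBall.measurableSet]
    refine ne_top_of_le_ne_top ?_ (setLIntegral_mono measurable_const fun p _ => min_le_right (g p) k)
    rw [setLIntegral_const]
    exact ENNReal.mul_ne_top (ENNReal.natCast_ne_top k) (isCompact_closedBall _ _).measure_ne_top
  refine hW.prod_aux hB hf (hGm k) hfin hfint hbar hGfin ?_ fun p q =>
    (mul_le_mul_right (hGg k q) _).trans (H p q)
  have : IsFiniteMeasure ((volume : Measure (ℝ × W)).withDensity (G k)) :=
    isFiniteMeasure_withDensity hGfin
  refine Integrable.of_bound measurable_id.aestronglyMeasurable (k : ℝ) ?_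
  rw [ae_withDensity_iff (hGm k)]
  refine ae_of_all _ fun p hp => ?_
  simpa using mem_of_indicator_ne_zero hp

end step

theorem FunctionalSantalo.congr {W V : Type*} [NormedAddCommGroup W] [NormedSpace ℝ W]
    [MeasureSpace W] [NormedAddCommGroup V] [NormedSpace ℝ V] [MeasureSpace V] [BorelSpace W]
    [BorelSpace V] [FiniteDimensional ℝ W] [FiniteDimensional ℝ V]
    {B : W →L[ℝ] W →L[ℝ] ℝ} {B' : V →L[ℝ] V →L[ℝ] ℝ} {C : ℝ} (e : V ≃L[ℝ] W)
    (he : MeasurePreserving e volume volume) (hB : ∀ x y, B (e x) (e y) = B' x y)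
    (hW : FunctionalSantalo W B C) : FunctionalSantalo V B' C := by
  intro f g hf hg hfin hfint hbar H
  have hes : MeasurePreserving e.symm (volume : Measure W) (volume : Measure V) :=
    he.symm e.toHomeomorph.toMeasurableEquiv
  have hmap : (volume : Measure W).withDensity (f ∘ e.symm) = (volume.withDensity f).map e := by
    ext A hA
    rw [Measure.map_apply e.continuous.measurable hA, withDensity_apply _ hA,
      withDensity_apply _ (e.continuous.measurable hA)]
    rw [← he.setLIntegral_comp_preimage hA (hf.comp e.symm.continuous.measurable)]
    simp
  have e1 (φ : V → ℝ≥0∞) (hφ : Measurable φ) : ∫⁻ x, (φ ∘ e.symm) x = ∫⁻ x, φ x :=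
    hes.lintegral_comp hφ
  have main := hW (f ∘ e.symm) (g ∘ e.symm) (hf.comp e.symm.continuous.measurable)
    (hg.comp e.symm.continuous.measurable)
    (by rw [e1 f hf]; exact hfin)
    (by
      rw [hmap, integrable_map_measure (by fun_prop) e.continuous.aemeasurable]
      exact (e : V →L[ℝ] W).integrable_comp hfint)
    (by
      rw [hmap, integral_map e.continuous.aemeasurable (by fun_prop)]
      have := (e : V →L[ℝ] W).integral_comp_comm hfint
      simp only [ContinuousLinearEquiv.coe_coe] at this
      rw [this, hbar, map_zero])
    (by
      intro x y
      have := hB (e.symm x) (e.symm y)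
      simp only [ContinuousLinearEquiv.apply_symm_apply] at this
      rw [this]
      exact H _ _)
  rwa [e1 f hf, e1 g hg] at main

/-- The base case is a single point of mass one, with constant `1`; each further coordinate
contributes `2π`. Gaussians show that the constant is sharp. -/
theorem functionalSantalo_euclideanSpace (k : ℕ) :
    FunctionalSantalo (EuclideanSpace ℝ (Fin k)) (innerSL ℝ) ((2 * Real.pi) ^ k) := by
  induction k with
  | zero =>
    intro f g hf hg hfin hfint hbar H
    have h1 : (volume : Measure (EuclideanSpace ℝ (Fin 0))) univ = 1 := by
      have := (PiLp.volume_preserving_ofLp (Fin 0)).measure_preimage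
        (s := univ) MeasurableSet.univ.nullMeasurableSet
      rw [preimage_univ] at this
      rw [this]
      simp [volume_pi]
    rw [lintegral_unique, lintegral_unique, h1, mul_one, mul_one]
    have h2 : ∀ x y : EuclideanSpace ℝ (Fin 0), f x * g y ≤ 1 := by
      intro x y
      refine (H x y).trans_eq ?_
      rw [Subsingleton.elim x 0]
      simp
    exact (h2 _ _).trans_eq (by simp)
  | succ k ih =>
    let e : EuclideanSpace ℝ (Fin (k + 1)) ≃L[ℝ] ℝ × EuclideanSpace ℝ (Fin k) :=
      ((EuclideanSpace.equiv (Fin (k + 1)) ℝ).trans (Fin.consEquivL ℝ fun _ => ℝ).symm).trans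
        ((ContinuousLinearEquiv.refl ℝ ℝ).prodCongr (EuclideanSpace.equiv (Fin k) ℝ).symm)
    rw [pow_succ, mul_comm]
    refine (ih.prod fun x y => ?_).congr e ?_ ?_
    · exact real_inner_comm (F := EuclideanSpace ℝ (Fin k)) y x
    · exact ((MeasurePreserving.id volume).prod (PiLp.volume_preserving_toLp (Fin k))).comp
        ((volume_preserving_piFinSuccAbove (fun _ => ℝ) 0).comp
          (PiLp.volume_preserving_ofLp (Fin (k + 1))))
    · intro x y
      rw [prodForm_apply]
      change (e x).1 * (e y).1 + inner ℝ (e x).2 (e y).2 = inner ℝ x y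
      simp only [PiLp.inner_apply, Fin.sum_univ_succ]
      exact congrArg₂ (· + ·) (mul_comm _ _) rfl

/-! ### Gaussian integrals of homogeneous functions and the Blaschke–Santaló inequality -/

theorem lintegral_Ioi_mul_exp_neg_sq_div_two {s : ℝ} (hs : 0 ≤ s) :
    ∫⁻ r in Ioi s, ENNReal.ofReal (r * Real.exp (-(r ^ 2) / 2)) =
      ENNReal.ofReal (Real.exp (-(s ^ 2) / 2)) := by
  have hd : ∀ r ∈ Ici s, HasDerivAt (fun r : ℝ => -Real.exp (-(r ^ 2) / 2))
      (r * Real.exp (-(r ^ 2) / 2)) r := by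
    intro r _
    have h1 : HasDerivAt (fun r : ℝ => -(r ^ 2) / 2) (-r) r := by
      have := ((hasDerivAt_pow 2 r).fun_neg).div_const 2
      exact this.congr_deriv (by push_cast; ring)
    exact h1.exp.fun_neg.congr_deriv (by ring)
  have hpos : ∀ r ∈ Ioi s, 0 ≤ r * Real.exp (-(r ^ 2) / 2) := fun r hr =>
    mul_nonneg (hs.trans (le_of_lt hr)) (Real.exp_pos _).le
  have hlim : Filter.Tendsto (fun r : ℝ => -Real.exp (-(r ^ 2) / 2)) Filter.atTop (nhds 0) := by
    rw [← neg_zero]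
    refine (Real.tendsto_exp_atBot.comp ?_).neg
    have : Filter.Tendsto (fun r : ℝ => r ^ 2 / 2) Filter.atTop Filter.atTop :=
      (Filter.tendsto_pow_atTop (by norm_num)).atTop_div_const (by norm_num)
    refine (Filter.tendsto_neg_atTop_atBot.comp this).congr fun r => ?_
    simp [neg_div]
  have hint := integrableOn_Ioi_deriv_of_nonneg' hd hpos hlim
  rw [← ofReal_integral_eq_lintegral_ofReal hint
    ((ae_restrict_iff' measurableSet_Ioi).2 (ae_of_all _ hpos)),
    integral_Ioi_of_hasDerivAt_of_nonneg' hd hpos hlim]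
  simp

section homogeneous

variable {k : ℕ}

/-- The radial factor in the Gaussian integral of a homogeneous function. -/
def radialConst (d : ℕ) : ℝ≥0∞ :=
  ∫⁻ r in Ioi (0 : ℝ), ENNReal.ofReal (r * Real.exp (-(r ^ 2) / 2)) * ENNReal.ofReal (r ^ d)

theorem setLIntegral_smul_homogeneous {p : EuclideanSpace ℝ (Fin k) → ℝ}
    (hp : Measurable p)
    (hph : ∀ r > 0, ∀ x, p (r • x) = r * p x) {q : EuclideanSpace ℝ (Fin k) → ℝ≥0∞}
    (hq : Measurable q) {d : ℕ}
    (hqh : ∀ r > 0, ∀ x, q (r • x) = ENNReal.ofReal (r ^ d) * q x) {r : ℝ} (hr : 0 < r) :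
    ∫⁻ x in {x | p x < r}, q x = ENNReal.ofReal (r ^ (k + d)) * ∫⁻ x in {x | p x < 1}, q x := by
  have hm (s : ℝ) : MeasurableSet {x | p x < s} := measurableSet_lt hp measurable_const
  have h1 := Measure.map_addHaar_smul (volume : Measure (EuclideanSpace ℝ (Fin k))) hr.ne'
  have h2 : ∫⁻ x in {x | p x < r}, q x ∂(Measure.map (fun x => r • x) volume) =
      ∫⁻ x in {x | p x < 1}, q (r • x) := by
    rw [setLIntegral_map (hm r) hq (measurable_const_smul r)]
    congr 2 with x
    simp only [mem_preimage, mem_ofPred_eq, hph r hr]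
    rw [mul_lt_iff_lt_one_right hr]
  rw [h1, Measure.restrict_smul, lintegral_smul_measure, finrank_euclideanSpace_fin] at h2
  simp_rw [hqh r hr] at h2
  rw [lintegral_const_mul _ hq] at h2
  have hk : (0 : ℝ) < r ^ k := by positivity
  rw [pow_add, ENNReal.ofReal_mul hk.le, mul_assoc, ← h2, abs_of_pos (by positivity), smul_eq_mul,
    ← mul_assoc, ← ENNReal.ofReal_mul hk.le, mul_inv_cancel₀ hk.ne', ENNReal.ofReal_one, one_mul]

/-- Write `e^{-p²/2}` as `∫_p^∞ r e^{-r²/2} dr` and exchange the integrals: the sets `{p < r}` are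
dilates of `{p < 1}`, so only a radial constant remains. The weight `q` of degree `d` covers volumes
(`d = 0`) and first moments (`d = 1`). -/
theorem lintegral_mul_exp_neg_sq_homogeneous {p : EuclideanSpace ℝ (Fin k) → ℝ}
    (hp : Measurable p) (hp0 : ∀ x, 0 ≤ p x)
    (hph : ∀ r > 0, ∀ x, p (r • x) = r * p x) {q : EuclideanSpace ℝ (Fin k) → ℝ≥0∞}
    (hq : Measurable q) {d : ℕ}
    (hqh : ∀ r > 0, ∀ x, q (r • x) = ENNReal.ofReal (r ^ d) * q x) :
    ∫⁻ x, ENNReal.ofReal (Real.exp (-(p x ^ 2) / 2)) * q x =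
      radialConst (k + d) * ∫⁻ x in {x | p x < 1}, q x := by
  have hρ : Measurable fun r : ℝ => ENNReal.ofReal (r * Real.exp (-(r ^ 2) / 2)) := by fun_prop
  set A : Set (EuclideanSpace ℝ (Fin k) × ℝ) := {y | p y.1 < y.2} with hA
  have hAm : MeasurableSet A := measurableSet_lt (hp.comp measurable_fst) measurable_snd
  calc ∫⁻ x, ENNReal.ofReal (Real.exp (-(p x ^ 2) / 2)) * q x
      = ∫⁻ x, ∫⁻ r in Ioi 0, A.indicator (fun y => ENNReal.ofReal (y.2 * Real.exp (-(y.2 ^ 2) / 2))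
          * q y.1) (x, r) := by
        congr 1 with x
        have : (fun r => A.indicator (fun y => ENNReal.ofReal (y.2 * Real.exp (-(y.2 ^ 2) / 2))
          * q y.1) (x, r)) = (Ioi (p x)).indicator fun r =>
            ENNReal.ofReal (r * Real.exp (-(r ^ 2) / 2)) * q x := by
          ext r
          by_cases h : p x < r
          · rw [indicator_of_mem (show (x, r) ∈ A from h), indicator_of_mem (show r ∈ Ioi (p x) from h)]
          · rw [indicator_of_notMem (show (x, r) ∉ A from h),
              indicator_of_notMem (show r ∉ Ioi (p x) from h)]
        rw [this, lintegral_indicator measurableSet_Ioi, Measure.restrict_restrict measurableSet_Ioi,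
          inter_eq_left.2 (Ioi_subset_Ioi (hp0 x)), lintegral_mul_const _ hρ,
          lintegral_Ioi_mul_exp_neg_sq_div_two (hp0 x)]
    _ = ∫⁻ r in Ioi 0, ∫⁻ x, A.indicator (fun y => ENNReal.ofReal (y.2 * Real.exp (-(y.2 ^ 2) / 2))
          * q y.1) (x, r) := by
        refine lintegral_lintegral_swap (Measurable.aemeasurable ?_)
        exact Measurable.indicator ((hρ.comp measurable_snd).mul (hq.comp measurable_fst)) hAm
    _ = ∫⁻ r in Ioi (0 : ℝ), ENNReal.ofReal (r * Real.exp (-(r ^ 2) / 2)) *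
          ENNReal.ofReal (r ^ (k + d)) * ∫⁻ x in {x | p x < 1}, q x := by
        refine setLIntegral_congr_fun measurableSet_Ioi fun r hr => ?_
        have : (fun x => A.indicator (fun y => ENNReal.ofReal (y.2 * Real.exp (-(y.2 ^ 2) / 2))
          * q y.1) (x, r)) = {x | p x < r}.indicator fun x =>
            ENNReal.ofReal (r * Real.exp (-(r ^ 2) / 2)) * q x := by
          ext x
          by_cases h : p x < r
          · rw [indicator_of_mem (show (x, r) ∈ A from h),
              indicator_of_mem (show x ∈ {x | p x < r} from h)]
          · rw [indicator_of_notMem (show (x, r) ∉ A from h),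
              indicator_of_notMem (show x ∉ {x | p x < r} from h)]
        simp only [this]
        rw [lintegral_indicator (measurableSet_lt hp measurable_const), lintegral_const_mul _ hq,
          setLIntegral_smul_homogeneous hp hph hq hqh hr, mul_assoc]
    _ = _ := by
        rw [lintegral_mul_const, radialConst]
        fun_prop

theorem lintegral_exp_neg_sq_homogeneous {p : EuclideanSpace ℝ (Fin k) → ℝ}
    (hp : Measurable p) (hp0 : ∀ x, 0 ≤ p x)
    (hph : ∀ r > 0, ∀ x, p (r • x) = r * p x) :
    ∫⁻ x, ENNReal.ofReal (Real.exp (-(p x ^ 2) / 2)) = radialConst k * volume {x | p x < 1} := by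
  have := lintegral_mul_exp_neg_sq_homogeneous hp hp0 hph (q := fun _ => 1) measurable_const
    (d := 0) (by simp)
  simpa using this

theorem lintegral_exp_neg_norm_sq :
    ∫⁻ x : EuclideanSpace ℝ (Fin k), ENNReal.ofReal (Real.exp (-(‖x‖ ^ 2) / 2)) =
      ENNReal.ofReal ((2 * Real.pi) ^ ((k : ℝ) / 2)) := by
  have e : (fun x : EuclideanSpace ℝ (Fin k) => Real.exp (-(‖x‖ ^ 2) / 2)) =
      fun x => Real.exp (-(1 / 2) * ‖x‖ ^ 2) := by
    ext x; ring_nf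
  have h1 := GaussianFourier.integral_rexp_neg_mul_sq_norm (V := EuclideanSpace ℝ (Fin k))
    (b := 1 / 2) (by norm_num)
  rw [← ofReal_integral_eq_lintegral_ofReal, e, h1]
  · rw [finrank_euclideanSpace_fin]
    congr 2
    ring
  · rw [e]
    by_contra h
    rw [integral_undef h] at h1
    have : (0 : ℝ) < (Real.pi / (1 / 2)) ^ ((Module.finrank ℝ (EuclideanSpace ℝ (Fin k)) : ℝ) / 2) := by
      positivity
    linarith
  · exact ae_of_all _ fun x => (Real.exp_pos _).le

/-- Taking `p` to be the norm identifies the radial constant through the Gaussian integral, so it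
need never be computed on its own. -/
theorem radialConst_mul_volume_ball :
    radialConst k * volume (ball (0 : EuclideanSpace ℝ (Fin k)) 1) =
      ENNReal.ofReal ((2 * Real.pi) ^ ((k : ℝ) / 2)) := by
  rw [← lintegral_exp_neg_norm_sq, lintegral_exp_neg_sq_homogeneous (by fun_prop)
    (fun _ => norm_nonneg _) (fun r hr x => by rw [norm_smul, Real.norm_of_nonneg hr.le])]
  congr 2
  ext x; simp

theorem radialConst_ne_zero : radialConst k ≠ 0 := by
  intro h
  have := radialConst_mul_volume_ball (k := k)
  rw [h, zero_mul, eq_comm, ENNReal.ofReal_eq_zero] at this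
  have : (0 : ℝ) < (2 * Real.pi) ^ ((k : ℝ) / 2) := by positivity
  linarith

theorem radialConst_ne_top : radialConst k ≠ ⊤ := by
  intro h
  have := radialConst_mul_volume_ball (k := k)
  rw [h, ENNReal.top_mul (isOpen_ball.measure_ne_zero _ (by simp))] at this
  exact ENNReal.ofReal_ne_top this.symm

/-- The Blaschke–Santaló inequality for a pair of positively homogeneous functions. -/
theorem volume_mul_volume_le_sq {p h : EuclideanSpace ℝ (Fin k) → ℝ}
    (hp : Measurable p) (hp0 : ∀ x, 0 ≤ p x) (hph : ∀ r > 0, ∀ x, p (r • x) = r * p x)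
    (hh : Measurable h) (hh0 : ∀ x, 0 ≤ h x) (hhh : ∀ r > 0, ∀ x, h (r • x) = r * h x)
    (hle : ∀ x y, inner ℝ x y ≤ p x * h y) (hpb : Bornology.IsBounded {x | p x < 1})
    (hbar : ∫ x in {x | p x < 1}, x = 0) :
    volume {x | p x < 1} * volume {x | h x < 1} ≤
      volume (ball (0 : EuclideanSpace ℝ (Fin k)) 1) ^ 2 := by
  have hpfin : volume {x | p x < 1} ≠ ⊤ := hpb.measure_lt_top.ne
  obtain ⟨R, hR⟩ := hpb.subset_closedBall 0
  have hpm : MeasurableSet {x | p x < 1} := measurableSet_lt hp measurable_const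
  set f : EuclideanSpace ℝ (Fin k) → ℝ≥0∞ := fun x => ENNReal.ofReal (Real.exp (-(p x ^ 2) / 2))
    with hf
  have hfm : Measurable f := by fun_prop
  have hpint : IntegrableOn (fun x : EuclideanSpace ℝ (Fin k) => x) {x | p x < 1} := by
    refine Measure.integrableOn_of_bounded (M := R) hpfin (by fun_prop) ?_
    exact (ae_restrict_iff' hpm).2 (ae_of_all _ fun x hx => by simpa using hR hx)
  have hfint : Integrable (fun x => x) (volume.withDensity f) := by
    refine ⟨by fun_prop, ?_⟩
    rw [hasFiniteIntegral_iff_enorm, lintegral_withDensity_eq_lintegral_mul _ hfm (by fun_prop)]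
    simp only [Pi.mul_apply, hf]
    rw [lintegral_mul_exp_neg_sq_homogeneous hp hp0 hph (d := 1) (by fun_prop)]
    · exact ENNReal.mul_lt_top radialConst_ne_top.lt_top hpint.2
    · intro r hr x
      rw [enorm_smul, pow_one, Real.enorm_eq_ofReal hr.le]
  have hfbar : ∫ x, x ∂(volume.withDensity f) = 0 := by
    -- Positive parts of linear forms are homogeneous of degree one, so the first moments of the
    -- density are a common multiple of those of `{p < 1}`; taking `v` and `-v` transfers the
    -- barycentre condition.
    have key (v : EuclideanSpace ℝ (Fin k)) :
        ∫⁻ x, ENNReal.ofReal (inner ℝ v x) ∂(volume.withDensity f) =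
          radialConst (k + 1) * ∫⁻ x in {x | p x < 1}, ENNReal.ofReal (inner ℝ v x) := by
      rw [lintegral_withDensity_eq_lintegral_mul _ hfm (by fun_prop)]
      refine lintegral_mul_exp_neg_sq_homogeneous hp hp0 hph (d := 1) (by fun_prop) ?_
      intro r hr x
      rw [inner_smul_right, pow_one, ENNReal.ofReal_mul hr.le]
    refine ext_inner_left ℝ fun v => ?_
    rw [inner_zero_right, ← integral_inner hfint]
    have h1 : ∫ x in {x | p x < 1}, inner ℝ v x = 0 := by
      rw [integral_inner hpint, hbar, inner_zero_right]
    rw [integral_eq_lintegral_pos_part_sub_lintegral_neg_part (hpint.const_inner v)] at h1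
    rw [integral_eq_lintegral_pos_part_sub_lintegral_neg_part (hfint.const_inner v), key]
    simp_rw [← inner_neg_left] at h1 ⊢
    rw [key, ENNReal.toReal_mul, ENNReal.toReal_mul, ← mul_sub, h1, mul_zero]
  have hff : ∫⁻ x, f x = radialConst k * volume {x | p x < 1} :=
    lintegral_exp_neg_sq_homogeneous hp hp0 hph
  have main := functionalSantalo_euclideanSpace k f
    (fun y => ENNReal.ofReal (Real.exp (-(h y ^ 2) / 2))) hfm (by fun_prop)
    (by rw [hff]; exact ENNReal.mul_ne_top radialConst_ne_top hpfin) hfint hfbar (by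
      intro x y
      rw [hf, ← ENNReal.ofReal_mul (Real.exp_pos _).le, ← Real.exp_add]
      refine ENNReal.ofReal_le_ofReal (Real.exp_le_exp.2 ?_)
      change _ ≤ -inner ℝ x y
      -- `(p² + h²) / 2 ≥ p h ≥ ⟪x, y⟫`.
      nlinarith [hle x y, sq_nonneg (p x - h y)])
  rw [hff, lintegral_exp_neg_sq_homogeneous hh hh0 hhh] at main
  have e : ENNReal.ofReal ((2 * Real.pi) ^ k) =
      (radialConst k * volume (ball (0 : EuclideanSpace ℝ (Fin k)) 1)) ^ 2 := by
    rw [radialConst_mul_volume_ball, ← ENNReal.ofReal_pow (by positivity), ← Real.rpow_natCast,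
      ← Real.rpow_natCast, ← Real.rpow_mul (by positivity)]
    congr 2
    push_cast
    ring
  rw [e, mul_pow, mul_mul_mul_comm, ← sq] at main
  have h0 : radialConst k ^ 2 ≠ 0 := pow_ne_zero _ radialConst_ne_zero
  have ht : radialConst k ^ 2 ≠ ⊤ := ENNReal.pow_ne_top radialConst_ne_top
  exact (ENNReal.mul_le_mul_iff_right h0 ht).1 main

end homogeneous

/-! ### Support functions -/

section support

variable {n : ℕ} {Ω : Set (E n)}

theorem bddAbove_inner_image (hc : IsCompact Ω) (z x : E n) :
    BddAbove ((fun w => ⟪x, w - z⟫) '' Ω) :=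
  (hc.image (by fun_prop)).bddAbove

theorem inner_le_supportFun (hc : IsCompact Ω) (z x : E n) {w : E n} (hw : w ∈ Ω) :
    ⟪x, w - z⟫ ≤ supportFun Ω z x :=
  le_csSup (bddAbove_inner_image hc z x) (mem_image_of_mem _ hw)

theorem exists_inner_eq_supportFun (hc : IsCompact Ω) (hne : Ω.Nonempty) (z x : E n) :
    ∃ w ∈ Ω, ⟪x, w - z⟫ = supportFun Ω z x :=
  (hc.image (f := fun w => ⟪x, w - z⟫) (by fun_prop)).sSup_mem (hne.image _)

theorem supportFun_le (hne : Ω.Nonempty) {z x : E n} {c : ℝ} (h : ∀ w ∈ Ω, ⟪x, w - z⟫ ≤ c) :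
    supportFun Ω z x ≤ c :=
  csSup_le (hne.image _) (by rintro _ ⟨w, hw, rfl⟩; exact h w hw)

theorem supportFun_eq_add_inner (hc : IsCompact Ω) (hne : Ω.Nonempty) (z z' x : E n) :
    supportFun Ω z x = supportFun Ω z' x + ⟪x, z' - z⟫ := by
  have key (w : E n) : ⟪x, w - z⟫ = ⟪x, w - z'⟫ + ⟪x, z' - z⟫ := by
    rw [← inner_add_right, sub_add_sub_cancel]
  refine le_antisymm (supportFun_le hne fun w hw => ?_) ?_
  · rw [key]; gcongr; exact inner_le_supportFun hc z' x hw
  · obtain ⟨w, hw, h⟩ := exists_inner_eq_supportFun hc hne z' x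
    rw [← h, ← key]
    exact inner_le_supportFun hc z x hw

theorem supportFun_smul (hc : IsCompact Ω) (hne : Ω.Nonempty) (z x : E n) {r : ℝ} (hr : 0 ≤ r) :
    supportFun Ω z (r • x) = r * supportFun Ω z x := by
  refine le_antisymm (supportFun_le hne fun w hw => ?_) ?_
  · rw [inner_smul_left]
    exact mul_le_mul_of_nonneg_left (inner_le_supportFun hc z x hw) hr
  · obtain ⟨w, hw, h⟩ := exists_inner_eq_supportFun hc hne z x
    rw [← h]
    have := inner_le_supportFun hc z (r • x) hw
    rwa [inner_smul_left] at this

theorem continuous_supportFun (hc : IsCompact Ω) (hne : Ω.Nonempty) (z : E n) :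
    Continuous (supportFun Ω z) := by
  obtain ⟨R, hR⟩ := (hc.isBounded).subset_closedBall z
  have key (x y : E n) : supportFun Ω z x ≤ supportFun Ω z y + max R 0 * dist x y := by
    refine supportFun_le hne fun w hw => ?_
    have h1 := inner_le_supportFun hc z y hw
    have h2 : ⟪x - y, w - z⟫ ≤ ‖x - y‖ * ‖w - z‖ := real_inner_le_norm _ _
    have h3 : ‖w - z‖ ≤ max R 0 := by
      rw [← dist_eq_norm]; exact (hR hw).trans (le_max_left _ _)
    rw [inner_sub_left] at h2
    rw [dist_eq_norm]
    nlinarith [norm_nonneg (x - y)]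
  have := LipschitzWith.of_le_add_mul (K := (max R 0).toNNReal) (f := supportFun Ω z) (by
    intro x y
    rw [Real.coe_toNNReal _ (le_max_right _ _)]
    exact key x y)
  exact this.continuous

theorem continuous_supportFun_left (hc : IsCompact Ω) (hne : Ω.Nonempty) (x : E n) :
    Continuous fun z => supportFun Ω z x := by
  have : (fun z => supportFun Ω z x) = fun z => supportFun Ω 0 x + ⟪x, 0 - z⟫ :=
    funext fun z => supportFun_eq_add_inner hc hne z 0 x
  rw [this]
  fun_prop

theorem supportFun_nonneg (hc : IsCompact Ω) {z : E n} (hz : z ∈ Ω) (x : E n) :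
    0 ≤ supportFun Ω z x := by
  simpa using inner_le_supportFun hc z x hz

theorem supportFun_pos (hc : IsCompact Ω) {z : E n} (hz : z ∈ interior Ω) {x : E n} (hx : x ≠ 0) :
    0 < supportFun Ω z x := by
  have h1 : Filter.Tendsto (fun t : ℝ => z + t • x) (nhdsWithin 0 (Ioi 0)) (nhds z) := by
    have : Continuous fun t : ℝ => z + t • x := by fun_prop
    simpa using (this.tendsto 0).mono_left nhdsWithin_le_nhds
  obtain ⟨t, ht, ht0⟩ := ((h1.eventually (mem_interior_iff_mem_nhds.1 hz)).and
    self_mem_nhdsWithin).exists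
  have h2 := inner_le_supportFun hc z x ht
  rw [add_sub_cancel_left, inner_smul_right, real_inner_self_eq_norm_sq] at h2
  have : 0 < t * ‖x‖ ^ 2 := mul_pos ht0 (by positivity)
  linarith

/-- A point outside a closed convex set is separated from it by a unit vector. -/
theorem exists_unit_supportFun_lt (hc : IsCompact Ω) (hconv : Convex ℝ Ω) (hne : Ω.Nonempty)
    (z : E n) {y : E n} (hy : y ∉ Ω) :
    ∃ x : E n, ‖x‖ = 1 ∧ supportFun Ω z x < ⟪x, y - z⟫ := by
  obtain ⟨f, u, hf, hu⟩ := geometric_hahn_banach_closed_point hconv hc.isClosed hy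
  set v := (InnerProductSpace.toDual ℝ (E n)).symm f with hv
  have hfv (w : E n) : f w = ⟪v, w⟫ := by simp [hv]
  have hv0 : v ≠ 0 := by
    intro h0
    obtain ⟨w, hw⟩ := hne
    have := (hf w hw).trans hu
    simp [hfv, h0] at this
  have hvn : 0 < ‖v‖ := norm_pos_iff.2 hv0
  refine ⟨‖v‖⁻¹ • v, by rw [norm_smul, norm_inv, norm_norm, inv_mul_cancel₀ hvn.ne'], ?_⟩
  rw [supportFun_smul hc hne _ _ (by positivity), inner_smul_left]
  refine mul_lt_mul_of_pos_left ?_ (by simpa using hv0)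
  obtain ⟨w, hw, h⟩ := exists_inner_eq_supportFun hc hne z v
  have := (hf w hw).trans hu
  rw [hfv, hfv] at this
  rw [← h, inner_sub_right, inner_sub_right]
  linarith

theorem exists_isOuterUnitNormal (hconv : Convex ℝ Ω) (hint : (interior Ω).Nonempty) {p : E n}
    (hp : p ∉ interior Ω) : ∃ v, IsOuterUnitNormal Ω p v := by
  obtain ⟨f, hf⟩ := geometric_hahn_banach_open_point hconv.interior isOpen_interior hp
  set v := (InnerProductSpace.toDual ℝ (E n)).symm f with hv
  have hfv (w : E n) : f w = ⟪v, w⟫ := by simp [hv]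
  have hv0 : v ≠ 0 := by
    intro h0
    obtain ⟨w, hw⟩ := hint
    have := hf w hw
    simp [hfv, h0] at this
  have hvn : 0 < ‖v‖ := norm_pos_iff.2 hv0
  have hle : ∀ w ∈ Ω, f w ≤ f p := by
    intro w hw
    have h1 : w ∈ closure (interior Ω) := by
      rw [hconv.closure_interior_eq_closure_of_nonempty_interior hint]
      exact subset_closure hw
    exact closure_minimal (fun y hy => (hf y hy).le) (isClosed_le f.continuous continuous_const) h1
  refine ⟨‖v‖⁻¹ • v, by rw [norm_smul, norm_inv, norm_norm, inv_mul_cancel₀ hvn.ne'], ?_⟩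
  intro w hw
  have := hle w hw
  rw [hfv, hfv] at this
  rw [inner_smul_left, inner_sub_right]
  refine mul_nonpos_of_nonneg_of_nonpos (by simp) (by linarith)

/-- At a non-interior point the support function is nonpositive in the direction of a supporting
normal. The supremum defining the entropy thus runs over an open set. -/
theorem positivePoints_eq_interior (hc : IsCompact Ω) (hconv : Convex ℝ Ω)
    (hint : (interior Ω).Nonempty) : positivePoints Ω = interior Ω := by
  ext z
  constructor
  · rintro ⟨_, hpos⟩
    by_contra hz
    obtain ⟨v, hv1, hv⟩ := exists_isOuterUnitNormal hconv hint hz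
    have := hpos v (by simpa using hv1)
    exact absurd (supportFun_le (hint.mono interior_subset) hv) (not_le.2 this)
  · intro hz
    refine ⟨interior_subset hz, fun x hx => supportFun_pos hc hz ?_⟩
    rintro rfl
    simp at hx

/-- The smooth boundary hypothesis forces the interior to be nonempty. -/
theorem HasSmoothBoundary.nonempty_interior (hΩ : HasSmoothBoundary Ω) (hc : IsCompact Ω)
    (hne : Ω.Nonempty) : (interior Ω).Nonempty := by
  have hfr : (frontier Ω).Nonempty := by
    refine nonempty_frontier_iff.2 ⟨hne, fun h => ?_⟩
    rw [h] at hc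
    exact noncompact_univ (E n) hc
  obtain ⟨p, hp⟩ := hfr
  obtain ⟨U, f, hU, hpU, hf, hf', hΩU⟩ := hΩ p hp
  by_contra hint
  rw [not_nonempty_iff_eq_empty] at hint
  have hfp : f p ≤ 0 := by
    have : p ∈ Ω ∩ U := ⟨hc.isClosed.frontier_subset hp, hpU⟩
    rw [hΩU] at this
    exact this.2
  -- Nearby points with `f < f p ≤ 0` would be interior; if there are none, `p` is a local minimum
  -- of `f` and its differential vanishes.
  have hmin : IsLocalMin f p := by
    filter_upwards [hU.mem_nhds hpU] with x hx
    by_contra hlt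
    push Not at hlt
    have hcont : ContinuousAt f x := (hf.continuousOn.continuousAt (hU.mem_nhds hx))
    have : x ∈ interior Ω := by
      rw [mem_interior_iff_mem_nhds]
      filter_upwards [hU.mem_nhds hx, hcont.eventually (gt_mem_nhds (hlt.trans_le hfp))] with y hy hy'
      have : y ∈ Ω ∩ U := by rw [hΩU]; exact ⟨hy, hy'.le⟩
      exact this.1
    rw [hint] at this
    exact this
  exact hf' hmin.fderiv_eq_zero

theorem eq_closedBall_of_supportFun_eq_one (hc : IsCompact Ω) (hconv : Convex ℝ Ω)
    (hne : Ω.Nonempty) {c : E n} (h : ∀ x ∈ sphere (0 : E n) 1, supportFun Ω c x = 1) :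
    Ω = closedBall c 1 := by
  ext y
  rw [mem_closedBall, dist_eq_norm]
  constructor
  · intro hy
    by_contra hlt
    push Not at hlt
    have h0 : 0 < ‖y - c‖ := by linarith
    have h1 := inner_le_supportFun hc c (‖y - c‖⁻¹ • (y - c)) hy
    rw [h _ (by simp [norm_smul, h0.ne']), inner_smul_left, real_inner_self_eq_norm_sq] at h1
    simp only [conj_trivial] at h1
    rw [sq, ← mul_assoc, inv_mul_cancel₀ h0.ne', one_mul] at h1
    linarith
  · intro hy
    by_contra hyΩ
    obtain ⟨x, hx, hlt⟩ := exists_unit_supportFun_lt hc hconv hne c hyΩ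
    rw [h x (by simpa using hx)] at hlt
    have := real_inner_le_norm x (y - c)
    rw [hx, one_mul] at this
    linarith

end support

/-! ### The mean logarithm of the support function at the centroid -/

section centroid

variable {n : ℕ} {Ω : Set (E n)}

theorem sphereArea_eq : sphereArea n = (n + 1) * volume.real (ball (0 : E n) 1) := by
  rw [sphereArea, Measure.toSphere_real_apply_univ, finrank_euclideanSpace_fin]
  push_cast
  rfl

theorem sphereArea_pos : 0 < sphereArea n := by
  rw [sphereArea_eq]
  have : 0 < volume.real (ball (0 : E n) 1) :=
    ENNReal.toReal_pos (isOpen_ball.measure_ne_zero _ (by simp)) measure_ball_lt_top.ne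
  positivity

/-- Polar coordinates for the sublevel set of a positively homogeneous function. -/
theorem lintegral_sphere_pow_neg {h : E n → ℝ} (hh : Measurable h)
    (hpos : ∀ x ≠ 0, 0 < h x) (hhh : ∀ r > 0, ∀ x, h (r • x) = r * h x) :
    ∫⁻ x : sphere (0 : E n) 1, ENNReal.ofReal ((h x)⁻¹ ^ (n + 1)) ∂(sphereMeasure n) =
      (n + 1) * volume {x | h x < 1} := by
  set A : Set (sphere (0 : E n) 1 × Ioi (0 : ℝ)) := {q | (q.2 : ℝ) * h q.1 < 1} with hA
  have hAm : MeasurableSet A := by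
    refine measurableSet_lt ?_ measurable_const
    fun_prop
  have hm : MeasurableSet {x : E n | h x < 1} := measurableSet_lt hh measurable_const
  have hmp := (volume : Measure (E n)).measurePreserving_homeomorphUnitSphereProd
  rw [finrank_euclideanSpace_fin, Nat.add_sub_cancel] at hmp
  have h1 := hmp.measure_preimage hAm.nullMeasurableSet
  have h2 : homeomorphUnitSphereProd (E n) ⁻¹' A = Subtype.val ⁻¹' {x | h x < 1} := by
    ext x
    have hx : (x : E n) ≠ 0 := x.2
    have hx0 : 0 < ‖(x : E n)‖ := norm_pos_iff.2 hx
    simp only [hA, mem_preimage, mem_ofPred_eq, homeomorphUnitSphereProd_apply_snd_coe,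
      homeomorphUnitSphereProd_apply_fst_coe]
    rw [hhh _ (inv_pos.2 hx0), ← mul_assoc, mul_inv_cancel₀ hx0.ne', one_mul]
  rw [h2, comap_subtype_coe_apply (measurableSet_singleton _).compl,
    Subtype.image_preimage_coe] at h1
  have h3 : volume (({0}ᶜ : Set (E n)) ∩ {x | h x < 1}) = volume {x | h x < 1} := by
    rw [inter_comm]
    exact measure_inter_conull (by simp)
  rw [h3, Measure.prod_apply hAm] at h1
  rw [h1, ← lintegral_const_mul _ (measurable_measure_prodMk_left hAm)]
  congr 1 with x
  have hx : (x : E n) ≠ 0 := by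
    intro h0
    have := x.2
    simp [h0] at this
  have hx0 := hpos x hx
  have h4 : Prod.mk x ⁻¹' A = Iio (⟨(h x)⁻¹, inv_pos.2 hx0⟩ : Ioi (0 : ℝ)) := by
    ext r
    simp only [hA, mem_preimage, mem_ofPred_eq, mem_Iio, ← Subtype.coe_lt_coe]
    rw [inv_eq_one_div, lt_div_iff₀ hx0]
  rw [h4, Measure.volumeIoiPow_apply_Iio]
  have : ((n : ℝ≥0∞) + 1) = ENNReal.ofReal (n + 1) := by
    rw [ENNReal.ofReal_add (by positivity) zero_le_one]; simp
  rw [this, ← ENNReal.ofReal_mul (by positivity), mul_div_cancel₀ _ (by positivity)]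

/-- Dividing `x` by its gauge puts it in the body translated to `c`: gauge and support function are
polar to each other. -/
theorem inner_le_gauge_mul_supportFun (hc : IsCompact Ω) (hconv : Convex ℝ Ω) {c : E n}
    (hcΩ : c ∈ interior Ω) (x y : E n) :
    inner ℝ x y ≤ gauge ((fun v => v + c) ⁻¹' Ω) x * supportFun Ω c y := by
  set T : Set (E n) := (fun v => v + c) ⁻¹' Ω with hT
  have hTc : IsCompact T := (Homeomorph.addRight c).isCompact_preimage.2 hc
  have hTconv : Convex ℝ T := hconv.translate_preimage_left c
  have hT0 : T ∈ nhds (0 : E n) := by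
    have : ContinuousAt (fun v : E n => v + c) 0 := by fun_prop
    exact this.preimage_mem_nhds (by simpa using mem_interior_iff_mem_nhds.1 hcΩ)
  rcases eq_or_ne x 0 with rfl | hx
  · simp
  have hg : 0 < gauge T x :=
    (gauge_pos (absorbent_nhds_zero hT0) ((NormedSpace.isVonNBounded_iff ℝ).2 hTc.isBounded)).2 hx
  have hmem : (gauge T x)⁻¹ • x ∈ T := by
    have : gauge T ((gauge T x)⁻¹ • x) ≤ 1 := by
      rw [gauge_smul_of_nonneg (by positivity), smul_eq_mul, inv_mul_cancel₀ hg.ne']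
    rwa [gauge_le_one_iff_mem_closure hTconv hT0, hTc.isClosed.closure_eq] at this
  have h1 := inner_le_supportFun hc c y hmem
  rw [add_sub_cancel_right, inner_smul_right, real_inner_comm] at h1
  rwa [inv_mul_le_iff₀ hg] at h1

/-- A functional separating the centroid from the interior would have a strictly signed integral
over `Ω` after centring, whereas that integral is zero. -/
theorem exists_centroid (hc : IsCompact Ω) (hconv : Convex ℝ Ω) (hint : (interior Ω).Nonempty) :
    ∃ c ∈ interior Ω, ∫ x in Ω, (x - c) = 0 := by
  have hpos : 0 < volume.real Ω := ENNReal.toReal_pos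
    (Measure.measure_pos_of_nonempty_interior _ hint).ne' hc.measure_ne_top
  have hid : IntegrableOn (fun x : E n => x) Ω := continuous_id.continuousOn.integrableOn_compact hc
  have hcst (c : E n) : IntegrableOn (fun _ : E n => c) Ω :=
    continuous_const.continuousOn.integrableOn_compact hc
  set c := (volume.real Ω)⁻¹ • ∫ x in Ω, x with hcdef
  have h0 : ∫ x in Ω, (x - c) = 0 := by
    rw [integral_sub hid (hcst c), setIntegral_const, hcdef, smul_inv_smul₀ hpos.ne', sub_self]
  refine ⟨c, ?_, h0⟩
  by_contra hcn
  obtain ⟨f, hf⟩ := geometric_hahn_banach_open_point hconv.interior isOpen_interior hcn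
  have h1 : ∫ x in interior Ω, (f c - f x) = 0 := by
    have h2 : ∫ x in Ω, f (x - c) = 0 := by
      have h3 : IntegrableOn (fun x : E n => x - c) Ω := hid.sub (hcst c)
      rw [ContinuousLinearMap.integral_comp_comm f h3, h0, map_zero]
    rw [setIntegral_congr_set (interior_ae_eq_of_null_frontier (hconv.addHaar_frontier volume)), ← neg_eq_zero, ← integral_neg]
    rw [← h2]
    congr 1 with x
    simp
  have h3 : 0 < ∫ x in interior Ω, (f c - f x) := by
    rw [setIntegral_pos_iff_support_of_nonneg_ae]
    · have : (Function.support fun x => f c - f x) ∩ interior Ω = interior Ω := by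
        refine inter_eq_right.2 fun x hx => ?_
        have := hf x hx
        simp only [Function.mem_support]
        linarith
      rw [this]
      exact isOpen_interior.measure_pos _ hint
    · refine (ae_restrict_iff' isOpen_interior.measurableSet).2 (ae_of_all _ fun x hx => ?_)
      have := hf x hx
      simp only [Pi.zero_apply]
      linarith
    · have : IntegrableOn (fun x => f c - f x) Ω :=
        (by fun_prop : Continuous fun x => f c - f x).continuousOn.integrableOn_compact hc
      exact this.mono_set interior_subset
  linarith

/-- The Blaschke–Santaló inequality for the polar body with respect to the centroid. -/
theorem lintegral_supportFun_pow_neg_le (hc : IsCompact Ω) (hconv : Convex ℝ Ω) {c : E n}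
    (hcΩ : c ∈ interior Ω) (hbar : ∫ x in Ω, (x - c) = 0)
    (hvol : volume Ω = volume (closedBall (0 : E n) 1)) :
    ∫⁻ x : sphere (0 : E n) 1, ENNReal.ofReal ((supportFun Ω c x)⁻¹ ^ (n + 1)) ∂(sphereMeasure n) ≤
      sphereMeasure n univ := by
  have hne : Ω.Nonempty := ⟨c, interior_subset hcΩ⟩
  set T : Set (E n) := (fun v => v + c) ⁻¹' Ω with hT
  have hTc : IsCompact T := (Homeomorph.addRight c).isCompact_preimage.2 hc
  have hTconv : Convex ℝ T := hconv.translate_preimage_left c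
  have hT0 : T ∈ nhds (0 : E n) := by
    have : ContinuousAt (fun v : E n => v + c) 0 := by fun_prop
    exact this.preimage_mem_nhds (by simpa using mem_interior_iff_mem_nhds.1 hcΩ)
  have hlt : {x | gauge T x < 1} = interior T := setOfPred_gauge_lt_one_eq_interior hTconv hT0
  have hTi : (interior T : Set (E n)) =ᵐ[volume] T := interior_ae_eq_of_null_frontier (hTconv.addHaar_frontier volume)
  have hvT : volume {x | gauge T x < 1} = volume (ball (0 : E n) 1) := by
    rw [hlt, measure_congr hTi, hT, measure_preimage_add_right, hvol,
      Measure.addHaar_closedBall_eq_addHaar_ball]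
  have hbarT : ∫ x in {x | gauge T x < 1}, x = 0 := by
    rw [hlt, setIntegral_congr_set hTi, ← hbar]
    have := (measurePreserving_add_right (volume : Measure (E n)) c).setIntegral_preimage_emb
      (Homeomorph.addRight c).measurableEmbedding (fun x => x - c) Ω
    simpa using this
  have main := volume_mul_volume_le_sq (p := gauge T) (h := supportFun Ω c)
    (continuous_gauge hTconv hT0).measurable (fun x => gauge_nonneg x)
    (fun r hr x => by rw [gauge_smul_of_nonneg hr.le, smul_eq_mul])
    (continuous_supportFun hc hne c).measurable
    (supportFun_nonneg hc (interior_subset hcΩ)) (fun r hr x => supportFun_smul hc hne c x hr.le)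
    (inner_le_gauge_mul_supportFun hc hconv hcΩ)
    (by rw [hlt]; exact hTc.isBounded.subset interior_subset) hbarT
  rw [hvT, sq] at main
  have hb0 : volume (ball (0 : E n) 1) ≠ 0 := isOpen_ball.measure_ne_zero _ (by simp)
  have hbt : volume (ball (0 : E n) 1) ≠ ⊤ := measure_ball_lt_top.ne
  have main' := (ENNReal.mul_le_mul_iff_right hb0 hbt).1 main
  rw [lintegral_sphere_pow_neg (continuous_supportFun hc hne c).measurable
    (fun x hx => supportFun_pos hc hcΩ hx) (fun r hr x => supportFun_smul hc hne c x hr.le),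
    Measure.toSphere_apply_univ, finrank_euclideanSpace_fin]
  push_cast
  gcongr

theorem continuous_log_supportFun_sphere (hc : IsCompact Ω) {c : E n} (hcΩ : c ∈ interior Ω) :
    Continuous fun x : sphere (0 : E n) 1 => Real.log (supportFun Ω c x) := by
  refine Continuous.log ?_ fun x => (supportFun_pos hc hcΩ (ne_zero_of_mem_unit_sphere x)).ne'
  exact (continuous_supportFun hc ⟨c, interior_subset hcΩ⟩ c).comp continuous_subtype_val

theorem integrable_of_continuous_sphere {f : sphere (0 : E n) 1 → ℝ} (hf : Continuous f) :
    Integrable f (sphereMeasure n) :=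
  hf.integrable_of_hasCompactSupport (HasCompactSupport.of_compactSpace f)

/-- With `w = u_c^{-(n+1)}`, Santaló gives `∫ w ≤ ω_n`, and `log w ≤ w - 1` bounds the mean of `log
u_c` below by zero. If that mean is zero, strictness of the logarithm inequality forces `w ≡ 1`; the
equality case of Blaschke–Santaló is not needed. -/
theorem exists_meanLogSupport_nonneg (hc : IsCompact Ω) (hconv : Convex ℝ Ω)
    (hint : (interior Ω).Nonempty) (hvol : volume Ω = volume (closedBall (0 : E n) 1)) :
    ∃ c ∈ interior Ω, 0 ≤ meanLogSupport Ω c ∧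
      (meanLogSupport Ω c = 0 → Ω = closedBall c 1) := by
  obtain ⟨c, hcΩ, hbar⟩ := exists_centroid hc hconv hint
  have hne : Ω.Nonempty := ⟨c, interior_subset hcΩ⟩
  have hS := lintegral_supportFun_pow_neg_le hc hconv hcΩ hbar hvol
  have hpos (x : sphere (0 : E n) 1) : 0 < supportFun Ω c x :=
    supportFun_pos hc hcΩ (ne_zero_of_mem_unit_sphere x)
  set w : sphere (0 : E n) 1 → ℝ := fun x => (supportFun Ω c x)⁻¹ ^ (n + 1) with hw
  have hwpos (x) : 0 < w x := by have := hpos x; positivity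
  have hucont : Continuous fun x : sphere (0 : E n) 1 => supportFun Ω c x :=
    (continuous_supportFun hc hne c).comp continuous_subtype_val
  have hwcont : Continuous w := (hucont.inv₀ fun x => (hpos x).ne').pow _
  have hlogw (x) : Real.log (w x) = -(n + 1) * Real.log (supportFun Ω c x) := by
    simp only [hw, Real.log_pow, Real.log_inv]; push_cast; ring
  have hlogcont := continuous_log_supportFun_sphere hc hcΩ
  have hwint := integrable_of_continuous_sphere hwcont
  have h1 : ∫ x, w x ∂(sphereMeasure n) ≤ (sphereMeasure n).real univ := by
    rw [integral_eq_lintegral_of_nonneg_ae (ae_of_all _ fun x => (hwpos x).le)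
      hwcont.aestronglyMeasurable]
    exact ENNReal.toReal_mono (measure_ne_top _ _) hS
  set D : sphere (0 : E n) 1 → ℝ := fun x => w x - 1 - Real.log (w x) with hD
  have hD0 (x) : 0 ≤ D x := by
    have := Real.log_le_sub_one_of_pos (hwpos x)
    simp only [hD]; linarith
  have hDcont : Continuous D :=
    (hwcont.sub continuous_const).sub (hwcont.log fun x => (hwpos x).ne')
  have hDint : ∫ x, D x ∂(sphereMeasure n) = ∫ x, w x ∂(sphereMeasure n) -
      (sphereMeasure n).real univ + (n + 1) * ∫ x : sphere (0 : E n) 1,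
        Real.log (supportFun Ω c x) ∂(sphereMeasure n) := by
    have e : D = fun x => (w x - 1) + (n + 1) * Real.log (supportFun Ω c x) := by
      ext x; simp only [hD, hlogw]; ring
    have hw1 : Integrable (fun x => w x - 1) (sphereMeasure n) := hwint.sub (integrable_const _)
    rw [e, integral_add hw1
      ((integrable_of_continuous_sphere hlogcont).const_mul _), integral_const_mul,
      integral_sub hwint (integrable_const _)]
    simp
  have hDge : 0 ≤ ∫ x, D x ∂(sphereMeasure n) := integral_nonneg hD0
  have hn : (0 : ℝ) < n + 1 := by positivity
  have hω := sphereArea_pos (n := n)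
  have hm : ∫ x : sphere (0 : E n) 1, Real.log (supportFun Ω c x) ∂(sphereMeasure n) =
      sphereArea n * meanLogSupport Ω c := by
    rw [meanLogSupport]; field_simp
  rw [hm] at hDint
  refine ⟨c, hcΩ, ?_, ?_⟩
  · by_contra hlt
    push Not at hlt
    have : (n + 1) * (sphereArea n * meanLogSupport Ω c) < 0 :=
      mul_neg_of_pos_of_neg hn (mul_neg_of_pos_of_neg hω hlt)
    linarith
  · intro h0
    refine eq_closedBall_of_supportFun_eq_one hc hconv hne fun x hx => ?_
    have h2 : ∫ x, D x ∂(sphereMeasure n) = 0 := by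
      rw [h0] at hDint
      linarith
    have h3 := (hDcont.ae_eq_iff_eq (sphereMeasure n) continuous_zero).1
      ((integral_eq_zero_iff_of_nonneg hD0 (integrable_of_continuous_sphere hDcont)).1 h2)
    have h4 : w ⟨x, hx⟩ = 1 := by
      have h5 := congrFun h3 ⟨x, hx⟩
      simp only [hD, Pi.zero_apply] at h5
      by_contra hne1
      have := Real.log_lt_sub_one_of_pos (hwpos ⟨x, hx⟩) hne1
      linarith
    have h6 : (supportFun Ω c x)⁻¹ = 1 :=
      (pow_eq_one_iff_of_nonneg (inv_nonneg.2 (hpos ⟨x, hx⟩).le) (by omega)).1 h4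
    exact inv_eq_one.1 h6

end centroid

/-! ### Normals of smooth convex bodies -/

section normals

variable {n : ℕ} {Ω : Set (E n)}

/-- The defining function of a smooth boundary, with nonvanishing differential throughout the
neighbourhood. -/
theorem HasSmoothBoundary.exists_defining (hΩ : HasSmoothBoundary Ω) (hcl : IsClosed Ω) {p : E n}
    (hp : p ∈ frontier Ω) :
    ∃ (U : Set (E n)) (f : E n → ℝ), IsOpen U ∧ p ∈ U ∧ ContDiffOn ℝ ∞ f U ∧
      (∀ x ∈ U, fderiv ℝ f x ≠ 0) ∧ (∀ x ∈ U, f x ≤ 0 → x ∈ Ω) ∧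
      ∀ x ∈ U, x ∈ frontier Ω → f x = 0 := by
  obtain ⟨U, f, hU, hpU, hf, hf', hΩU⟩ := hΩ p hp
  have hmem : ∀ x ∈ U, f x ≤ 0 → x ∈ Ω := fun x hx h => by
    have : x ∈ Ω ∩ U := by rw [hΩU]; exact ⟨hx, h⟩
    exact this.1
  have hcont : ContinuousOn (fderiv ℝ f) U := hf.continuousOn_fderiv_of_isOpen hU (by simp)
  refine ⟨U ∩ fderiv ℝ f ⁻¹' {0}ᶜ, f, hcont.isOpen_inter_preimage hU isOpen_compl_singleton,
    ⟨hpU, hf'⟩, hf.mono inter_subset_left, fun x hx => hx.2, fun x hx => hmem x hx.1, ?_⟩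
  rintro x ⟨hxU, -⟩ hx
  refine le_antisymm ?_ ?_
  · have : x ∈ Ω ∩ U := ⟨hcl.frontier_subset hx, hxU⟩
    rw [hΩU] at this
    exact this.2
  · by_contra hlt
    push Not at hlt
    refine hx.2 ?_
    rw [mem_interior_iff_mem_nhds]
    have hcx : ContinuousAt f x := hf.continuousOn.continuousAt (hU.mem_nhds hxU)
    filter_upwards [hU.mem_nhds hxU, hcx.eventually (gt_mem_nhds hlt)] with y hy hy'
    exact hmem y hy hy'.le

/-- The unit gradient of `f`. -/
def unitGradient (f : E n → ℝ) (x : E n) : E n :=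
  ‖gradient f x‖⁻¹ • gradient f x

theorem norm_unitGradient {f : E n → ℝ} {x : E n} (h : fderiv ℝ f x ≠ 0) :
    ‖unitGradient f x‖ = 1 := by
  have : gradient f x ≠ 0 := by simpa [gradient] using h
  rw [unitGradient, norm_smul, norm_inv, norm_norm, inv_mul_cancel₀ (norm_ne_zero_iff.2 this)]

theorem contDiffOn_unitGradient {f : E n → ℝ} {U : Set (E n)} (hU : IsOpen U)
    (hf : ContDiffOn ℝ ∞ f U) (hf' : ∀ x ∈ U, fderiv ℝ f x ≠ 0) :
    ContDiffOn ℝ 1 (unitGradient f) U := by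
  have h1 : ContDiffOn ℝ 1 (gradient f) U := by
    have : ContDiffOn ℝ 1 (fderiv ℝ f) U := hf.fderiv_of_isOpen hU (by norm_cast)
    exact (InnerProductSpace.toDual ℝ (E n)).symm.contDiff.comp_contDiffOn this
  have h0 : ∀ x ∈ U, gradient f x ≠ 0 := fun x hx => by simpa [gradient] using hf' x hx
  exact ((h1.norm ℝ h0).inv fun x hx => norm_ne_zero_iff.2 (h0 x hx)).smul h1

/-- First-order expansion: `f (q + h)` is at most `⟪∇f, h⟫ + ε ‖∇f‖ ‖h‖`, which is nonpositive on
the cone. This inner cone condition is the form in which smoothness is used below. -/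
theorem mem_of_inner_unitGradient_le {f : E n → ℝ} {U : Set (E n)} (hU : IsOpen U)
    (hf : ContDiffOn ℝ ∞ f U) (hf' : ∀ x ∈ U, fderiv ℝ f x ≠ 0) (hmem : ∀ x ∈ U, f x ≤ 0 → x ∈ Ω)
    {q : E n} (hq : q ∈ U) (hfq : f q = 0) {ε : ℝ} (hε : 0 < ε) :
    ∃ δ > 0, ∀ h : E n, ‖h‖ < δ → ⟪unitGradient f q, h⟫ ≤ -ε * ‖h‖ → q + h ∈ Ω := by
  have hg0 : gradient f q ≠ 0 := by simpa [gradient] using hf' q hq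
  have hgn : 0 < ‖gradient f q‖ := norm_pos_iff.2 hg0
  have hd : HasFDerivAt f (fderiv ℝ f q) q :=
    ((hf.contDiffAt (hU.mem_nhds hq)).differentiableAt (by simp)).hasFDerivAt
  have h1 := hd.isLittleO.def (show 0 < ε * ‖gradient f q‖ by positivity)
  obtain ⟨δ, hδ, hball⟩ := Metric.eventually_nhds_iff_ball.1 (h1.and (hU.mem_nhds hq))
  refine ⟨δ, hδ, fun h hh hle => ?_⟩
  have hb : q + h ∈ ball q δ := by simpa [dist_eq_norm] using hh
  obtain ⟨h2, h3⟩ := hball _ hb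
  refine hmem _ h3 ?_
  rw [add_sub_cancel_left, hfq, sub_zero] at h2
  have h4 : fderiv ℝ f q h = ‖gradient f q‖ * ⟪unitGradient f q, h⟫ := by
    rw [unitGradient, inner_smul_left]
    simp only [conj_trivial]
    rw [← mul_assoc, mul_inv_cancel₀ hgn.ne', one_mul, gradient,
      InnerProductSpace.toDual_symm_apply]
  rw [h4, Real.norm_eq_abs] at h2
  have h5 := (abs_le.1 h2).2
  nlinarith [mul_le_mul_of_nonneg_left hle hgn.le]

/-- A unit vector that sees a cone of directions into `Ω` is the only outer unit normal. -/
theorem IsOuterUnitNormal.eq_of_forall_mem {q v N : E n} (hv : IsOuterUnitNormal Ω q v)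
    (hN : ‖N‖ = 1)
    (H : ∀ ε > 0, ∃ δ > 0, ∀ h : E n, ‖h‖ < δ → ⟪N, h⟫ ≤ -ε * ‖h‖ → q + h ∈ Ω) : v = N := by
  have key : ∀ w : E n, ⟪N, w⟫ < 0 → ⟪v, w⟫ ≤ 0 := by
    intro w hw
    have hw0 : w ≠ 0 := by rintro rfl; simp at hw
    have hwn : 0 < ‖w‖ := norm_pos_iff.2 hw0
    obtain ⟨δ, hδ, hδ'⟩ := H (-⟪N, w⟫ / ‖w‖) (div_pos (by linarith) hwn)
    have ht : 0 < δ / (2 * ‖w‖) := by positivity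
    have h1 := hδ' ((δ / (2 * ‖w‖)) • w) (by
      rw [norm_smul, Real.norm_of_nonneg ht.le]
      field_simp
      linarith) (by
      rw [inner_smul_right, norm_smul, Real.norm_of_nonneg ht.le]
      field_simp
      linarith)
    have h2 := hv.2 _ h1
    rw [add_sub_cancel_left, inner_smul_right] at h2
    by_contra h3
    push Not at h3
    have := mul_pos ht h3
    linarith
  have hNN : ⟪N, N⟫ = 1 := by rw [real_inner_self_eq_norm_sq, hN]; norm_num
  have hvv : ⟪v, v⟫ = 1 := by rw [real_inner_self_eq_norm_sq, hv.1]; norm_num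
  set c := ⟪v, N⟫ with hc
  have hc0 : 0 ≤ c := by
    have := key (-N) (by rw [inner_neg_right, hNN]; norm_num)
    rw [inner_neg_right] at this
    linarith
  -- Test with `v - (c + η) N`, which `N` sees as strictly negative. The value `η = 1 - c` then
  -- rules out `c < 1`.
  have hη : ∀ η > 0, 1 - c * (c + η) ≤ 0 := by
    intro η hη
    have := key (v - (c + η) • N) (by
      rw [inner_sub_right, inner_smul_right, hNN, real_inner_comm, ← hc]; linarith)
    rw [inner_sub_right, inner_smul_right, hvv, ← hc] at this
    linarith
  have hc1 : 1 ≤ c := by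
    by_contra hlt
    push Not at hlt
    have := hη (1 - c) (by linarith)
    linarith
  have hcle : c ≤ 1 := by
    have := real_inner_le_norm v N
    rwa [hv.1, hN, one_mul] at this
  exact (inner_eq_one_iff_of_norm_eq_one hv.1 hN).1 (le_antisymm hcle hc1)

/-- Structure of a smooth convex body at a boundary point. -/
theorem HasSmoothBoundary.exists_local_gaussMap (hΩ : HasSmoothBoundary Ω) (hc : IsCompact Ω)
    (hconv : Convex ℝ Ω) {p : E n} (hp : p ∈ frontier Ω) :
    ∃ (U : Set (E n)) (N : E n → E n), IsOpen U ∧ p ∈ U ∧ ContDiffOn ℝ 1 N U ∧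
      ∀ q ∈ U, q ∈ frontier Ω → gaussMap Ω q = N q ∧ IsOuterUnitNormal Ω q (N q) ∧
        (∀ v, IsOuterUnitNormal Ω q v → v = N q) ∧
        ∀ ε > 0, ∃ δ > 0, ∀ h : E n, ‖h‖ < δ → ⟪N q, h⟫ ≤ -ε * ‖h‖ → q + h ∈ Ω := by
  have hne : Ω.Nonempty := ⟨p, hc.isClosed.frontier_subset hp⟩
  have hint := hΩ.nonempty_interior hc hne
  obtain ⟨U, f, hU, hpU, hf, hf', hmem, hzero⟩ := hΩ.exists_defining hc.isClosed hp
  refine ⟨U, unitGradient f, hU, hpU, contDiffOn_unitGradient hU hf hf', fun q hq hqfr => ?_⟩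
  have H : ∀ ε > 0, ∃ δ > 0, ∀ h : E n, ‖h‖ < δ → ⟪unitGradient f q, h⟫ ≤ -ε * ‖h‖ → q + h ∈ Ω :=
    fun ε hε => mem_of_inner_unitGradient_le hU hf hf' hmem hq (hzero q hq hqfr) hε
  have huniq : ∀ v, IsOuterUnitNormal Ω q v → v = unitGradient f q := fun v hv =>
    hv.eq_of_forall_mem (norm_unitGradient (hf' q hq)) H
  obtain ⟨v, hv⟩ := exists_isOuterUnitNormal hconv hint hqfr.2
  have hg : IsOuterUnitNormal Ω q (gaussMap Ω q) := Classical.epsilon_spec ⟨v, hv⟩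
  exact ⟨huniq _ hg, huniq v hv ▸ hv, huniq, H⟩

theorem isOuterUnitNormal_gaussMap (hconv : Convex ℝ Ω) (hint : (interior Ω).Nonempty) {p : E n}
    (hp : p ∉ interior Ω) : IsOuterUnitNormal Ω p (gaussMap Ω p) :=
  Classical.epsilon_spec (exists_isOuterUnitNormal hconv hint hp)

theorem HasSmoothBoundary.eq_gaussMap (hΩ : HasSmoothBoundary Ω) (hc : IsCompact Ω)
    (hconv : Convex ℝ Ω) {p : E n} (hp : p ∈ frontier Ω) {v : E n}
    (hv : IsOuterUnitNormal Ω p v) : v = gaussMap Ω p := by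
  obtain ⟨U, N, -, hpU, -, h⟩ := hΩ.exists_local_gaussMap hc hconv hp
  rw [(h p hpU hp).1]
  exact (h p hpU hp).2.2.1 v hv

theorem HasSmoothBoundary.mem_of_inner_gaussMap_le (hΩ : HasSmoothBoundary Ω) (hc : IsCompact Ω)
    (hconv : Convex ℝ Ω) {p : E n} (hp : p ∈ frontier Ω) {ε : ℝ} (hε : 0 < ε) :
    ∃ δ > 0, ∀ h : E n, ‖h‖ < δ → ⟪gaussMap Ω p, h⟫ ≤ -ε * ‖h‖ → p + h ∈ Ω := by
  obtain ⟨U, N, -, hpU, -, h⟩ := hΩ.exists_local_gaussMap hc hconv hp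
  rw [(h p hpU hp).1]
  exact (h p hpU hp).2.2.2 ε hε

theorem HasSmoothBoundary.continuousOn_gaussMap (hΩ : HasSmoothBoundary Ω) (hc : IsCompact Ω)
    (hconv : Convex ℝ Ω) : ContinuousOn (gaussMap Ω) (frontier Ω) := by
  intro p hp
  obtain ⟨U, N, hU, hpU, hN, h⟩ := hΩ.exists_local_gaussMap hc hconv hp
  have h1 : ContinuousWithinAt N (frontier Ω) p :=
    (hN.continuousOn.continuousAt (hU.mem_nhds hpU)).continuousWithinAt
  refine h1.congr_of_eventuallyEq ?_ (h p hpU hp).1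
  filter_upwards [self_mem_nhdsWithin, mem_nhdsWithin_of_mem_nhds (hU.mem_nhds hpU)] with q hq hqU
  exact (h q hqU hq).1

/-- Stepping outward along `v` from a contact point leaves `Ω`. This gives surjectivity of the Gauss
map and, later, its constancy on flat segments. -/
theorem mem_frontier_of_inner_eq {z p v : E n} (hv : IsOuterUnitNormal Ω p v)
    (hz : z ∈ Ω) (h : ⟪v, z - p⟫ = 0) : z ∈ frontier Ω ∧ IsOuterUnitNormal Ω z v := by
  have hn : IsOuterUnitNormal Ω z v := by
    refine ⟨hv.1, fun w hw => ?_⟩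
    have h1 := hv.2 w hw
    rw [show w - z = (w - p) - (z - p) by abel, inner_sub_right, h]
    linarith
  refine ⟨⟨subset_closure hz, fun hint => ?_⟩, hn⟩
  have h1 : Filter.Tendsto (fun t : ℝ => z + t • v) (nhdsWithin 0 (Ioi 0)) (nhds z) := by
    have : Continuous fun t : ℝ => z + t • v := by fun_prop
    simpa using (this.tendsto 0).mono_left nhdsWithin_le_nhds
  obtain ⟨t, ht, ht0⟩ := ((h1.eventually (mem_interior_iff_mem_nhds.1 hint)).and
    self_mem_nhdsWithin).exists
  have h2 := hn.2 _ ht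
  rw [add_sub_cancel_left, inner_smul_right, real_inner_self_eq_norm_sq, hn.1] at h2
  have : (0 : ℝ) < t := ht0
  linarith

/-- Every unit vector is the Gauss image of some boundary point. -/
theorem HasSmoothBoundary.exists_gaussMap_eq (hΩ : HasSmoothBoundary Ω) (hc : IsCompact Ω)
    (hconv : Convex ℝ Ω) (hne : Ω.Nonempty) {x : E n} (hx : ‖x‖ = 1) :
    ∃ p ∈ frontier Ω, gaussMap Ω p = x := by
  obtain ⟨p, hp, hpx⟩ := exists_inner_eq_supportFun hc hne 0 x
  have hn : IsOuterUnitNormal Ω p x := by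
    refine ⟨hx, fun w hw => ?_⟩
    have := inner_le_supportFun hc 0 x hw
    rw [← hpx, sub_zero, sub_zero] at this
    rw [inner_sub_right]
    linarith
  have hfr := (mem_frontier_of_inner_eq hn hp (by simp)).1
  exact ⟨p, hfr, (hΩ.eq_gaussMap hc hconv hfr hn).symm⟩

theorem supportFun_eq_inner_of_normal (hc : IsCompact Ω) {p v : E n}
    (hp : p ∈ Ω) (hv : IsOuterUnitNormal Ω p v) (z : E n) :
    supportFun Ω z v = ⟪v, p - z⟫ := by
  refine le_antisymm (supportFun_le ⟨p, hp⟩ fun w hw => ?_) (inner_le_supportFun hc z v hp)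
  have := hv.2 w hw
  rw [show w - z = (w - p) + (p - z) by abel, inner_add_right]
  linarith

/-- A point slightly inside along the inner normal belongs to the interior. -/
theorem HasSmoothBoundary.exists_sub_smul_mem_interior (hΩ : HasSmoothBoundary Ω)
    (hc : IsCompact Ω) (hconv : Convex ℝ Ω) {p : E n} (hp : p ∈ frontier Ω) :
    ∃ δ > (0 : ℝ), p - δ • gaussMap Ω p ∈ interior Ω := by
  have hne : Ω.Nonempty := ⟨p, hc.isClosed.frontier_subset hp⟩
  have hn := isOuterUnitNormal_gaussMap hconv (hΩ.nonempty_interior hc hne) hp.2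
  obtain ⟨δ, hδ, H⟩ := hΩ.mem_of_inner_gaussMap_le hc hconv hp (ε := 1 / 2) (by norm_num)
  set ν := gaussMap Ω p
  have hmem : p - (δ / 2) • ν ∈ Ω := by
    have := H (-((δ / 2) • ν)) (by
      rw [norm_neg, norm_smul, hn.1, Real.norm_of_nonneg (by positivity)]; linarith) (by
      rw [norm_neg, norm_smul, hn.1, Real.norm_of_nonneg (by positivity), inner_neg_right,
        inner_smul_right, real_inner_self_eq_norm_sq, hn.1]; nlinarith)
    rwa [← sub_eq_add_neg] at this
  refine ⟨δ / 2, by positivity, mem_interior_iff_mem_nhds.2 ?_⟩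
  have hcont : Continuous fun y : E n => (‖y - p‖, ⟪ν, y - p⟫ + 1 / 2 * ‖y - p‖) := by fun_prop
  have h0 : (‖p - (δ / 2) • ν - p‖, ⟪ν, p - (δ / 2) • ν - p⟫ + 1 / 2 * ‖p - (δ / 2) • ν - p‖) ∈
      Iio δ ×ˢ Iio (0 : ℝ) := by
    have e : p - (δ / 2) • ν - p = -((δ / 2) • ν) := by abel
    rw [e, norm_neg, norm_smul, hn.1, Real.norm_of_nonneg (by positivity), inner_neg_right,
      inner_smul_right, real_inner_self_eq_norm_sq, hn.1]
    constructor
    · simp only [mem_Iio]; linarith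
    · simp only [mem_Iio]; linarith
  filter_upwards [hcont.continuousAt.preimage_mem_nhds ((isOpen_Iio.prod isOpen_Iio).mem_nhds h0)]
    with y hy
  have := H (y - p) hy.1 (by have : ⟪ν, y - p⟫ + 1 / 2 * ‖y - p‖ < 0 := hy.2; linarith)
  simpa using this

end normals

/-! ### Existence and uniqueness of the entropy point -/

section entropyPoint

variable {n : ℕ} {Ω : Set (E n)}

/-- A linear isometry acting on the unit sphere. -/
def sphereMap (L : E n ≃ₗᵢ[ℝ] E n) (x : sphere (0 : E n) 1) : sphere (0 : E n) 1 :=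
  ⟨L x, by simp⟩

theorem continuous_sphereMap (L : E n ≃ₗᵢ[ℝ] E n) : Continuous (sphereMap L) :=
  (L.continuous.comp continuous_subtype_val).subtype_mk _

/-- The sphere measure is defined by volumes of cones from the origin, which linear isometries
preserve. -/
theorem measurePreserving_sphereMap (L : E n ≃ₗᵢ[ℝ] E n) :
    MeasurePreserving (sphereMap L) (sphereMeasure n) (sphereMeasure n) := by
  refine ⟨(continuous_sphereMap L).measurable, ?_⟩
  ext A hA
  have hA' := (continuous_sphereMap L).measurable hA
  rw [Measure.map_apply (continuous_sphereMap L).measurable hA, Measure.toSphere_apply' _ hA',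
    Measure.toSphere_apply' _ hA]
  congr 1
  have h1 : L ⁻¹' (Ioo (0 : ℝ) 1 • (Subtype.val '' A)) =
      Ioo (0 : ℝ) 1 • (Subtype.val '' (sphereMap L ⁻¹' A)) := by
    ext y
    simp only [mem_preimage, mem_smul, mem_image]
    constructor
    · rintro ⟨r, hr, _, ⟨x, hx, rfl⟩, hxy⟩
      refine ⟨r, hr, L.symm x, ⟨sphereMap L.symm x, ?_, rfl⟩, ?_⟩
      · have : sphereMap L (sphereMap L.symm x) = x := Subtype.ext (by simp [sphereMap])
        rwa [this]
      · rw [← map_smul, hxy, LinearIsometryEquiv.symm_apply_apply]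
    · rintro ⟨r, hr, _, ⟨x, hx, rfl⟩, rfl⟩
      exact ⟨r, hr, _, ⟨_, hx, rfl⟩, by simp [sphereMap]⟩
  rw [← h1]
  exact L.measurePreserving.measure_preimage_equiv (f := L.toMeasurableEquiv) _

/-- The integral of `log u_z` over the sphere. -/
def logIntegral (Ω : Set (E n)) (z : E n) : ℝ :=
  ∫ x : sphere (0 : E n) 1, Real.log (supportFun Ω z x) ∂(sphereMeasure n)

theorem meanLogSupport_eq (z : E n) : meanLogSupport Ω z = (1 / sphereArea n) * logIntegral Ω z :=
  rfl

theorem continuousOn_logIntegral (hc : IsCompact Ω) :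
    ContinuousOn (logIntegral Ω) (interior Ω) := by
  rcases (interior Ω).eq_empty_or_nonempty with h | hint
  · rw [h]; exact continuousOn_empty _
  have hne := hint.mono interior_subset
  rw [continuousOn_iff_continuous_domRestrict]
  have hloc : LocallyCompactSpace (interior Ω) := isOpen_interior.locallyCompactSpace
  have hcont : Continuous (Function.uncurry fun (z : interior Ω) (x : sphere (0 : E n) 1) =>
      Real.log (supportFun Ω z x)) := by
    refine Continuous.log ?_ fun q => (supportFun_pos hc q.1.2 (ne_zero_of_mem_unit_sphere q.2)).ne'
    have : (fun q : interior Ω × sphere (0 : E n) 1 => supportFun Ω (q.1 : E n) (q.2 : E n)) =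
        fun q => supportFun Ω 0 (q.2 : E n) + ⟪(q.2 : E n), 0 - (q.1 : E n)⟫ :=
      funext fun q => supportFun_eq_add_inner hc hne _ 0 _
    rw [this]
    have := continuous_supportFun hc hne 0
    fun_prop
  have := continuous_parametric_integral_of_continuous (μ := sphereMeasure n) hcont isCompact_univ
  simp only [Measure.restrict_univ] at this
  exact this

theorem supportFun_lineMap (hc : IsCompact Ω) (hne : Ω.Nonempty) (z w x : E n) (t : ℝ) :
    supportFun Ω (z + t • (w - z)) x = supportFun Ω z x + t * (supportFun Ω w x - supportFun Ω z x) := by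
  rw [supportFun_eq_add_inner hc hne _ z, supportFun_eq_add_inner hc hne w z,
    sub_add_cancel_left, ← smul_neg, inner_smul_right, neg_sub]
  ring

/-- First order condition at a maximum of the mean logarithm. -/
theorem integral_supportFun_div_le (hc : IsCompact Ω) {z w : E n} (hz : z ∈ interior Ω)
    (hw : w ∈ interior Ω)
    (hmax : ∀ t ∈ Ioo (0 : ℝ) 1, logIntegral Ω (z + t • (w - z)) ≤ logIntegral Ω z) :
    ∫ x : sphere (0 : E n) 1, (supportFun Ω w x / supportFun Ω z x - 1) ∂(sphereMeasure n) ≤ 0 := by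
  have hne : Ω.Nonempty := ⟨z, interior_subset hz⟩
  have hzpos (x : sphere (0 : E n) 1) : 0 < supportFun Ω z x :=
    supportFun_pos hc hz (ne_zero_of_mem_unit_sphere x)
  have hwpos (x : sphere (0 : E n) 1) : 0 < supportFun Ω w x :=
    supportFun_pos hc hw (ne_zero_of_mem_unit_sphere x)
  have hzc : Continuous fun x : sphere (0 : E n) 1 => supportFun Ω z x :=
    (continuous_supportFun hc hne z).comp continuous_subtype_val
  have hwc : Continuous fun x : sphere (0 : E n) 1 => supportFun Ω w x :=
    (continuous_supportFun hc hne w).comp continuous_subtype_val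
  set y : sphere (0 : E n) 1 → ℝ := fun x => supportFun Ω w x / supportFun Ω z x - 1 with hy
  have hyc : Continuous y := (hwc.div hzc fun x => (hzpos x).ne').sub continuous_const
  have hy1 (x) : -1 < y x := by
    have := div_pos (hwpos x) (hzpos x)
    simp only [hy]; linarith
  obtain ⟨Y, hY⟩ := (isCompact_range hyc).isBounded.exists_norm_le
  have hY' (x) : |y x| ≤ Y := hY _ (mem_range_self x)
  have hyi := integrable_of_continuous_sphere hyc
  have hY0 : 0 ≤ Y := (abs_nonneg _).trans
    (hY' ⟨EuclideanSpace.single 0 1, by simp⟩)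
  -- the inequality up to an error of order `t`
  have key : ∀ t ∈ Ioo (0 : ℝ) (1 / 2), ∫ x, y x ∂(sphereMeasure n) ≤
      t * (2 * Y ^ 2 * (sphereMeasure n).real univ) := by
    rintro t ⟨ht0, ht1⟩
    have hpos (x) : 1 / 2 < 1 + t * y x := by nlinarith [hy1 x]
    have hcont1 : Continuous fun x => Real.log (1 + t * y x) :=
      (continuous_const.add (continuous_const.mul hyc)).log fun x =>
        (lt_trans (by norm_num) (hpos x)).ne'
    have h1 : ∫ x, Real.log (1 + t * y x) ∂(sphereMeasure n) ≤ 0 := by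
      have h2 := hmax t ⟨ht0, by linarith⟩
      have h3 : logIntegral Ω (z + t • (w - z)) = logIntegral Ω z +
          ∫ x, Real.log (1 + t * y x) ∂(sphereMeasure n) := by
        rw [logIntegral, logIntegral, ← integral_add (integrable_of_continuous_sphere
          (continuous_log_supportFun_sphere hc hz)) (integrable_of_continuous_sphere hcont1)]
        congr 1 with x
        rw [← Real.log_mul (hzpos x).ne' (by linarith [hpos x]), supportFun_lineMap hc hne]
        congr 1
        simp only [hy]
        have := (hzpos x).ne'
        field_simp
      linarith
    -- From `log s ≥ 1 - 1/s` at `s = 1 + t y`; as `y > -1` and `t < 1/2`, the denominator exceeds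
    -- `1/2`, whence the `2` in the error term.
    have h4 (x) : t * (y x - t * (2 * Y ^ 2)) ≤ Real.log (1 + t * y x) := by
      have hp := hpos x
      refine le_trans ?_ (Real.one_sub_inv_le_log_of_pos (by linarith : 0 < 1 + t * y x))
      have e : 1 - (1 + t * y x)⁻¹ = t * (y x - t * (y x ^ 2 / (1 + t * y x))) := by
        field_simp
        ring
      rw [e]
      have h5 : y x ^ 2 / (1 + t * y x) ≤ 2 * Y ^ 2 := by
        rw [div_le_iff₀ (by linarith)]
        have : y x ^ 2 ≤ Y ^ 2 := sq_le_sq' (by linarith [neg_le_of_abs_le (hY' x)])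
          (le_of_abs_le (hY' x))
        nlinarith
      gcongr
    have h6 : t * (∫ x, y x ∂(sphereMeasure n) - t * (2 * Y ^ 2) * (sphereMeasure n).real univ) ≤ 0 := by
      refine le_trans ?_ h1
      have h7 : ∫ x, t * (y x - t * (2 * Y ^ 2)) ∂(sphereMeasure n) ≤
          ∫ x, Real.log (1 + t * y x) ∂(sphereMeasure n) :=
        integral_mono ((hyi.sub (integrable_const _)).const_mul t)
          (integrable_of_continuous_sphere hcont1) h4
      rw [integral_const_mul, integral_sub hyi (integrable_const _)] at h7
      simp only [integral_const, smul_eq_mul] at h7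
      refine le_trans (le_of_eq ?_) h7
      ring
    have := nonpos_of_mul_nonpos_right h6 ht0
    linarith
  by_contra hlt
  push Not at hlt
  set I := ∫ x, y x ∂(sphereMeasure n) with hI
  set M := 2 * Y ^ 2 * (sphereMeasure n).real univ with hM
  have hM0 : 0 ≤ M := by positivity
  -- This `t` makes the error at most `I / 2`, contradicting `I > 0`.
  have h8 := key (min (1 / 4) (I / (2 * (M + 1)))) ⟨by positivity, by
    exact (min_le_left _ _).trans_lt (by norm_num)⟩
  have h9 : min (1 / 4) (I / (2 * (M + 1))) * M ≤ I / (2 * (M + 1)) * M := by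
    gcongr; exact min_le_right _ _
  have h10 : I / (2 * (M + 1)) * M ≤ I / 2 := by
    rw [div_mul_eq_mul_div, div_le_div_iff₀ (by positivity) (by positivity)]
    nlinarith
  linarith

/-- The converse direction: by `log t ≤ t - 1` at `t = u_w / u_z`, the first-order condition at `z`
suffices for a global maximum. -/
theorem logIntegral_le_of_integral_le (hc : IsCompact Ω) {z w : E n} (hz : z ∈ interior Ω)
    (hw : w ∈ interior Ω)
    (h : ∫ x : sphere (0 : E n) 1, (supportFun Ω w x / supportFun Ω z x - 1) ∂(sphereMeasure n) ≤ 0) :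
    logIntegral Ω w ≤ logIntegral Ω z := by
  have hne : Ω.Nonempty := ⟨z, interior_subset hz⟩
  have hzpos (x : sphere (0 : E n) 1) : 0 < supportFun Ω z x :=
    supportFun_pos hc hz (ne_zero_of_mem_unit_sphere x)
  have hwpos (x : sphere (0 : E n) 1) : 0 < supportFun Ω w x :=
    supportFun_pos hc hw (ne_zero_of_mem_unit_sphere x)
  have hzc : Continuous fun x : sphere (0 : E n) 1 => supportFun Ω z x :=
    (continuous_supportFun hc hne z).comp continuous_subtype_val
  have hwc : Continuous fun x : sphere (0 : E n) 1 => supportFun Ω w x :=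
    (continuous_supportFun hc hne w).comp continuous_subtype_val
  rw [← sub_nonpos, logIntegral, logIntegral, ← integral_sub
    (integrable_of_continuous_sphere (continuous_log_supportFun_sphere hc hw))
    (integrable_of_continuous_sphere (continuous_log_supportFun_sphere hc hz))]
  refine le_trans (integral_mono ?_ ?_ fun x => ?_) h
  · exact (integrable_of_continuous_sphere (continuous_log_supportFun_sphere hc hw)).sub
      (integrable_of_continuous_sphere (continuous_log_supportFun_sphere hc hz))
  · exact integrable_of_continuous_sphere
      ((hwc.div hzc fun x => (hzpos x).ne').sub continuous_const)
  · rw [← Real.log_div (hwpos x).ne' (hzpos x).ne']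
    exact Real.log_le_sub_one_of_pos (div_pos (hwpos x) (hzpos x))

/-- The support function is affine in the base point, so at the midpoint of two maximisers the
arithmetic–geometric gap integrates to zero and `u_z = u_w` on the sphere. Evaluating in the
direction of `w - z` shows that the points coincide. -/
theorem eq_of_logIntegral_eq_max (hc : IsCompact Ω) (hconv : Convex ℝ Ω) {z w : E n}
    (hz : z ∈ interior Ω)
    (hw : w ∈ interior Ω) (hmax : ∀ v ∈ interior Ω, logIntegral Ω v ≤ logIntegral Ω z)
    (heq : logIntegral Ω w = logIntegral Ω z) : w = z := by
  have hne : Ω.Nonempty := ⟨z, interior_subset hz⟩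
  have hzpos (x : sphere (0 : E n) 1) : 0 < supportFun Ω z x :=
    supportFun_pos hc hz (ne_zero_of_mem_unit_sphere x)
  have hwpos (x : sphere (0 : E n) 1) : 0 < supportFun Ω w x :=
    supportFun_pos hc hw (ne_zero_of_mem_unit_sphere x)
  set m := z + (1 / 2 : ℝ) • (w - z) with hm
  have hmi : m ∈ interior Ω :=
    hconv.interior.add_smul_sub_mem hz hw ⟨by norm_num, by norm_num⟩
  have hum (x : E n) : supportFun Ω m x = (supportFun Ω z x + supportFun Ω w x) / 2 := by
    rw [hm, supportFun_lineMap hc hne]; ring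
  set D : sphere (0 : E n) 1 → ℝ := fun x => 2 * Real.log (supportFun Ω m x) -
    (Real.log (supportFun Ω z x) + Real.log (supportFun Ω w x)) with hD
  have hcm := continuous_log_supportFun_sphere hc hmi
  have hcz := continuous_log_supportFun_sphere hc hz
  have hcw := continuous_log_supportFun_sphere hc hw
  have hDc : Continuous D := (continuous_const.mul hcm).sub (hcz.add hcw)
  have hexp (x) : D x = Real.log (supportFun Ω m x ^ 2 / (supportFun Ω z x * supportFun Ω w x)) := by
    have hmpos := supportFun_pos hc hmi (ne_zero_of_mem_unit_sphere x)
    rw [Real.log_div (by positivity) (mul_pos (hzpos x) (hwpos x)).ne',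
      Real.log_mul (hzpos x).ne' (hwpos x).ne', Real.log_pow]
    simp only [hD]; push_cast; ring
  have hD0 (x) : 0 ≤ D x := by
    rw [hexp]
    refine Real.log_nonneg ?_
    rw [one_le_div (mul_pos (hzpos x) (hwpos x)), hum]
    nlinarith [sq_nonneg (supportFun Ω z x - supportFun Ω w x)]
  have hDi : ∫ x, D x ∂(sphereMeasure n) =
      2 * logIntegral Ω m - (logIntegral Ω z + logIntegral Ω w) := by
    have i1 := integrable_of_continuous_sphere hcm
    have i2 := integrable_of_continuous_sphere hcz
    have i3 := integrable_of_continuous_sphere hcw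
    simp only [hD, logIntegral]
    rw [integral_sub (i1.const_mul 2), integral_const_mul, integral_add i2 i3]
    exact i2.add i3
  have h0 : ∫ x, D x ∂(sphereMeasure n) = 0 := by
    refine le_antisymm ?_ (integral_nonneg hD0)
    rw [hDi, heq]
    linarith [hmax m hmi]
  have h1 := (hDc.ae_eq_iff_eq (sphereMeasure n) continuous_zero).1
    ((integral_eq_zero_iff_of_nonneg hD0 (integrable_of_continuous_sphere hDc)).1 h0)
  have h2 (x : sphere (0 : E n) 1) : supportFun Ω z x = supportFun Ω w x := by
    have h3 := congrFun h1 x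
    have hp := mul_pos (hzpos x) (hwpos x)
    have hmpos := supportFun_pos hc hmi (ne_zero_of_mem_unit_sphere x)
    rw [Pi.zero_apply, hexp] at h3
    have h4 : supportFun Ω m x ^ 2 / (supportFun Ω z x * supportFun Ω w x) = 1 :=
      Real.eq_one_of_pos_of_log_eq_zero (by positivity) h3
    rw [div_eq_one_iff_eq hp.ne', hum] at h4
    nlinarith [sq_nonneg (supportFun Ω z x - supportFun Ω w x)]
  by_contra hwz
  have hn : 0 < ‖w - z‖ := norm_pos_iff.2 (sub_ne_zero.2 hwz)
  have h5 := h2 ⟨‖w - z‖⁻¹ • (w - z), by simp [norm_smul, hn.ne']⟩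
  rw [supportFun_eq_add_inner hc hne z w, inner_smul_left, real_inner_self_eq_norm_sq] at h5
  have : (0 : ℝ) < ‖w - z‖⁻¹ * ‖w - z‖ ^ 2 := by positivity
  simp only [conj_trivial] at h5
  linarith

/-- The weight `u_w / u_z` integrates to more than the area of the sphere when `z` is a boundary
point and `w` lies on the inner normal at `z`. -/
theorem not_lintegral_supportFun_div_le (hc : IsCompact Ω) {z ν : E n} (hz : z ∈ Ω)
    (hν : IsOuterUnitNormal Ω z ν) {δ : ℝ} (hδ : 0 < δ) (hw : z - δ • ν ∈ interior Ω) :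
    ¬ ∫⁻ x : sphere (0 : E n) 1, ENNReal.ofReal (supportFun Ω (z - δ • ν) x) /
      ENNReal.ofReal (supportFun Ω z x) ∂(sphereMeasure n) ≤ sphereMeasure n univ := by
  intro hle
  have hne : Ω.Nonempty := ⟨z, hz⟩
  set w := z - δ • ν with hwdef
  set u : sphere (0 : E n) 1 → ℝ := fun x => supportFun Ω z x with hu
  set v : sphere (0 : E n) 1 → ℝ := fun x => supportFun Ω w x with hv
  have huc : Continuous u := (continuous_supportFun hc hne z).comp continuous_subtype_val
  have hvc : Continuous v := (continuous_supportFun hc hne w).comp continuous_subtype_val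
  have hvpos (x) : 0 < v x := supportFun_pos hc hw (ne_zero_of_mem_unit_sphere x)
  have hu0 (x) : 0 ≤ u x := supportFun_nonneg hc hz x
  have hvu (x) : v x = u x + δ * ⟪ν, (x : E n)⟫ := by
    simp only [hv, hu]
    rw [supportFun_eq_add_inner hc hne w z, hwdef, sub_sub_cancel, inner_smul_right,
      real_inner_comm]
  set L : E n ≃ₗᵢ[ℝ] E n := (Submodule.span ℝ {ν})ᗮ.reflection with hL
  have hLx (x : E n) : L x = x - (2 * ⟪ν, x⟫) • ν := by
    rw [hL, Submodule.reflection_orthogonal_apply, Submodule.reflection_singleton_apply, hν.1]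
    simp only [RCLike.ofReal_real_eq_id, id_eq, one_pow, div_one, neg_sub, mul_smul]
    rw [two_smul, two_smul]
  set σ := sphereMap L with hσ
  have hσc := continuous_sphereMap L
  have hσm := measurePreserving_sphereMap L
  have hσs (x : sphere (0 : E n) 1) : ⟪ν, (σ x : E n)⟫ = -⟪ν, (x : E n)⟫ := by
    change ⟪ν, L x⟫ = _
    rw [hLx, inner_sub_right, inner_smul_right, real_inner_self_eq_norm_sq, hν.1]
    ring
  have hσσ (x : sphere (0 : E n) 1) : σ (σ x) = x := by
    refine Subtype.ext ?_
    change L (L x) = x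
    exact Submodule.reflection_reflection _ _
  -- The body lies in `⟪ν, y - z⟫ ≤ 0`, so on the hemisphere around `ν` the support function grows
  -- under reflection.
  have hmono (x : sphere (0 : E n) 1) (hx : 0 ≤ ⟪ν, (x : E n)⟫) : u x ≤ u (σ x) := by
    refine supportFun_le hne fun y hy => ?_
    refine le_trans ?_ (inner_le_supportFun hc z _ hy)
    change _ ≤ ⟪L x, y - z⟫
    rw [hLx, inner_sub_left, inner_smul_left]
    simp only [conj_trivial]
    nlinarith [hν.2 y hy]
  have hm : Measurable fun x : sphere (0 : E n) 1 => ENNReal.ofReal (v x) / ENNReal.ofReal (u x) :=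
    (hvc.measurable.ennreal_ofReal).div huc.measurable.ennreal_ofReal
  -- In `ℝ≥0∞`, a positive number divided by zero is `⊤`, so a finite integral excludes zeros of `u`
  -- almost everywhere.
  have hupos : ∀ᵐ x ∂(sphereMeasure n), 0 < u x := by
    filter_upwards [ae_lt_top hm (ne_top_of_le_ne_top (measure_ne_top _ _) hle)] with x hx
    by_contra h0
    have h1 : u x = 0 := le_antisymm (not_lt.1 h0) (hu0 x)
    rw [h1, ENNReal.ofReal_zero, ENNReal.div_zero (by simpa using hvpos x)] at hx
    exact lt_irrefl _ hx
  have hupos' : ∀ᵐ x ∂(sphereMeasure n), 0 < u (σ x) := hσm.quasiMeasurePreserving.ae hupos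
  have hφ : ∫⁻ x, ENNReal.ofReal (v x / u x) ∂(sphereMeasure n) ≤ sphereMeasure n univ := by
    refine le_trans (le_of_eq (lintegral_congr_ae ?_)) hle
    filter_upwards [hupos] with x hx
    exact ENNReal.ofReal_div_of_pos hx
  have hφm : Measurable fun x => v x / u x := hvc.measurable.div huc.measurable
  have hφ0 (x) : 0 ≤ v x / u x := div_nonneg (hvpos x).le (hu0 x)
  have hφi : Integrable (fun x => v x / u x) (sphereMeasure n) := by
    refine ⟨hφm.aestronglyMeasurable, ?_⟩
    rw [hasFiniteIntegral_iff_ofReal (ae_of_all _ hφ0)]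
    exact hφ.trans_lt (measure_lt_top _ _)
  set q : sphere (0 : E n) 1 → ℝ := fun x => v x / u x - 1 with hq
  have hqi : Integrable q (sphereMeasure n) := hφi.sub (integrable_const _)
  have hqle : ∫ x, q x ∂(sphereMeasure n) ≤ 0 := by
    rw [hq, integral_sub hφi (integrable_const _), integral_const, smul_eq_mul, mul_one, sub_nonpos,
      integral_eq_lintegral_of_nonneg_ae (ae_of_all _ hφ0) hφm.aestronglyMeasurable]
    exact ENNReal.toReal_mono (measure_ne_top _ _) hφ
  have hqσi : Integrable (fun x => q (σ x)) (sphereMeasure n) := hσm.integrable_comp_of_integrable hqi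
  have hqσ : ∫ x, q (σ x) ∂(sphereMeasure n) = ∫ x, q x ∂(sphereMeasure n) := by
    conv_rhs => rw [← hσm.map_eq]
    rw [integral_map hσc.measurable.aemeasurable]
    rw [hσm.map_eq]
    exact hqi.aestronglyMeasurable
  -- `v / u - 1 = δ ⟪ν, x⟫ / u`, and the numerator is odd under `σ`; by `hmono` the symmetrised
  -- expression is nonnegative, so the assumed bound forces it to vanish almost everywhere.
  have hform : ∀ᵐ x ∂(sphereMeasure n), q x + q (σ x) =
      δ * (⟪ν, (x : E n)⟫ * (u (σ x) - u x)) / (u x * u (σ x)) := by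
    filter_upwards [hupos, hupos'] with x h1 h2
    simp only [hq, hvu, hσs]
    field_simp
    ring
  have hsum0 : 0 ≤ᵐ[sphereMeasure n] fun x => q x + q (σ x) := by
    filter_upwards [hform] with x hx
    rw [hx]
    refine div_nonneg (mul_nonneg hδ.le ?_) (mul_nonneg (hu0 _) (hu0 _))
    rcases le_total 0 ⟪ν, (x : E n)⟫ with hs | hs
    · exact mul_nonneg hs (sub_nonneg.2 (hmono x hs))
    · refine mul_nonneg_of_nonpos_of_nonpos hs (sub_nonpos.2 ?_)
      have := hmono (σ x) (by rw [hσs]; linarith)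
      rwa [hσσ] at this
  have hsum : ∫ x, (q x + q (σ x)) ∂(sphereMeasure n) = 0 := by
    refine le_antisymm ?_ (integral_nonneg_of_ae hsum0)
    rw [integral_add hqi hqσi, hqσ]
    linarith
  have hae := (integral_eq_zero_iff_of_nonneg_ae hsum0 (hqi.add hqσi)).1 hsum
  set G : Set (sphere (0 : E n) 1) := {x | ⟪ν, (x : E n)⟫ * (u (σ x) - u x) ≠ 0} with hG
  have hGo : IsOpen G := by
    have : Continuous fun x : sphere (0 : E n) 1 => ⟪ν, (x : E n)⟫ * (u (σ x) - u x) := by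
      have := huc.comp hσc
      fun_prop
    exact isOpen_ne_fun this continuous_const
  have hGnull : sphereMeasure n G = 0 := by
    rw [measure_eq_zero_iff_ae_notMem]
    filter_upwards [hform, hae, hupos, hupos'] with x h1 h2 h3 h4 hx
    rw [h1, Pi.zero_apply, div_eq_zero_iff] at h2
    rcases h2 with h2 | h2
    · exact hx ((mul_eq_zero.1 h2).resolve_left hδ.ne')
    · exact (mul_pos h3 h4).ne' h2
  -- At `x = ν` one has `u = 0`, while `u ≥ δ` at `-ν`; hence the open set where the symmetrised
  -- numerator is nonzero is nonempty.
  have hνG : (⟨ν, by simpa using hν.1⟩ : sphere (0 : E n) 1) ∈ G := by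
    have h1 : u ⟨ν, by simpa using hν.1⟩ = 0 := by
      simp only [hu]
      rw [supportFun_eq_inner_of_normal hc hz hν]
      simp
    have h2 : 0 < u (σ ⟨ν, by simpa using hν.1⟩) := by
      have h3 := inner_le_supportFun hc z (L ν) (interior_subset hw)
      have h4 : ⟪L ν, w - z⟫ = δ := by
        rw [hLx, real_inner_self_eq_norm_sq, hν.1, hwdef]
        simp only [inner_sub_left, inner_smul_left, sub_sub_cancel_left, inner_neg_right,
          inner_smul_right, real_inner_self_eq_norm_sq, hν.1, conj_trivial]
        ring
      rw [h4] at h3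
      exact hδ.trans_le h3
    simp only [hG, mem_ofPred_eq, h1, real_inner_self_eq_norm_sq, hν.1, sub_zero]
    simpa using h2.ne'
  exact (hGo.measure_pos _ ⟨_, hνG⟩).ne' hGnull

theorem HasSmoothBoundary.exists_logIntegral_max (hΩ : HasSmoothBoundary Ω) (hc : IsCompact Ω)
    (hconv : Convex ℝ Ω) (hne : Ω.Nonempty) :
    ∃ z ∈ interior Ω, ∀ w ∈ interior Ω, logIntegral Ω w ≤ logIntegral Ω z := by
  obtain ⟨c₀, hc₀⟩ := hΩ.nonempty_interior hc hne
  set ε : ℕ → ℝ := fun k => 1 / ((k : ℝ) + 2) with hε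
  have hε0 (k) : 0 < ε k := by positivity
  have hε1 (k) : ε k < 1 := by
    simp only [hε]
    rw [div_lt_one (by positivity)]
    have : (0 : ℝ) ≤ k := by positivity
    linarith
  have hεlim : Filter.Tendsto ε Filter.atTop (nhds 0) := by
    have := (tendsto_const_div_atTop_nhds_zero_nat (1 : ℝ)).comp (Filter.tendsto_add_atTop_nat 2)
    refine this.congr fun k => ?_
    simp [hε]
  -- Contraction towards an interior point: its image is a compact subset of the interior, where
  -- `logIntegral` is continuous and a maximum exists. The shift by `2` keeps `ε k < 1` also at `k =
  -- 0`.
  set S : ℕ → E n → E n := fun k y => y + ε k • (c₀ - y) with hS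
  have hSint (k) (y) (hy : y ∈ Ω) : S k y ∈ interior Ω :=
    hconv.add_smul_sub_mem_interior hy hc₀ ⟨hε0 k, (hε1 k).le⟩
  have hSc (k) : Continuous (S k) := by fun_prop
  have hex (k) : ∃ y ∈ Ω, ∀ y' ∈ Ω, logIntegral Ω (S k y') ≤ logIntegral Ω (S k y) := by
    have hcont : ContinuousOn (fun y => logIntegral Ω (S k y)) Ω :=
      (continuousOn_logIntegral hc).comp (hSc k).continuousOn (hSint k)
    obtain ⟨y, hy, hmax⟩ := hc.exists_isMaxOn hne hcont
    exact ⟨y, hy, fun y' hy' => hmax hy'⟩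
  choose y hyΩ hymax using hex
  obtain ⟨z, hz, φ, hφ, hlim⟩ := hc.tendsto_subseq hyΩ
  have hzlim : Filter.Tendsto (fun k => S (φ k) (y (φ k))) Filter.atTop (nhds z) := by
    have h1 : Filter.Tendsto (fun k => ε (φ k)) Filter.atTop (nhds 0) :=
      hεlim.comp hφ.tendsto_atTop
    have := hlim.add (h1.smul ((tendsto_const_nhds (x := c₀)).sub hlim))
    simpa using this
  have hfirst : ∀ w ∈ interior Ω, ∀ᶠ k in Filter.atTop,
      ∫⁻ x : sphere (0 : E n) 1, ENNReal.ofReal (supportFun Ω w x) /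
        ENNReal.ofReal (supportFun Ω (S k (y k)) x) ∂(sphereMeasure n) ≤ sphereMeasure n univ := by
    intro w hw
    -- The preimage of `w` under the contraction `S k`. It tends to `w`, so for large `k` it lies in
    -- `Ω` and `w` is an admissible competitor.
    have h1 : Filter.Tendsto (fun k => w + (ε k / (1 - ε k)) • (w - c₀)) Filter.atTop (nhds w) := by
      have h2 : Filter.Tendsto (fun k => ε k / (1 - ε k)) Filter.atTop (nhds (0 / (1 - 0))) :=
        hεlim.div (tendsto_const_nhds.sub hεlim) (by norm_num)
      have := (tendsto_const_nhds (x := w)).add (h2.smul_const (w - c₀))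
      simpa using this
    filter_upwards [h1.eventually (mem_interior_iff_mem_nhds.1 hw)] with k hk
    have hSw : S k (w + (ε k / (1 - ε k)) • (w - c₀)) = w := by
      have h3 : (1 - ε k) ≠ 0 := by linarith [hε1 k]
      have e1 : S k (w + (ε k / (1 - ε k)) • (w - c₀)) =
          w + (((1 - ε k) * (ε k / (1 - ε k))) • (w - c₀) - ε k • (w - c₀)) := by
        simp only [hS]
        module
      rw [e1, mul_div_cancel₀ _ h3, sub_self, add_zero]
    have hzk := hSint k _ (hyΩ k)
    have h4 := integral_supportFun_div_le hc hzk hw (by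
      intro t ht
      have h5 := hymax k (y k + t • ((w + (ε k / (1 - ε k)) • (w - c₀)) - y k))
        (hconv.add_smul_sub_mem (hyΩ k) hk ⟨ht.1.le, ht.2.le⟩)
      have h6 : S k (y k + t • ((w + (ε k / (1 - ε k)) • (w - c₀)) - y k)) =
          S k (y k) + t • (w - S k (y k)) := by
        conv_rhs => rw [← hSw]
        simp only [hS]
        module
      rwa [h6] at h5)
    have hzpos (x : sphere (0 : E n) 1) : 0 < supportFun Ω (S k (y k)) x :=
      supportFun_pos hc hzk (ne_zero_of_mem_unit_sphere x)
    have hwpos (x : sphere (0 : E n) 1) : 0 < supportFun Ω w x :=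
      supportFun_pos hc hw (ne_zero_of_mem_unit_sphere x)
    have hcont : Continuous fun x : sphere (0 : E n) 1 =>
        supportFun Ω w x / supportFun Ω (S k (y k)) x :=
      ((continuous_supportFun hc hne w).comp continuous_subtype_val).div
        ((continuous_supportFun hc hne _).comp continuous_subtype_val) fun x => (hzpos x).ne'
    have hi := integrable_of_continuous_sphere hcont
    rw [integral_sub hi (integrable_const _), integral_const, smul_eq_mul, mul_one, sub_nonpos] at h4
    calc _ = ∫⁻ x : sphere (0 : E n) 1, ENNReal.ofReal
          (supportFun Ω w x / supportFun Ω (S k (y k)) x) ∂(sphereMeasure n) := by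
          congr 1 with x
          exact (ENNReal.ofReal_div_of_pos (hzpos x)).symm
      _ ≤ sphereMeasure n univ := by
          rw [← ofReal_integral_eq_lintegral_ofReal hi
            (ae_of_all _ fun x => (div_pos (hwpos x) (hzpos x)).le), ← ofReal_measureReal]
          exact ENNReal.ofReal_le_ofReal h4
  -- Fatou, in `ℝ≥0∞` because the limit `z` may still lie on the boundary.
  have hlimit : ∀ w ∈ interior Ω,
      ∫⁻ x : sphere (0 : E n) 1, ENNReal.ofReal (supportFun Ω w x) /
        ENNReal.ofReal (supportFun Ω z x) ∂(sphereMeasure n) ≤ sphereMeasure n univ := by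
    intro w hw
    have hwpos (x : sphere (0 : E n) 1) : 0 < supportFun Ω w x :=
      supportFun_pos hc hw (ne_zero_of_mem_unit_sphere x)
    set F : ℕ → sphere (0 : E n) 1 → ℝ≥0∞ := fun k x => ENNReal.ofReal (supportFun Ω w x) /
      ENNReal.ofReal (supportFun Ω (S (φ k) (y (φ k))) x) with hF
    have hFm (k) : Measurable (F k) := by
      have h1 := ((continuous_supportFun hc hne w).comp
        (continuous_subtype_val (p := fun x => x ∈ sphere (0 : E n) 1))).measurable.ennreal_ofReal
      have h2 := ((continuous_supportFun hc hne (S (φ k) (y (φ k)))).comp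
        (continuous_subtype_val (p := fun x => x ∈ sphere (0 : E n) 1))).measurable.ennreal_ofReal
      exact h1.div h2
    calc ∫⁻ x : sphere (0 : E n) 1, ENNReal.ofReal (supportFun Ω w x) /
        ENNReal.ofReal (supportFun Ω z x) ∂(sphereMeasure n)
        = ∫⁻ x, Filter.liminf (fun k => F k x) Filter.atTop ∂(sphereMeasure n) := by
          congr 1 with x
          refine (Filter.Tendsto.liminf_eq ?_).symm
          refine ENNReal.Tendsto.div tendsto_const_nhds (Or.inl ?_) ?_ (Or.inr ENNReal.ofReal_ne_top)
          · simpa using hwpos x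
          · exact ENNReal.tendsto_ofReal
              (((continuous_supportFun_left hc hne x).tendsto z).comp hzlim)
      _ ≤ Filter.liminf (fun k => ∫⁻ x, F k x ∂(sphereMeasure n)) Filter.atTop :=
          lintegral_liminf_le hFm
      _ ≤ Filter.limsup (fun k => ∫⁻ x, F k x ∂(sphereMeasure n)) Filter.atTop :=
          Filter.liminf_le_limsup
      _ ≤ sphereMeasure n univ :=
          Filter.limsup_le_of_le (h := hφ.tendsto_atTop.eventually (hfirst w hw))
  have hzint : z ∈ interior Ω := by
    by_contra hzn
    have hzfr : z ∈ frontier Ω := ⟨subset_closure hz, hzn⟩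
    obtain ⟨δ, hδ, hw⟩ := hΩ.exists_sub_smul_mem_interior hc hconv hzfr
    exact not_lintegral_supportFun_div_le hc hz
      (isOuterUnitNormal_gaussMap hconv ⟨c₀, hc₀⟩ hzn) hδ hw (hlimit _ hw)
  refine ⟨z, hzint, fun w hw => logIntegral_le_of_integral_le hc hzint hw ?_⟩
  have hzpos (x : sphere (0 : E n) 1) : 0 < supportFun Ω z x :=
    supportFun_pos hc hzint (ne_zero_of_mem_unit_sphere x)
  have hwpos (x : sphere (0 : E n) 1) : 0 < supportFun Ω w x :=
    supportFun_pos hc hw (ne_zero_of_mem_unit_sphere x)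
  have hcont : Continuous fun x : sphere (0 : E n) 1 => supportFun Ω w x / supportFun Ω z x :=
    ((continuous_supportFun hc hne w).comp continuous_subtype_val).div
      ((continuous_supportFun hc hne _).comp continuous_subtype_val) fun x => (hzpos x).ne'
  have hi := integrable_of_continuous_sphere hcont
  rw [integral_sub hi (integrable_const _), integral_const, smul_eq_mul, mul_one, sub_nonpos,
    integral_eq_lintegral_of_nonneg_ae (ae_of_all _ fun x => (div_pos (hwpos x) (hzpos x)).le)
      hcont.aestronglyMeasurable]
  refine ENNReal.toReal_mono (measure_ne_top _ _) (le_trans (le_of_eq ?_) (hlimit w hw))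
  congr 1 with x
  exact ENNReal.ofReal_div_of_pos (hzpos x)

end entropyPoint

/-! ### Determinants on a hyperplane -/

section linearAlgebra

variable {n : ℕ}

/-- The orthogonal projection onto the hyperplane `ν^⊥`, for a unit vector `ν`. -/
def tanProj (ν : E n) : E n →L[ℝ] E n :=
  ContinuousLinearMap.id ℝ (E n) - (innerSL ℝ ν).smulRight ν

theorem tanProj_apply (ν v : E n) : tanProj ν v = v - ⟪ν, v⟫ • ν := by
  simp [tanProj]

/-- The compression of `A` to `ν^⊥`, extended by the identity on the line spanned by `ν`. -/
def compression (ν : E n) (A : E n →L[ℝ] E n) : E n →L[ℝ] E n :=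
  tanProj ν ∘L A ∘L tanProj ν + (innerSL ℝ ν).smulRight ν

theorem compression_apply (ν : E n) (A : E n →L[ℝ] E n) (v : E n) :
    compression ν A v = tanProj ν (A (tanProj ν v)) + ⟪ν, v⟫ • ν := by
  simp [compression]

theorem inner_tanProj {ν : E n} (hν : ‖ν‖ = 1) (v : E n) : ⟪ν, tanProj ν v⟫ = 0 := by
  rw [tanProj_apply, inner_sub_right, inner_smul_right, real_inner_self_eq_norm_sq, hν]
  ring

theorem tanProj_of_inner_eq_zero {ν v : E n} (h : ⟪ν, v⟫ = 0) : tanProj ν v = v := by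
  rw [tanProj_apply, h, zero_smul, sub_zero]

/-- Moves the determinant from `ν^⊥`, a space depending on the boundary point, to the fixed ambient
space, where determinants can be compared and varied continuously. -/
theorem det_compression {ν : E n} (hν : ‖ν‖ = 1) (A : E n →L[ℝ] E n) :
    LinearMap.det ((((Submodule.span ℝ {ν})ᗮ.orthogonalProjectionOnto ∘L A ∘L
      (Submodule.span ℝ {ν})ᗮ.subtypeL : (Submodule.span ℝ {ν})ᗮ →L[ℝ] (Submodule.span ℝ {ν})ᗮ)) :
      (Submodule.span ℝ {ν})ᗮ →ₗ[ℝ] (Submodule.span ℝ {ν})ᗮ) = (compression ν A).det := by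
  set L := Submodule.span ℝ {ν} with hL
  set W : Lᗮ →L[ℝ] Lᗮ := Lᗮ.orthogonalProjectionOnto ∘L A ∘L Lᗮ.subtypeL with hW
  let e := Submodule.prodEquivOfIsCompl Lᗮ L L.isCompl_orthogonal.symm
  have hWv (a : Lᗮ) : (W a : E n) = tanProj ν (A a) := by
    rw [tanProj_apply, ← Submodule.starProjection_unit_singleton ℝ hν,
      ← Submodule.starProjection_orthogonal_val]
    rfl
  have key : ((compression ν A : E n →L[ℝ] E n) : E n →ₗ[ℝ] E n) =
      (e : (Lᗮ × L) →ₗ[ℝ] E n) ∘ₗ (LinearMap.prodMap (W : Lᗮ →ₗ[ℝ] Lᗮ) LinearMap.id) ∘ₗ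
        (e.symm : E n →ₗ[ℝ] Lᗮ × L) := by
    have : ((compression ν A : E n →L[ℝ] E n) : E n →ₗ[ℝ] E n) ∘ₗ (e : (Lᗮ × L) →ₗ[ℝ] E n) =
        (e : (Lᗮ × L) →ₗ[ℝ] E n) ∘ₗ (LinearMap.prodMap (W : Lᗮ →ₗ[ℝ] Lᗮ) LinearMap.id) := by
      refine LinearMap.ext fun x => ?_
      obtain ⟨a, b⟩ := x
      have ha : ⟪ν, (a : E n)⟫ = 0 :=
        Submodule.mem_orthogonal_singleton_iff_inner_right.1 a.2
      obtain ⟨c, hb⟩ := Submodule.mem_span_singleton.1 b.2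
      have hcv : ⟪ν, (b : E n)⟫ = c := by
        rw [← hb, inner_smul_right, real_inner_self_eq_norm_sq, hν]; ring
      simp only [LinearMap.comp_apply, ContinuousLinearMap.coe_coe, LinearEquiv.coe_coe,
        LinearMap.prodMap_apply, LinearMap.id_apply, e, Submodule.coe_prodEquivOfIsCompl']
      rw [compression_apply, hWv, inner_add_right, ha, hcv, zero_add, hb, tanProj_apply ν (a + b),
        inner_add_right, ha, hcv, zero_add, hb, add_sub_cancel_right]
    rw [← LinearMap.comp_assoc, ← this, LinearMap.comp_assoc]
    simp
  rw [ContinuousLinearMap.det, key, LinearMap.det_conj, LinearMap.det_prodMap, LinearMap.det_id,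
    mul_one]

theorem continuous_det_compression :
    Continuous fun p : E n × (E n →L[ℝ] E n) => (compression p.1 p.2).det := by
  refine ContinuousLinearMap.continuous_det.comp ?_
  have h1 : Continuous fun p : E n × (E n →L[ℝ] E n) => (innerSL ℝ p.1).smulRight p.1 :=
    (ContinuousLinearMap.smulRightL ℝ (E n) (E n)).continuous₂.comp
      (((innerSL ℝ (E := E n)).continuous.comp continuous_fst).prodMk continuous_fst)
  have h2 : Continuous fun p : E n × (E n →L[ℝ] E n) => tanProj p.1 := continuous_const.sub h1
  exact (h2.clm_comp (continuous_snd.clm_comp h2)).add h1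

/-- The determinant of a compression composed with the rank one perturbation
`v ↦ v + (⟪ν, v⟫ / ⟪ν, q⟫) (ν - q)`. -/
theorem det_compression_comp {ν q : E n} (hν : ‖ν‖ = 1) (hq : ⟪ν, q⟫ ≠ 0) (A : E n →L[ℝ] E n) :
    (compression ν A ∘L (ContinuousLinearMap.id ℝ (E n) +
      ((⟪ν, q⟫)⁻¹ • innerSL ℝ ν).smulRight (ν - q))).det = (compression ν A).det / ⟪ν, q⟫ := by
  -- The perturbation is a transvection of determinant `1 + (1 - ⟪ν, q⟫) / ⟪ν, q⟫ = 1 / ⟪ν, q⟫`.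
  have h1 : ((ContinuousLinearMap.id ℝ (E n) +
      ((⟪ν, q⟫)⁻¹ • innerSL ℝ ν).smulRight (ν - q) : E n →L[ℝ] E n) : E n →ₗ[ℝ] E n) =
      LinearMap.transvection (((⟪ν, q⟫)⁻¹ • innerSL ℝ ν : E n →L[ℝ] ℝ) : E n →ₗ[ℝ] ℝ) (ν - q) := by
    refine LinearMap.ext fun v => ?_
    simp [LinearMap.transvection.apply]
  rw [ContinuousLinearMap.det, ContinuousLinearMap.toLinearMap_comp, LinearMap.det_comp, h1,
    LinearMap.transvection.det, ContinuousLinearMap.det]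
  simp only [ContinuousLinearMap.coe_coe, smul_apply, innerSL_apply_apply,
    smul_eq_mul, inner_sub_right, real_inner_self_eq_norm_sq, hν]
  field_simp
  ring

theorem det_compression_eq_zero {ν v : E n} {A : E n →L[ℝ] E n} (hv : v ≠ 0)
    (hvν : ⟪ν, v⟫ = 0) (hA : A v = 0) : (compression ν A).det = 0 := by
  by_contra h
  have : IsUnit (LinearMap.det ((compression ν A : E n →L[ℝ] E n) : E n →ₗ[ℝ] E n)) :=
    isUnit_iff_ne_zero.2 h
  have hinj := (LinearMap.isUnit_iff_ker_eq_bot _).1 ((LinearMap.isUnit_iff_isUnit_det _).2 this)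
  refine hv (LinearMap.ker_eq_bot.1 hinj ?_)
  rw [map_zero, ContinuousLinearMap.coe_coe, compression_apply, hvν,
    tanProj_of_inner_eq_zero hvν, hA]
  simp

/-- Along the segment from `B` to the identity the quadratic form is positive definite for `t > 0`,
so the determinant never vanishes there. It is `1` at the identity, hence positive, and nonnegative
in the limit. -/
theorem det_nonneg_of_forall_inner_nonneg {B : E n →L[ℝ] E n} (hB : ∀ v, 0 ≤ ⟪B v, v⟫) :
    0 ≤ B.det := by
  let P : ℝ → (E n →L[ℝ] E n) := fun t => B + t • (ContinuousLinearMap.id ℝ (E n) - B)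
  have hP : Continuous fun t => (P t).det :=
    ContinuousLinearMap.continuous_det.comp (by fun_prop)
  have h0 : P 0 = B := by ext1 v; simp [P]
  have h1 : (P 1).det = 1 := by
    have : P 1 = ContinuousLinearMap.id ℝ (E n) := by simp [P]
    rw [this]; simp [ContinuousLinearMap.det]
  have hne : ∀ t ∈ Ioc (0 : ℝ) 1, (P t).det ≠ 0 := by
    intro t ht hdet
    have hker : LinearMap.ker ((P t : E n →L[ℝ] E n) : E n →ₗ[ℝ] E n) ≠ ⊥ := by
      intro hk
      have := (LinearMap.isUnit_iff_isUnit_det _).1 ((LinearMap.isUnit_iff_ker_eq_bot _).2 hk)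
      exact this.ne_zero hdet
    obtain ⟨v, hv, hv0⟩ := (Submodule.ne_bot_iff _).1 hker
    have h2 : P t v = 0 := hv
    have h3 : ⟪P t v, v⟫ = (1 - t) * ⟪B v, v⟫ + t * ‖v‖ ^ 2 := by
      simp only [P, add_apply, smul_apply,
        sub_apply, ContinuousLinearMap.id_apply, inner_add_left,
        inner_smul_left, inner_sub_left, real_inner_self_eq_norm_sq, conj_trivial]
      ring
    rw [h2, inner_zero_left] at h3
    have h4 : 0 < t * ‖v‖ ^ 2 := mul_pos ht.1 (pow_pos (norm_pos_iff.2 hv0) 2)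
    have h5 := mul_nonneg (sub_nonneg.2 ht.2) (hB v)
    linarith
  have hpos : ∀ t ∈ Ioc (0 : ℝ) 1, 0 ≤ (P t).det := by
    intro t ht
    by_contra hlt
    push Not at hlt
    obtain ⟨s, hs, hs0⟩ := intermediate_value_Icc ht.2 hP.continuousOn
      (show (0 : ℝ) ∈ Icc (P t).det (P 1).det from ⟨hlt.le, by rw [h1]; norm_num⟩)
    exact hne s ⟨ht.1.trans_le hs.1, hs.2⟩ hs0
  have hlim : Filter.Tendsto (fun t => (P t).det) (nhdsWithin 0 (Ioi 0)) (nhds B.det) := by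
    have := (hP.tendsto 0).mono_left (nhdsWithin_le_nhds (s := Ioi (0 : ℝ)))
    rwa [h0] at this
  refine ge_of_tendsto hlim ?_
  filter_upwards [Ioc_mem_nhdsGT (zero_lt_one (α := ℝ))] with t ht using hpos t ht

theorem det_compression_nonneg {ν : E n} (hν : ‖ν‖ = 1) {A : E n →L[ℝ] E n}
    (hA : ∀ v, ⟪ν, v⟫ = 0 → 0 ≤ ⟪A v, v⟫) : 0 ≤ (compression ν A).det := by
  refine det_nonneg_of_forall_inner_nonneg fun v => ?_
  set w := tanProj ν v with hw
  have hwν : ⟪ν, w⟫ = 0 := inner_tanProj hν v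
  have hv : v = w + ⟪ν, v⟫ • ν := by rw [hw, tanProj_apply]; abel
  have h1 : ⟪tanProj ν (A w), v⟫ = ⟪A w, w⟫ := by
    conv_lhs => rw [hv]
    rw [inner_add_right, inner_smul_right, real_inner_comm ν, inner_tanProj hν, tanProj_apply,
      inner_sub_left, inner_smul_left, hwν]
    simp
  rw [compression_apply, ← hw, inner_add_left, h1, inner_smul_left]
  have := hA w hwν
  have h2 : 0 ≤ ⟪ν, v⟫ * ⟪ν, v⟫ := mul_self_nonneg _
  simpa using add_nonneg this h2

end linearAlgebra

/-! ### The radial projection and the derivative of the Gauss map -/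

section radial

variable {n : ℕ} {T : Set (E n)}

theorem inner_gaussMap_pos (hc : IsCompact T) (hconv : Convex ℝ T) (h0 : (0 : E n) ∈ interior T)
    {q : E n} (hq : q ∈ frontier T) : 0 < ⟪gaussMap T q, q⟫ := by
  have hn := isOuterUnitNormal_gaussMap hconv ⟨0, h0⟩ hq.2
  have h1 := supportFun_eq_inner_of_normal hc (hc.isClosed.frontier_subset hq) hn 0
  rw [sub_zero] at h1
  rw [← h1]
  exact supportFun_pos hc h0 (norm_ne_zero_iff.1 (by rw [hn.1]; norm_num))

theorem norm_gaussMap (hconv : Convex ℝ T) (h0 : (0 : E n) ∈ interior T)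
    {q : E n} (hq : q ∈ frontier T) : ‖gaussMap T q‖ = 1 :=
  (isOuterUnitNormal_gaussMap hconv ⟨0, h0⟩ hq.2).1

theorem gauge_pos_of_ne_zero (hc : IsCompact T) (h0 : (0 : E n) ∈ interior T) {y : E n}
    (hy : y ≠ 0) : 0 < gauge T y :=
  (gauge_pos (absorbent_nhds_zero (mem_interior_iff_mem_nhds.1 h0))
    ((NormedSpace.isVonNBounded_iff ℝ).2 hc.isBounded)).2 hy

/-- The radial projection onto the boundary. -/
def radialProj (T : Set (E n)) (y : E n) : E n := (gauge T y)⁻¹ • y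

theorem radialProj_mem_frontier (hc : IsCompact T) (hconv : Convex ℝ T)
    (h0 : (0 : E n) ∈ interior T) {y : E n} (hy : y ≠ 0) : radialProj T y ∈ frontier T := by
  have hg := gauge_pos_of_ne_zero hc h0 hy
  rw [← gauge_eq_one_iff_mem_frontier hconv (mem_interior_iff_mem_nhds.1 h0), radialProj,
    gauge_smul_of_nonneg (inv_nonneg.2 hg.le), smul_eq_mul, inv_mul_cancel₀ hg.ne']

theorem gauge_eq_one_of_mem_frontier (hconv : Convex ℝ T)
    (h0 : (0 : E n) ∈ interior T) {y : E n} (hy : y ∈ frontier T) : gauge T y = 1 :=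
  (gauge_eq_one_iff_mem_frontier hconv (mem_interior_iff_mem_nhds.1 h0)).2 hy

theorem radialProj_of_mem_frontier (hconv : Convex ℝ T)
    (h0 : (0 : E n) ∈ interior T) {y : E n} (hy : y ∈ frontier T) : radialProj T y = y := by
  rw [radialProj, gauge_eq_one_of_mem_frontier hconv h0 hy, inv_one, one_smul]

theorem ne_zero_of_mem_frontier (h0 : (0 : E n) ∈ interior T) {y : E n} (hy : y ∈ frontier T) :
    y ≠ 0 := by
  rintro rfl
  exact hy.2 h0

theorem gauge_smul_radialProj (hc : IsCompact T) (h0 : (0 : E n) ∈ interior T) {y : E n}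
    (hy : y ≠ 0) : gauge T y • radialProj T y = y := by
  rw [radialProj, smul_smul, mul_inv_cancel₀ (gauge_pos_of_ne_zero hc h0 hy).ne', one_smul]

/-- The gauge of a smooth convex body is differentiable. -/
theorem HasSmoothBoundary.hasFDerivAt_gauge (hT : HasSmoothBoundary T) (hc : IsCompact T)
    (hconv : Convex ℝ T) (h0 : (0 : E n) ∈ interior T) {y : E n} (hy : y ≠ 0) :
    HasFDerivAt (gauge T) ((⟪gaussMap T (radialProj T y), radialProj T y⟫)⁻¹ •
      innerSL ℝ (gaussMap T (radialProj T y))) y := by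
  have hqfr := radialProj_mem_frontier hc hconv h0 hy
  have hgy := gauge_pos_of_ne_zero hc h0 hy
  have hgq := gauge_smul_radialProj hc h0 hy
  have hu := inner_gaussMap_pos hc hconv h0 hqfr
  have hn := isOuterUnitNormal_gaussMap hconv ⟨0, h0⟩ hqfr.2
  set q := radialProj T y with hq
  set ν := gaussMap T q with hν
  set u := ⟪ν, q⟫ with hudef
  set g := gauge T y with hg
  have hyu : ⟪ν, y⟫ = g * u := by rw [← hgq, inner_smul_right]
  have hnhds : T ∈ nhds (0 : E n) := mem_interior_iff_mem_nhds.1 h0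
  rw [hasFDerivAt_iff_isLittleO_nhds_zero, Asymptotics.isLittleO_iff]
  intro ε hε
  -- Polarity against the fixed normal `ν` bounds the gauge below by its linearisation, with no
  -- error term.
  have hlow (v : E n) : g + ⟪ν, v⟫ / u ≤ gauge T (y + v) := by
    have h1 := inner_le_gauge_mul_supportFun hc hconv h0 (y + v) ν
    rw [supportFun_eq_inner_of_normal hc (hc.isClosed.frontier_subset hqfr) hn 0, sub_zero,
      ← hudef, real_inner_comm, inner_add_right, hyu] at h1
    simp only [add_zero, preimage_id'] at h1
    rw [← sub_nonneg] at h1 ⊢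
    have h2 : gauge T (y + v) - (g + ⟪ν, v⟫ / u) = (gauge T (y + v) * u - (g * u + ⟪ν, v⟫)) / u := by
      field_simp
    rw [h2]
    exact div_nonneg h1 hu.le
  set C := 1 + (u⁻¹ + ε) * ‖q‖ with hC
  have hCpos : 0 < C := by positivity
  obtain ⟨δ, hδ, H⟩ := hT.mem_of_inner_gaussMap_le hc hconv hqfr (ε := ε * u / C) (by positivity)
  have hs0 : Filter.Tendsto (fun v : E n => g + ⟪ν, v⟫ / u + ε * ‖v‖) (nhds 0) (nhds g) := by
    have : Continuous fun v : E n => g + ⟪ν, v⟫ / u + ε * ‖v‖ := by fun_prop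
    simpa using this.tendsto 0
  have hsmall : ∀ᶠ v : E n in nhds 0, ‖v‖ < δ * (g / 2) / C :=
    (continuous_norm.tendsto' (0 : E n) 0 norm_zero).eventually (gt_mem_nhds (by positivity))
  filter_upwards [hs0.eventually (lt_mem_nhds (half_lt_self hgy)), hsmall] with v hv1 hv2
  set s := g + ⟪ν, v⟫ / u + ε * ‖v‖ with hs
  have hspos : 0 < s := (half_pos hgy).trans hv1
  -- The upper bound is the inner cone condition at `q`: after division by `s`, the point is `q`
  -- plus a displacement whose component along `ν` is `-ε u ‖v‖ / s`, and `C` bounds its length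
  -- relative to `‖v‖ / s`.
  have hup : gauge T (y + v) ≤ s := by
    refine gauge_le_of_mem hspos.le ?_
    rw [mem_smul_set_iff_inv_smul_mem₀ hspos.ne']
    have hnum : ‖v - (⟪ν, v⟫ / u + ε * ‖v‖) • q‖ ≤ C * ‖v‖ := by
      refine (norm_sub_le _ _).trans ?_
      rw [norm_smul, hC]
      have h1 : ‖⟪ν, v⟫ / u + ε * ‖v‖‖ ≤ (u⁻¹ + ε) * ‖v‖ := by
        refine (norm_add_le _ _).trans ?_
        rw [norm_div, Real.norm_of_nonneg hu.le, Real.norm_of_nonneg (by positivity : 0 ≤ ε * ‖v‖)]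
        have := norm_inner_le_norm (𝕜 := ℝ) ν v
        rw [hn.1, one_mul] at this
        rw [add_mul, inv_mul_eq_div]
        gcongr
      have := mul_le_mul_of_nonneg_right h1 (norm_nonneg q)
      nlinarith
    have he : s⁻¹ • (y + v) = q + s⁻¹ • (v - (⟪ν, v⟫ / u + ε * ‖v‖) • q) := by
      have : y + v = s • q + (v - (⟪ν, v⟫ / u + ε * ‖v‖) • q) := by
        rw [← hgq, hs]; module
      rw [this, smul_add, smul_smul, inv_mul_cancel₀ hspos.ne', one_smul]
    rw [he]
    refine H _ ?_ ?_
    · rw [norm_smul, norm_inv, Real.norm_of_nonneg hspos.le, inv_mul_lt_iff₀ hspos]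
      have h3 : C * ‖v‖ < C * (δ * (g / 2) / C) := mul_lt_mul_of_pos_left hv2 hCpos
      have h4 : C * (δ * (g / 2) / C) = δ * (g / 2) := by field_simp
      have h5 : δ * (g / 2) ≤ s * δ := by nlinarith
      linarith
    · rw [inner_smul_right, norm_smul, norm_inv, Real.norm_of_nonneg hspos.le, inner_sub_right,
        inner_smul_right, ← hudef]
      have h3 : ⟪ν, v⟫ - (⟪ν, v⟫ / u + ε * ‖v‖) * u = -(ε * u * ‖v‖) := by field_simp; ring
      rw [h3]
      have h4 : ε * u / C * ‖v - (⟪ν, v⟫ / u + ε * ‖v‖) • q‖ ≤ ε * u * ‖v‖ := by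
        have := mul_le_mul_of_nonneg_left hnum (by positivity : 0 ≤ ε * u / C)
        have e : ε * u / C * (C * ‖v‖) = ε * u * ‖v‖ := by field_simp
        rwa [e] at this
      have := mul_le_mul_of_nonneg_left h4 (inv_nonneg.2 hspos.le)
      nlinarith
  have hl := hlow v
  simp only [smul_apply, innerSL_apply_apply, smul_eq_mul]
  rw [inv_mul_eq_div, Real.norm_of_nonneg (by linarith)]
  linarith

theorem HasSmoothBoundary.hasFDerivAt_radialProj (hT : HasSmoothBoundary T) (hc : IsCompact T)
    (hconv : Convex ℝ T) (h0 : (0 : E n) ∈ interior T) {y : E n} (hy : y ≠ 0) :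
    HasFDerivAt (radialProj T) ((gauge T y)⁻¹ • (ContinuousLinearMap.id ℝ (E n) -
      ((⟪gaussMap T (radialProj T y), radialProj T y⟫)⁻¹ •
        innerSL ℝ (gaussMap T (radialProj T y))).smulRight (radialProj T y))) y := by
  have hgy := gauge_pos_of_ne_zero hc h0 hy
  have h1 := ((hasDerivAt_inv hgy.ne').comp_hasFDerivAt y
    (hT.hasFDerivAt_gauge hc hconv h0 hy)).smul (hasFDerivAt_id y)
  refine h1.congr_fderiv ?_
  ext1 v
  simp only [add_apply, smul_apply,
    sub_apply, ContinuousLinearMap.id_apply,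
    ContinuousLinearMap.smulRight_apply, innerSL_apply_apply, smul_eq_mul, id_eq,
    Function.comp_apply]
  set q := radialProj T y with hq
  have hyq : y = gauge T y • q := (gauge_smul_radialProj hc h0 hy).symm
  set g := gauge T y
  rw [hyq]
  match_scalars
  · ring
  · field_simp

theorem HasSmoothBoundary.hasFDerivWithinAt_gaussMap (hT : HasSmoothBoundary T) (hc : IsCompact T)
    (hconv : Convex ℝ T) {q : E n} (hq : q ∈ frontier T) :
    HasFDerivWithinAt (gaussMap T) (fderivWithin ℝ (gaussMap T) (frontier T) q)
      (frontier T) q := by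
  obtain ⟨U, N, hU, hqU, hN, h⟩ := hT.exists_local_gaussMap hc hconv hq
  have h1 : HasFDerivWithinAt N (fderiv ℝ N q) (frontier T) q :=
    ((hN.contDiffAt (hU.mem_nhds hqU)).differentiableAt (by simp)).hasFDerivAt.hasFDerivWithinAt
  have h2 : HasFDerivWithinAt (gaussMap T) (fderiv ℝ N q) (frontier T) q := by
    refine h1.congr_of_eventuallyEq ?_ (h q hqU hq).1
    filter_upwards [self_mem_nhdsWithin, mem_nhdsWithin_of_mem_nhds (hU.mem_nhds hqU)] with p hp hpU
    exact (h p hpU hp).1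
  exact h2.differentiableWithinAt.hasFDerivWithinAt

theorem HasSmoothBoundary.hasFDerivAt_gaussMap_radialProj (hT : HasSmoothBoundary T)
    (hc : IsCompact T) (hconv : Convex ℝ T) (h0 : (0 : E n) ∈ interior T) {y : E n} (hy : y ≠ 0)
    {F : E n → E n} {A : E n →L[ℝ] E n}
    (hA : HasFDerivWithinAt F A (frontier T) (radialProj T y)) :
    HasFDerivAt (fun x => F (radialProj T x))
      (A ∘L ((gauge T y)⁻¹ • (ContinuousLinearMap.id ℝ (E n) -
      ((⟪gaussMap T (radialProj T y), radialProj T y⟫)⁻¹ •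
        innerSL ℝ (gaussMap T (radialProj T y))).smulRight (radialProj T y)))) y := by
  have h1 := (hT.hasFDerivAt_radialProj hc hconv h0 hy)
  rw [← hasFDerivWithinAt_univ] at h1
  have hopen : IsOpen ({0}ᶜ : Set (E n)) := isOpen_compl_singleton
  have h2 := hA.comp y (h1.mono (subset_univ ({0}ᶜ : Set (E n))))
    (fun x hx => radialProj_mem_frontier hc hconv h0 hx)
  exact h2.hasFDerivAt (hopen.mem_nhds hy)

/-- At a boundary point, the derivative along tangent vectors of a function of the boundary. -/
theorem HasSmoothBoundary.hasFDerivAt_comp_radialProj_apply (hT : HasSmoothBoundary T)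
    (hc : IsCompact T) (hconv : Convex ℝ T) (h0 : (0 : E n) ∈ interior T) {q : E n}
    (hq : q ∈ frontier T) {F : E n → E n} {A : E n →L[ℝ] E n}
    (hA : HasFDerivWithinAt F A (frontier T) q) :
    ∃ B : E n →L[ℝ] E n, HasFDerivAt (fun x => F (radialProj T x)) B q ∧
      ∀ v, ⟪gaussMap T q, v⟫ = 0 → B v = A v := by
  have hq0 := ne_zero_of_mem_frontier h0 hq
  have hqq := radialProj_of_mem_frontier hconv h0 hq
  refine ⟨_, hT.hasFDerivAt_gaussMap_radialProj hc hconv h0 hq0 (by rwa [hqq]), fun v hv => ?_⟩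
  simp [hqq, hv, gauge_eq_one_of_mem_frontier hconv h0 hq]

/-- A derivative within the boundary is not determined in the normal direction. Composing with the
radial projection gives a genuine derivative, which is unique and agrees with it on tangent vectors.
-/
theorem HasSmoothBoundary.fderivWithin_gaussMap_apply (hT : HasSmoothBoundary T)
    (hc : IsCompact T) (hconv : Convex ℝ T) (h0 : (0 : E n) ∈ interior T) {q : E n}
    (hq : q ∈ frontier T) {A : E n →L[ℝ] E n}
    (hA : HasFDerivWithinAt (gaussMap T) A (frontier T) q) {v : E n}
    (hv : ⟪gaussMap T q, v⟫ = 0) : fderivWithin ℝ (gaussMap T) (frontier T) q v = A v := by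
  obtain ⟨B, hB, hBv⟩ := hT.hasFDerivAt_comp_radialProj_apply hc hconv h0 hq hA
  obtain ⟨B', hB', hBv'⟩ := hT.hasFDerivAt_comp_radialProj_apply hc hconv h0 hq
    (hT.hasFDerivWithinAt_gaussMap hc hconv hq)
  rw [← hBv v hv, ← hBv' v hv, hB.unique hB']

/-- The derivative of the Gauss map takes tangent values. -/
theorem HasSmoothBoundary.inner_fderivWithin_gaussMap (hT : HasSmoothBoundary T)
    (hc : IsCompact T) (hconv : Convex ℝ T) (h0 : (0 : E n) ∈ interior T) {q : E n}
    (hq : q ∈ frontier T) {v : E n} (hv : ⟪gaussMap T q, v⟫ = 0) :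
    ⟪gaussMap T q, fderivWithin ℝ (gaussMap T) (frontier T) q v⟫ = 0 := by
  obtain ⟨B, hB, hBv⟩ := hT.hasFDerivAt_comp_radialProj_apply hc hconv h0 hq
    (hT.hasFDerivWithinAt_gaussMap hc hconv hq)
  have hq0 := ne_zero_of_mem_frontier h0 hq
  have h1 := hB.norm_sq
  have h2 : HasFDerivAt (fun x => ‖gaussMap T (radialProj T x)‖ ^ 2) (0 : E n →L[ℝ] ℝ) q := by
    refine (hasFDerivAt_const (1 : ℝ) q).congr_of_eventuallyEq ?_
    filter_upwards [isOpen_compl_singleton.mem_nhds hq0] with x hx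
    rw [norm_gaussMap hconv h0 (radialProj_mem_frontier hc hconv h0 hx)]
    norm_num
  have h3 := congrArg (fun L : E n →L[ℝ] ℝ => L v) (h1.unique h2)
  rw [radialProj_of_mem_frontier hconv h0 hq] at h3
  rw [← hBv v hv]
  simpa using h3

theorem compression_congr {ν : E n} (hν : ‖ν‖ = 1) {A A' : E n →L[ℝ] E n}
    (h : ∀ v, ⟪ν, v⟫ = 0 → A v = A' v) : compression ν A = compression ν A' := by
  ext1 v
  rw [compression_apply, compression_apply, h _ (inner_tanProj hν v)]

/-- The extension `v ↦ g(v) ν(v / g(v))` of the Gauss map that is homogeneous of degree one. -/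
def radialGaussMap (T : Set (E n)) (y : E n) : E n := gauge T y • gaussMap T (radialProj T y)

theorem gaussCurvature_eq_det (hconv : Convex ℝ T) (h0 : (0 : E n) ∈ interior T) {q : E n}
    (hq : q ∈ frontier T) : gaussCurvature T q =
      (compression (gaussMap T q) (fderivWithin ℝ (gaussMap T) (frontier T) q)).det :=
  det_compression (norm_gaussMap hconv h0 hq) _

/-- The derivative sends `v` to `A (v - τ q) + τ ν` with `τ = ⟪ν, v⟫ / ⟪ν, q⟫`: project along `q` to
the tangent space, apply `dν`, and send `q` to `ν`. This is the compression of `A` after a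
transvection, so the Jacobian is `K / ⟪ν, q⟫`. -/
theorem HasSmoothBoundary.exists_hasFDerivAt_radialGaussMap (hT : HasSmoothBoundary T)
    (hc : IsCompact T) (hconv : Convex ℝ T) (h0 : (0 : E n) ∈ interior T) {y : E n} (hy : y ≠ 0) :
    ∃ D : E n →L[ℝ] E n, HasFDerivAt (radialGaussMap T) D y ∧
      D.det = gaussCurvature T (radialProj T y) /
        ⟪gaussMap T (radialProj T y), radialProj T y⟫ := by
  have hqfr := radialProj_mem_frontier hc hconv h0 hy
  have hgy := gauge_pos_of_ne_zero hc h0 hy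
  have hu := inner_gaussMap_pos hc hconv h0 hqfr
  have hν1 := norm_gaussMap hconv h0 hqfr
  have hD := (hT.hasFDerivAt_gauge hc hconv h0 hy).smul
    (hT.hasFDerivAt_gaussMap_radialProj hc hconv h0 hy
      (hT.hasFDerivWithinAt_gaussMap hc hconv hqfr))
  have htan : ∀ v, ⟪gaussMap T (radialProj T y), v⟫ = 0 → _ := fun v hv =>
    hT.inner_fderivWithin_gaussMap hc hconv h0 hqfr hv
  rw [gaussCurvature_eq_det hconv h0 hqfr]
  set q := radialProj T y with hq
  set ν := gaussMap T q with hν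
  set A := fderivWithin ℝ (gaussMap T) (frontier T) q with hA
  refine ⟨_, hD.congr_fderiv ?_, det_compression_comp hν1 hu.ne' A⟩
  ext1 v
  have e1 : tanProj ν (v + ((⟪ν, q⟫)⁻¹ * ⟪ν, v⟫) • (ν - q)) = v - ((⟪ν, q⟫)⁻¹ * ⟪ν, v⟫) • q := by
    rw [tanProj_apply, inner_add_right, inner_smul_right, inner_sub_right,
      real_inner_self_eq_norm_sq, hν1]
    have : ⟪ν, v⟫ + (⟪ν, q⟫)⁻¹ * ⟪ν, v⟫ * (1 ^ 2 - ⟪ν, q⟫) = (⟪ν, q⟫)⁻¹ * ⟪ν, v⟫ := by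
      field_simp; ring
    rw [this]
    module
  have e2 : ⟪ν, v + ((⟪ν, q⟫)⁻¹ * ⟪ν, v⟫) • (ν - q)⟫ = (⟪ν, q⟫)⁻¹ * ⟪ν, v⟫ := by
    rw [inner_add_right, inner_smul_right, inner_sub_right, real_inner_self_eq_norm_sq, hν1]
    field_simp
    ring
  have e3 : ⟪ν, v - ((⟪ν, q⟫)⁻¹ * ⟪ν, v⟫) • q⟫ = 0 := by
    rw [inner_sub_right, inner_smul_right]
    field_simp
    ring
  have e4 : (compression ν A ∘L (ContinuousLinearMap.id ℝ (E n) +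
      ((⟪ν, q⟫)⁻¹ • innerSL ℝ ν).smulRight (ν - q))) v =
      A (v - ((⟪ν, q⟫)⁻¹ * ⟪ν, v⟫) • q) + ((⟪ν, q⟫)⁻¹ * ⟪ν, v⟫) • ν := by
    have : (ContinuousLinearMap.id ℝ (E n) +
      ((⟪ν, q⟫)⁻¹ • innerSL ℝ ν).smulRight (ν - q)) v = v + ((⟪ν, q⟫)⁻¹ * ⟪ν, v⟫) • (ν - q) := by
      simp
    rw [ContinuousLinearMap.comp_apply, this, compression_apply, e1, e2,
      tanProj_of_inner_eq_zero (htan _ e3)]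
  rw [e4]
  simp only [add_apply, smul_apply,
    ContinuousLinearMap.comp_apply, sub_apply, ContinuousLinearMap.id_apply,
    ContinuousLinearMap.smulRight_apply, innerSL_apply_apply, smul_eq_mul, map_smul, smul_smul]
  rw [mul_inv_cancel₀ hgy.ne', one_smul]

/-- Locally the Gauss map is the restriction of a `C¹` field `N` on an open set, so the curvature
can be computed from the ordinary derivative of `N`. -/
theorem HasSmoothBoundary.continuousOn_gaussCurvature (hT : HasSmoothBoundary T)
    (hc : IsCompact T) (hconv : Convex ℝ T) (h0 : (0 : E n) ∈ interior T) :
    ContinuousOn (gaussCurvature T) (frontier T) := by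
  intro p hp
  obtain ⟨U, N, hU, hpU, hN, h⟩ := hT.exists_local_gaussMap hc hconv hp
  have hfd : ContinuousOn (fderiv ℝ N) U := hN.continuousOn_fderiv_of_isOpen hU (by simp)
  have h1 : ContinuousWithinAt (fun q => (compression (N q) (fderiv ℝ N q)).det) (frontier T) p :=
    (continuous_det_compression.continuousAt.comp
      ((hN.continuousOn.continuousAt (hU.mem_nhds hpU)).prodMk
        (hfd.continuousAt (hU.mem_nhds hpU)))).continuousWithinAt
  have h2 : ∀ q ∈ frontier T, q ∈ U →
      gaussCurvature T q = (compression (N q) (fderiv ℝ N q)).det := by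
    intro q hq hqU
    have h3 : HasFDerivWithinAt (gaussMap T) (fderiv ℝ N q) (frontier T) q := by
      refine HasFDerivWithinAt.congr_of_eventuallyEq (f := N) ?_ ?_ (h q hqU hq).1
      · exact ((hN.contDiffAt (hU.mem_nhds hqU)).differentiableAt
          (by simp)).hasFDerivAt.hasFDerivWithinAt
      · filter_upwards [self_mem_nhdsWithin, mem_nhdsWithin_of_mem_nhds (hU.mem_nhds hqU)]
          with x hx hxU using (h x hxU hx).1
    rw [gaussCurvature_eq_det hconv h0 hq, compression_congr (norm_gaussMap hconv h0 hq)
      (fun v hv => hT.fderivWithin_gaussMap_apply hc hconv h0 hq h3 hv), (h q hqU hq).1]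
  refine h1.congr_of_eventuallyEq ?_ (h2 p hp hpU)
  filter_upwards [self_mem_nhdsWithin, mem_nhdsWithin_of_mem_nhds (hU.mem_nhds hpU)] with q hq hqU
  exact h2 q hq hqU

/-- By convexity the Gauss map is monotone, `⟪ν(p) - ν(q), p - q⟫ ≥ 0`; along radially projected
tangent lines this passes to difference quotients and makes `dν` positive semidefinite. -/
theorem HasSmoothBoundary.gaussCurvature_nonneg (hT : HasSmoothBoundary T)
    (hc : IsCompact T) (hconv : Convex ℝ T) (h0 : (0 : E n) ∈ interior T) {q : E n}
    (hq : q ∈ frontier T) : 0 ≤ gaussCurvature T q := by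
  rw [gaussCurvature_eq_det hconv h0 hq]
  refine det_compression_nonneg (norm_gaussMap hconv h0 hq) fun v hv => ?_
  obtain ⟨B, hB, hBv⟩ := hT.hasFDerivAt_comp_radialProj_apply hc hconv h0 hq
    (hT.hasFDerivWithinAt_gaussMap hc hconv hq)
  obtain ⟨B', hB', hBv'⟩ := hT.hasFDerivAt_comp_radialProj_apply hc hconv h0 hq
    (F := id) (hasFDerivWithinAt_id q (frontier T))
  have hqq := radialProj_of_mem_frontier hconv h0 hq
  have hline : HasDerivAt (fun t : ℝ => q + t • v) v 0 := by
    simpa using ((hasDerivAt_id (0 : ℝ)).smul_const v).const_add q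
  have e0 : q + (0 : ℝ) • v = q := by simp
  have d1 : HasDerivAt (fun t : ℝ => gaussMap T (radialProj T (q + t • v))) (B v) 0 :=
    HasFDerivAt.comp_hasDerivAt (0 : ℝ) (l := fun x => gaussMap T (radialProj T x))
      (f := fun t : ℝ => q + t • v) (by rwa [e0]) hline
  have d2 : HasDerivAt (fun t : ℝ => radialProj T (q + t • v)) (B' v) 0 :=
    HasFDerivAt.comp_hasDerivAt (0 : ℝ) (l := fun x => radialProj T x)
      (f := fun t : ℝ => q + t • v) (by rw [e0]; exact hB') hline
  rw [hBv v hv] at d1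
  rw [hBv' v hv, ContinuousLinearMap.id_apply] at d2
  have hlim := (hasDerivAt_iff_tendsto_slope.1 d1).inner (𝕜 := ℝ)
    (hasDerivAt_iff_tendsto_slope.1 d2)
  refine ge_of_tendsto hlim ?_
  have hne : ∀ᶠ t : ℝ in nhds 0, q + t • v ∈ ({0}ᶜ : Set (E n)) := by
    refine hline.continuousAt.eventually (isOpen_compl_singleton.mem_nhds ?_)
    simpa using ne_zero_of_mem_frontier h0 hq
  filter_upwards [nhdsWithin_le_nhds hne] with t ht
  have hp := radialProj_mem_frontier hc hconv h0 ht
  set p := radialProj T (q + t • v)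
  have hcl := hc.isClosed.frontier_subset
  have i1 := (isOuterUnitNormal_gaussMap hconv ⟨0, h0⟩ hp.2).2 q (hcl hq)
  have i2 := (isOuterUnitNormal_gaussMap hconv ⟨0, h0⟩ hq.2).2 p (hcl hp)
  rw [slope_def_module, slope_def_module, e0, hqq, inner_smul_left, inner_smul_right, ← mul_assoc]
  refine mul_nonneg (mul_self_nonneg _) ?_
  rw [inner_sub_left]
  rw [← neg_sub, inner_neg_right] at i1
  linarith

/-- The Gauss curvature vanishes where the Gauss map is not injective. -/
theorem HasSmoothBoundary.gaussCurvature_eq_zero (hT : HasSmoothBoundary T)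
    (hc : IsCompact T) (hconv : Convex ℝ T) (h0 : (0 : E n) ∈ interior T) {p q : E n}
    (hp : p ∈ frontier T) (hq : q ∈ frontier T) (hne : p ≠ q) (h : gaussMap T p = gaussMap T q) :
    gaussCurvature T q = 0 := by
  have hcl := hc.isClosed.frontier_subset
  have np := isOuterUnitNormal_gaussMap hconv ⟨0, h0⟩ hp.2
  have nq := isOuterUnitNormal_gaussMap hconv ⟨0, h0⟩ hq.2
  have hv : ⟪gaussMap T q, p - q⟫ = 0 := by
    refine le_antisymm (nq.2 p (hcl hp)) ?_
    have := np.2 q (hcl hq)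
    rw [h, ← neg_sub, inner_neg_right] at this
    linarith
  rw [gaussCurvature_eq_det hconv h0 hq]
  refine det_compression_eq_zero (sub_ne_zero.2 hne) hv ?_
  obtain ⟨B, hB, hBv⟩ := hT.hasFDerivAt_comp_radialProj_apply hc hconv h0 hq
    (hT.hasFDerivWithinAt_gaussMap hc hconv hq)
  have hqq := radialProj_of_mem_frontier hconv h0 hq
  have hline : HasDerivAt (fun t : ℝ => q + t • (p - q)) (p - q) 0 := by
    simpa using ((hasDerivAt_id (0 : ℝ)).smul_const (p - q)).const_add q
  have e0 : q + (0 : ℝ) • (p - q) = q := by simp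
  have d1 : HasDerivAt (fun t : ℝ => gaussMap T (radialProj T (q + t • (p - q)))) (B (p - q)) 0 :=
    HasFDerivAt.comp_hasDerivAt (0 : ℝ) (l := fun x => gaussMap T (radialProj T x))
      (f := fun t : ℝ => q + t • (p - q)) (by rwa [e0]) hline
  rw [hBv _ hv] at d1
  have hlim := (hasDerivAt_iff_tendsto_slope.1 d1).mono_left
    (nhdsWithin_mono (0 : ℝ) (show Ioi (0 : ℝ) ⊆ {0}ᶜ from fun t ht => ne_of_gt ht))
  refine tendsto_nhds_unique hlim (tendsto_const_nhds.congr' ?_)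
  filter_upwards [Ioc_mem_nhdsGT (zero_lt_one (α := ℝ))] with t ht
  -- The segment from `q` to `p` lies in a supporting hyperplane, hence in the boundary with
  -- constant normal, so `dν` kills `p - q`.
  have hmem : q + t • (p - q) ∈ T := by
    have := hconv.add_smul_sub_mem (hcl hq) (hcl hp) ⟨ht.1.le, ht.2⟩
    exact this
  have h1 := mem_frontier_of_inner_eq nq hmem (by
    rw [add_sub_cancel_left, inner_smul_right, hv, mul_zero])
  rw [slope_def_module, e0, hqq, radialProj_of_mem_frontier hconv h0 h1.1,
    ← hT.eq_gaussMap hc hconv h1.1 h1.2, sub_self, smul_zero]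

end radial

/-! ### Translations, and the curvature of the unit ball -/

section translate

variable {n : ℕ} {Ω : Set (E n)}

theorem frontier_preimage_add (c : E n) :
    frontier ((fun v => v + c) ⁻¹' Ω) = (fun v => v + c) ⁻¹' frontier Ω :=
  ((Homeomorph.addRight c).preimage_frontier Ω).symm

theorem interior_preimage_add (c : E n) :
    interior ((fun v => v + c) ⁻¹' Ω) = (fun v => v + c) ⁻¹' interior Ω :=
  ((Homeomorph.addRight c).preimage_interior Ω).symm

theorem HasSmoothBoundary.preimage_add (hΩ : HasSmoothBoundary Ω) (c : E n) :
    HasSmoothBoundary ((fun v => v + c) ⁻¹' Ω) := by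
  intro p hp
  rw [frontier_preimage_add] at hp
  obtain ⟨U, f, hU, hpU, hf, hf', h⟩ := hΩ _ hp
  refine ⟨(fun v => v + c) ⁻¹' U, fun v => f (v + c), hU.preimage (by fun_prop), hpU,
    hf.comp (by fun_prop) (mapsTo_preimage _ _), ?_, ?_⟩
  · rwa [fderiv_comp_add_right]
  · rw [← preimage_inter, h]
    rfl

theorem isOuterUnitNormal_preimage_add (c p : E n) :
    IsOuterUnitNormal ((fun v => v + c) ⁻¹' Ω) p = IsOuterUnitNormal Ω (p + c) := by
  ext v
  refine and_congr_right fun _ => ⟨fun h z hz => ?_, fun h z hz => ?_⟩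
  · have := h (z - c) (by simpa using hz)
    rwa [show z - c - p = z - (p + c) by abel] at this
  · have := h (z + c) hz
    rwa [add_sub_add_right_eq_sub] at this

theorem gaussMap_preimage_add (c p : E n) :
    gaussMap ((fun v => v + c) ⁻¹' Ω) p = gaussMap Ω (p + c) := by
  rw [gaussMap, gaussMap, isOuterUnitNormal_preimage_add]

theorem gaussCurvature_preimage_add (c p : E n) :
    gaussCurvature ((fun v => v + c) ⁻¹' Ω) p = gaussCurvature Ω (p + c) := by
  have h1 := gaussMap_preimage_add (Ω := Ω) c p
  have h2 : fderivWithin ℝ (gaussMap ((fun v => v + c) ⁻¹' Ω))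
      (frontier ((fun v => v + c) ⁻¹' Ω)) p = fderivWithin ℝ (gaussMap Ω) (frontier Ω) (p + c) := by
    rw [show gaussMap ((fun v => v + c) ⁻¹' Ω) = fun p => gaussMap Ω (p + c) from
      funext fun p => gaussMap_preimage_add c p, fderivWithin_comp_add_right, frontier_preimage_add]
    congr 1
    ext x
    simp [mem_vadd_set_iff_neg_vadd_mem, add_comm]
  -- The two determinants live on tangent spaces that are only propositionally equal; generalising
  -- over `ν` and `A` lets the equalities be substituted.
  have key : ∀ (ν ν' : E n) (A A' : E n →L[ℝ] E n), ν = ν' → A = A' →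
      LinearMap.det ((((Submodule.span ℝ {ν})ᗮ.orthogonalProjectionOnto ∘L A ∘L
        (Submodule.span ℝ {ν})ᗮ.subtypeL : (Submodule.span ℝ {ν})ᗮ →L[ℝ] (Submodule.span ℝ {ν})ᗮ)) :
        (Submodule.span ℝ {ν})ᗮ →ₗ[ℝ] (Submodule.span ℝ {ν})ᗮ) =
      LinearMap.det ((((Submodule.span ℝ {ν'})ᗮ.orthogonalProjectionOnto ∘L A' ∘L
        (Submodule.span ℝ {ν'})ᗮ.subtypeL :
          (Submodule.span ℝ {ν'})ᗮ →L[ℝ] (Submodule.span ℝ {ν'})ᗮ)) :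
        (Submodule.span ℝ {ν'})ᗮ →ₗ[ℝ] (Submodule.span ℝ {ν'})ᗮ) := by
    rintro ν _ A _ rfl rfl
    rfl
  exact key _ _ _ _ h1 h2

theorem lintegral_frontier_preimage_add (c : E n) (F : E n → ℝ≥0∞) :
    ∫⁻ p in frontier ((fun v => v + c) ⁻¹' Ω), F (p + c) ∂(μHE[n] : Measure (E n)) =
      ∫⁻ p in frontier Ω, F p ∂(μHE[n] : Measure (E n)) := by
  rw [frontier_preimage_add]
  exact (measurePreserving_add_right _ c).setLIntegral_comp_preimage_emb
    (Homeomorph.addRight c).measurableEmbedding F _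

/-- The Gauss curvature of a unit ball is `1`. -/
theorem gaussCurvature_closedBall {c p : E n} (hΩ : HasSmoothBoundary (closedBall c 1))
    (hp : p ∈ frontier (closedBall c 1)) : gaussCurvature (closedBall c 1) p = 1 := by
  have hpre : (fun v => v + c) ⁻¹' closedBall c 1 = closedBall (0 : E n) 1 := by
    ext v; simp [dist_eq_norm]
  have hB := hΩ.preimage_add c
  have hK := gaussCurvature_preimage_add (Ω := closedBall c 1) c (p - c)
  rw [hpre, sub_add_cancel] at hK
  rw [hpre] at hB
  rw [← hK]
  have hcB := isCompact_closedBall (0 : E n) 1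
  have hconv := convex_closedBall (0 : E n) 1
  have h0 : (0 : E n) ∈ interior (closedBall (0 : E n) 1) :=
    interior_mono ball_subset_closedBall (by rw [isOpen_ball.interior_eq]; simp)
  have hfr : ∀ q ∈ frontier (closedBall (0 : E n) 1), ‖q‖ = 1 := fun q hq => by
    have := frontier_closedBall_subset_sphere hq
    simpa using this
  have hg : ∀ q ∈ frontier (closedBall (0 : E n) 1), gaussMap (closedBall (0 : E n) 1) q = q := by
    intro q hq
    refine (hB.eq_gaussMap hcB hconv hq ⟨hfr q hq, fun z hz => ?_⟩).symm
    have h1 := real_inner_le_norm q z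
    rw [inner_sub_right, real_inner_self_eq_norm_sq, hfr q hq]
    rw [hfr q hq] at h1
    have : ‖z‖ ≤ 1 := by simpa using hz
    linarith
  have hq : p - c ∈ frontier (closedBall (0 : E n) 1) := by
    rw [← hpre, frontier_preimage_add]; simpa using hp
  have hid : HasFDerivWithinAt (gaussMap (closedBall (0 : E n) 1)) (ContinuousLinearMap.id ℝ (E n))
      (frontier (closedBall (0 : E n) 1)) (p - c) :=
    (hasFDerivWithinAt_id _ _).congr (fun q hq => hg q hq) (hg _ hq)
  rw [gaussCurvature_eq_det hconv h0 hq, compression_congr (norm_gaussMap hconv h0 hq)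
    fun v hv => hB.fderivWithin_gaussMap_apply hcB hconv h0 hq hid hv]
  have : compression (gaussMap (closedBall (0 : E n) 1) (p - c)) (ContinuousLinearMap.id ℝ (E n)) =
      ContinuousLinearMap.id ℝ (E n) := by
    ext1 v
    rw [compression_apply, ContinuousLinearMap.id_apply,
      tanProj_of_inner_eq_zero (inner_tanProj (norm_gaussMap hconv h0 hq) v), tanProj_apply]
    simp
  rw [this]
  simp [ContinuousLinearMap.det]

end translate

/-! ### Volumes of cones -/

section cones

variable {n : ℕ}

theorem euclideanHausdorffMeasure_image_le {K : ℝ≥0} {f : E n → E n} {s : Set (E n)}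
    (h : LipschitzOnWith K f s) (d : ℕ) :
    (μHE[d] : Measure (E n)) (f '' s) ≤ (K : ℝ≥0∞) ^ d * (μHE[d] : Measure (E n)) s := by
  rw [Measure.euclideanHausdorffMeasure_def, Measure.smul_apply, Measure.smul_apply,
    ENNReal.smul_def, smul_eq_mul, ENNReal.smul_def, smul_eq_mul, mul_left_comm]
  gcongr
  simpa using h.hausdorffMeasure_image_le (d := d) (by positivity)

theorem lintegral_Ioc_div_pow {u : ℝ} (hu : 0 < u) :
    ∫⁻ x in Ioc 0 u, ENNReal.ofReal (x / u) ^ n = ENNReal.ofReal (u / (n + 1)) := by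
  have h1 : ∫ x in (0 : ℝ)..u, (x / u) ^ n = u / (n + 1) := by
    rw [intervalIntegral.integral_comp_div (fun x => x ^ n) hu.ne', zero_div, div_self hu.ne',
      integral_pow]
    simp [div_eq_mul_inv]
  rw [← h1, intervalIntegral.integral_of_le hu.le, ofReal_integral_eq_lintegral_ofReal]
  · refine setLIntegral_congr_fun measurableSet_Ioc fun x hx => ?_
    rw [ENNReal.ofReal_pow (div_nonneg hx.1.le hu.le)]
  · exact (Continuous.integrableOn_Icc (by fun_prop)).mono_set Ioc_subset_Icc_self
  · filter_upwards [ae_restrict_mem measurableSet_Ioc] with x hx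
    exact pow_nonneg (div_nonneg hx.1.le hu.le) _

/-- The volume of the cone over a subset of a hyperplane. -/
theorem volume_cone_hyperplane {ν : E n} (hν : ‖ν‖ = 1) {u : ℝ} (hu : 0 < u) {B : Set (E n)}
    (hB : MeasurableSet B) (hBu : ∀ y ∈ B, ⟪ν, y⟫ = u) :
    volume {y : E n | 0 < ⟪ν, y⟫ ∧ ⟪ν, y⟫ ≤ u ∧ (u / ⟪ν, y⟫) • y ∈ B} =
      ENNReal.ofReal (u / (n + 1)) * (μHE[n] : Measure (E n)) B := by
  set C : Set (E n) := {y : E n | 0 < ⟪ν, y⟫ ∧ ⟪ν, y⟫ ≤ u ∧ (u / ⟪ν, y⟫) • y ∈ B} with hC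
  have hCm : MeasurableSet C := by
    have h1 : Measurable fun y : E n => ⟪ν, y⟫ := by fun_prop
    have h2 : Measurable fun y : E n => (u / ⟪ν, y⟫) • y := (h1.const_div u).smul measurable_id
    exact (measurableSet_lt measurable_const h1).inter
      ((measurableSet_le h1 measurable_const).inter (h2 hB))
  have hν0 : ν ≠ 0 := norm_ne_zero_iff.1 (by rw [hν]; norm_num)
  have hfr : Module.finrank ℝ (E n) = n + 1 := finrank_euclideanSpace_fin
  -- Cavalieri: the slice at height `x` is `(x / u) • B`, whose `n`-dimensional measure scales by
  -- `(x / u)^n`.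
  have hslice (x : ℝ) : (μHE[n] : Measure (E n)) (C ∩ AffineSubspace.mk' (x • ν +ᵥ (0 : E n))
      (ℝ ∙ ν)ᗮ) = (Ioc 0 u).indicator
        (fun x => ENNReal.ofReal (x / u) ^ n * (μHE[n] : Measure (E n)) B) x := by
    have hmem (y : E n) : y ∈ AffineSubspace.mk' (x • ν +ᵥ (0 : E n)) (ℝ ∙ ν)ᗮ ↔ ⟪ν, y⟫ = x := by
      rw [AffineSubspace.mem_mk', Submodule.mem_orthogonal_singleton_iff_inner_right]
      simp only [vadd_eq_add, add_zero, vsub_eq_sub, inner_sub_right, inner_smul_right,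
        real_inner_self_eq_norm_sq, hν]
      rw [one_pow, mul_one, sub_eq_zero]
    by_cases hx : x ∈ Ioc 0 u
    · rw [indicator_of_mem hx]
      have hxu : 0 < x / u := div_pos hx.1 hu
      have : C ∩ AffineSubspace.mk' (x • ν +ᵥ (0 : E n)) (ℝ ∙ ν)ᗮ = (x / u) • B := by
        ext y
        rw [mem_smul_set_iff_inv_smul_mem₀ hxu.ne', inv_div]
        constructor
        · rintro ⟨⟨-, -, h3⟩, h4⟩
          rwa [(hmem y).1 h4] at h3
        · intro h
          have h5 := hBu _ h
          rw [inner_smul_right] at h5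
          have h6 : ⟪ν, y⟫ = x := by
            have := hx.1.ne'
            field_simp at h5
            exact h5
          refine ⟨⟨?_, ?_, ?_⟩, (hmem y).2 h6⟩ <;> rw [h6]
          exacts [hx.1, hx.2, h]
      rw [this, Measure.euclideanHausdorffMeasure_smul₀ n hxu.ne', ENNReal.smul_def, smul_eq_mul,
        ENNReal.coe_pow]
      congr 2
      rw [← enorm_eq_nnnorm, Real.enorm_of_nonneg hxu.le]
    · rw [indicator_of_notMem hx]
      have : C ∩ AffineSubspace.mk' (x • ν +ᵥ (0 : E n)) (ℝ ∙ ν)ᗮ = ∅ := by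
        refine eq_empty_of_forall_notMem fun y ⟨⟨h1, h2, _⟩, h4⟩ => hx ?_
        rw [(hmem y).1 h4] at h1 h2
        exact ⟨h1, h2⟩
      rw [this, measure_empty]
  have main := EuclideanGeometry.euclideanHausdorffMeasure_eq_lintegral (0 : E n) hν0 hCm
  rw [InnerProductSpace.euclideanHausdorffMeasure_eq_volume, hfr, Nat.add_sub_cancel] at main
  rw [main]
  simp_rw [hslice]
  rw [lintegral_indicator measurableSet_Ioc, lintegral_mul_const _ (by fun_prop),
    lintegral_Ioc_div_pow hu, ← ofReal_norm, hν, ENNReal.ofReal_one, one_mul]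

end cones

/-! ### The cone measure of a smooth convex body -/

section coneMeasure

variable {n : ℕ} {T : Set (E n)}

theorem measurable_radialProj (hconv : Convex ℝ T) (h0 : (0 : E n) ∈ interior T) :
    Measurable (radialProj T) :=
  (continuous_gauge hconv (mem_interior_iff_mem_nhds.1 h0)).measurable.inv.smul measurable_id

theorem radialProj_smul {t : ℝ} (ht : 0 < t) (y : E n) :
    radialProj T (t • y) = radialProj T y := by
  rw [radialProj, radialProj, gauge_smul_of_nonneg ht.le, smul_eq_mul, mul_inv, smul_smul,
    mul_right_comm, inv_mul_cancel₀ ht.ne', one_mul]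

/-- Near a boundary point, normals are almost orthogonal to chords, and the radial projection onto
the tangent plane is almost isometric. -/
theorem HasSmoothBoundary.exists_nhds_almost_isometric (hT : HasSmoothBoundary T)
    (hc : IsCompact T) (hconv : Convex ℝ T) (h0 : (0 : E n) ∈ interior T) {p : E n}
    (hp : p ∈ frontier T) {r : ℝ} (hr : 1 < r) :
    ∃ V : Set (E n), IsOpen V ∧ p ∈ V ∧ ∀ a ∈ V, a ∈ frontier T →
      ⟪gaussMap T p, p⟫ / r ≤ ⟪gaussMap T p, a⟫ ∧
      ⟪gaussMap T p, a⟫ ≤ ⟪gaussMap T p, p⟫ ∧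
      ⟪gaussMap T p, p⟫ / r ≤ ⟪gaussMap T a, a⟫ ∧ ⟪gaussMap T a, a⟫ ≤ r * ⟪gaussMap T p, p⟫ ∧
      ∀ b ∈ V, b ∈ frontier T →
        dist ((⟪gaussMap T p, p⟫ / ⟪gaussMap T p, a⟫) • a)
          ((⟪gaussMap T p, p⟫ / ⟪gaussMap T p, b⟫) • b) ≤ r * dist a b ∧
        dist a b ≤ r * dist ((⟪gaussMap T p, p⟫ / ⟪gaussMap T p, a⟫) • a)
          ((⟪gaussMap T p, p⟫ / ⟪gaussMap T p, b⟫) • b) := by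
  have hu := inner_gaussMap_pos hc hconv h0 hp
  have hnp := isOuterUnitNormal_gaussMap hconv ⟨0, h0⟩ hp.2
  have hcl := hc.isClosed.frontier_subset
  have hcont := hT.continuousOn_gaussMap hc hconv
  set ν := gaussMap T p with hν
  set u := ⟪ν, p⟫ with hudef
  obtain ⟨R, hR⟩ := hc.isBounded.exists_pos_norm_le
  obtain ⟨hRpos, hR⟩ := hR
  have hr0 : 0 < r := by linarith
  -- Half of the slack `r - 1` is for the dilation factors `u / ⟪ν, a⟫ ≤ s`, the rest for their
  -- variation between `a` and `b`; `ε` is solved from `s² ε R / u = (r - 1) / (2 r)`.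
  set s := (1 + r) / 2 with hs
  have hs1 : 1 < s := by rw [hs]; linarith
  have hsr : s ≤ r := by rw [hs]; linarith
  set ε := (r - 1) / (2 * r) * u / (s ^ 2 * R) with hε
  have hεpos : 0 < ε := by
    have : 0 < r - 1 := by linarith
    positivity
  have hδ : s ^ 2 * ε * R / u = (r - 1) / (2 * r) := by rw [hε]; field_simp
  have hc1 : ContinuousWithinAt (fun a => ⟪gaussMap T a, a⟫) (frontier T) p :=
    (hcont p hp).inner continuousWithinAt_id
  have hc2 : ContinuousWithinAt (fun a => ⟪ν, a⟫) (frontier T) p := by fun_prop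
  have hc3 : ContinuousWithinAt (fun a => ‖gaussMap T a - ν‖) (frontier T) p :=
    ((hcont p hp).sub continuousWithinAt_const).norm
  have hus : u / s < u := div_lt_self hu hs1
  have hur : u / r < u := div_lt_self hu hr
  have e1 := hc2.eventually (lt_mem_nhds (show u / s < ⟪ν, p⟫ from hus))
  have e2 := hc1.eventually (lt_mem_nhds (show u / r < ⟪gaussMap T p, p⟫ from hur))
  have e3 := hc1.eventually (gt_mem_nhds (show ⟪gaussMap T p, p⟫ < r * u from by
    rw [← hν, ← hudef]; nlinarith))
  have e4 := hc3.eventually (gt_mem_nhds (show ‖gaussMap T p - ν‖ < ε by simpa [hν] using hεpos))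
  obtain ⟨V, hV, hpV, hVs⟩ := (mem_nhdsWithin.1 (e1.and (e2.and (e3.and e4))))
  refine ⟨V, hV, hpV, fun a ha hafr => ?_⟩
  obtain ⟨a1, a2, a3, a4⟩ := hVs ⟨ha, hafr⟩
  have hle : ∀ a ∈ frontier T, ⟪ν, a⟫ ≤ u := by
    intro a ha
    have := hnp.2 a (hcl ha)
    rw [inner_sub_right] at this
    linarith
  refine ⟨(div_le_div_of_nonneg_left hu.le (by linarith) hsr).trans a1.le, hle a hafr, a2.le,
    a3.le, fun b hb hbfr => ?_⟩
  obtain ⟨b1, b2, b3, b4⟩ := hVs ⟨hb, hbfr⟩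
  have hna := isOuterUnitNormal_gaussMap hconv ⟨0, h0⟩ hafr.2
  have hnb := isOuterUnitNormal_gaussMap hconv ⟨0, h0⟩ hbfr.2
  -- The normals at `a` and at `b` bound the chord from opposite sides, and both are within `ε` of
  -- `ν`.
  have hchord : |⟪ν, b - a⟫| ≤ ε * ‖a - b‖ := by
    have i1 := hna.2 b (hcl hbfr)
    have i2 := hnb.2 a (hcl hafr)
    have j1 : ⟪ν - gaussMap T a, b - a⟫ ≤ ε * ‖a - b‖ := by
      refine (real_inner_le_norm _ _).trans ?_
      rw [norm_sub_rev ν, norm_sub_rev b a]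
      exact mul_le_mul_of_nonneg_right (le_of_lt a4) (norm_nonneg _)
    have j2 : ⟪ν - gaussMap T b, a - b⟫ ≤ ε * ‖a - b‖ := by
      refine (real_inner_le_norm _ _).trans ?_
      rw [norm_sub_rev ν]
      exact mul_le_mul_of_nonneg_right (le_of_lt b4) (norm_nonneg _)
    rw [inner_sub_left] at j1 j2
    rw [abs_le]
    have k : ⟪ν, a - b⟫ = -⟪ν, b - a⟫ := by rw [← neg_sub, inner_neg_right]
    constructor <;> linarith
  have hs0 : 0 < s := by linarith
  have ha0 : 0 < ⟪ν, a⟫ := (div_pos hu hs0).trans a1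
  have hb0 : 0 < ⟪ν, b⟫ := (div_pos hu hs0).trans b1
  set la := u / ⟪ν, a⟫ with hla
  set lb := u / ⟪ν, b⟫ with hlb
  have hla1 : 1 ≤ la := (one_le_div ha0).2 (hle a hafr)
  have hlas : la ≤ s := by
    rw [hla, div_le_iff₀ ha0]
    have := (div_lt_iff₀ hs0).1 a1
    linarith
  have hdiff : ‖(la - lb) • b‖ ≤ (r - 1) / (2 * r) * ‖a - b‖ := by
    have h1 : la - lb = u * ⟪ν, b - a⟫ / (⟪ν, a⟫ * ⟪ν, b⟫) := by
      rw [hla, hlb, inner_sub_right]; field_simp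
    have h2 : (u / s) * (u / s) ≤ ⟪ν, a⟫ * ⟪ν, b⟫ :=
      mul_le_mul a1.le b1.le (div_pos hu hs0).le ha0.le
    rw [norm_smul, Real.norm_eq_abs, h1, abs_div, abs_mul, abs_of_pos hu,
      abs_of_pos (mul_pos ha0 hb0)]
    calc u * |⟪ν, b - a⟫| / (⟪ν, a⟫ * ⟪ν, b⟫) * ‖b‖
        ≤ u * (ε * ‖a - b‖) / ((u / s) * (u / s)) * R := by
          gcongr
          exact hR b (hcl hbfr)
      _ = (s ^ 2 * ε * R / u) * ‖a - b‖ := by field_simp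
      _ = (r - 1) / (2 * r) * ‖a - b‖ := by rw [hδ]
  have hsplit : la • a - lb • b = la • (a - b) + (la - lb) • b := by module
  have hnorm : ‖la • (a - b)‖ = la * ‖a - b‖ := by
    rw [norm_smul, Real.norm_of_nonneg (by linarith)]
  have hd1 : (r - 1) / (2 * r) ≤ (r - 1) / 2 :=
    div_le_div_of_nonneg_left (by linarith) (by norm_num) (by linarith)
  rw [dist_eq_norm, dist_eq_norm, hsplit]
  have hab := norm_nonneg (a - b)
  constructor
  · refine (norm_add_le _ _).trans ?_
    rw [hnorm]
    have h1 : la * ‖a - b‖ ≤ s * ‖a - b‖ := mul_le_mul_of_nonneg_right hlas hab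
    have h2 := mul_le_mul_of_nonneg_right hd1 hab
    have h3 : r * ‖a - b‖ = s * ‖a - b‖ + (r - 1) / 2 * ‖a - b‖ := by rw [hs]; ring
    linarith
  · have h1 : ‖la • (a - b)‖ - ‖(la - lb) • b‖ ≤ ‖la • (a - b) + (la - lb) • b‖ := by
      have := norm_sub_le (la • (a - b) + (la - lb) • b) ((la - lb) • b)
      rw [add_sub_cancel_right] at this
      linarith
    rw [hnorm] at h1
    have h2 : 1 * ‖a - b‖ ≤ la * ‖a - b‖ := mul_le_mul_of_nonneg_right hla1 hab
    have h3 : r * ((1 - (r - 1) / (2 * r)) * ‖a - b‖) ≤ r * ‖la • (a - b) + (la - lb) • b‖ :=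
      mul_le_mul_of_nonneg_left (by linarith) hr0.le
    have h4 : r * ((1 - (r - 1) / (2 * r)) * ‖a - b‖) = (r + 1) / 2 * ‖a - b‖ := by
      field_simp; ring
    have h5 : 1 * ‖a - b‖ ≤ (r + 1) / 2 * ‖a - b‖ :=
      mul_le_mul_of_nonneg_right (by linarith) hab
    linarith

/-- The part of `T` over a subset `A` of the boundary. -/
def cone (T A : Set (E n)) : Set (E n) := T ∩ radialProj T ⁻¹' A

/-- Local comparison of the cone measure and the Hausdorff measure. -/
theorem HasSmoothBoundary.exists_nhds_volume_cone (hT : HasSmoothBoundary T)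
    (hc : IsCompact T) (hconv : Convex ℝ T) (h0 : (0 : E n) ∈ interior T) {p : E n}
    (hp : p ∈ frontier T) {r : ℝ} (hr : 1 < r) :
    ∃ V : Set (E n), IsOpen V ∧ p ∈ V ∧
      (∀ a ∈ V, a ∈ frontier T →
        ⟪gaussMap T p, p⟫ / r ≤ ⟪gaussMap T a, a⟫ ∧ ⟪gaussMap T a, a⟫ ≤ r * ⟪gaussMap T p, p⟫) ∧
      ∀ A ⊆ V ∩ frontier T, MeasurableSet A →
        volume (cone T A) ≤ ENNReal.ofReal r ^ n *
          (ENNReal.ofReal (⟪gaussMap T p, p⟫ / (n + 1)) * (μHE[n] : Measure (E n)) A) ∧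
        ENNReal.ofReal (⟪gaussMap T p, p⟫ / (n + 1)) * (μHE[n] : Measure (E n)) A ≤
          ENNReal.ofReal r ^ (2 * n + 1) * volume (cone T A) := by
  obtain ⟨V, hV, hpV, H⟩ := hT.exists_nhds_almost_isometric hc hconv h0 hp hr
  refine ⟨V, hV, hpV, fun a ha hafr => ⟨(H a ha hafr).2.2.1, (H a ha hafr).2.2.2.1⟩,
    fun A hA hAm => ?_⟩
  have hu := inner_gaussMap_pos hc hconv h0 hp
  have hν1 := norm_gaussMap hconv h0 hp
  have hcl := hc.isClosed.frontier_subset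
  set ν := gaussMap T p with hν
  set u := ⟪ν, p⟫ with hudef
  have hr0 : 0 < r := by linarith
  let ρ : E n → E n := fun a => (u / ⟪ν, a⟫) • a
  have hpos : ∀ a ∈ A, 0 < ⟪ν, a⟫ := fun a ha =>
    (div_pos hu hr0).trans_le (H a (hA ha).1 (hA ha).2).1
  have hproj : ∀ a ∈ A, radialProj T a = a := fun a ha =>
    radialProj_of_mem_frontier hconv h0 (hA ha).2
  have hπρ : ∀ a ∈ A, radialProj T (ρ a) = a := fun a ha => by
    rw [radialProj_smul (div_pos hu (hpos a ha)), hproj a ha]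
  have hBeq : ρ '' A = {y | ⟪ν, y⟫ = u} ∩ radialProj T ⁻¹' A := by
    ext y
    constructor
    · rintro ⟨a, ha, rfl⟩
      refine ⟨?_, by rw [mem_preimage, hπρ a ha]; exact ha⟩
      change ⟪ν, (u / ⟪ν, a⟫) • a⟫ = u
      rw [inner_smul_right, div_mul_cancel₀ _ (hpos a ha).ne']
    · rintro ⟨hy, hya⟩
      refine ⟨_, hya, ?_⟩
      have hy' : ⟪ν, y⟫ = u := hy
      have hy0 : y ≠ 0 := by rintro rfl; rw [inner_zero_right] at hy'; exact hu.ne hy'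
      have hg := gauge_pos_of_ne_zero hc h0 hy0
      change (u / ⟪ν, radialProj T y⟫) • radialProj T y = y
      rw [radialProj, inner_smul_right, hy', smul_smul]
      rw [show u / ((gauge T y)⁻¹ * u) * (gauge T y)⁻¹ = 1 by field_simp, one_smul]
  have hBm : MeasurableSet (ρ '' A) := by
    rw [hBeq]
    exact (measurableSet_eq_fun (by fun_prop) measurable_const).inter
      (measurable_radialProj hconv h0 hAm)
  have hvol := volume_cone_hyperplane hν1 hu hBm (fun y hy => by rw [hBeq] at hy; exact hy.1)
  set C : Set (E n) := {y : E n | 0 < ⟪ν, y⟫ ∧ ⟪ν, y⟫ ≤ u ∧ (u / ⟪ν, y⟫) • y ∈ ρ '' A} with hC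
  have hLip : LipschitzOnWith r.toNNReal ρ A := by
    refine LipschitzOnWith.of_dist_le_mul fun a ha b hb => ?_
    rw [Real.coe_toNNReal r hr0.le]
    exact ((H a (hA ha).1 (hA ha).2).2.2.2.2 b (hA hb).1 (hA hb).2).1
  have hLip' : LipschitzOnWith r.toNNReal (radialProj T) (ρ '' A) := by
    refine LipschitzOnWith.of_dist_le_mul ?_
    rintro _ ⟨a, ha, rfl⟩ _ ⟨b, hb, rfl⟩
    rw [Real.coe_toNNReal r hr0.le, hπρ a ha, hπρ b hb]
    exact ((H a (hA ha).1 (hA ha).2).2.2.2.2 b (hA hb).1 (hA hb).2).2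
  have hAimg : radialProj T '' (ρ '' A) = A := by
    rw [image_image]
    ext y
    constructor
    · rintro ⟨a, ha, rfl⟩
      change radialProj T (ρ a) ∈ A
      rwa [hπρ a ha]
    · exact fun hy => ⟨y, hy, hπρ y hy⟩
  have m1 := euclideanHausdorffMeasure_image_le hLip n
  have m2 := euclideanHausdorffMeasure_image_le hLip' n
  rw [hAimg] at m2
  have hof : ((r.toNNReal : ℝ≥0) : ℝ≥0∞) = ENNReal.ofReal r := rfl
  rw [hof] at m1 m2
  -- The body lies below its tangent hyperplane at `p`, so the curved cone sits inside the straight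
  -- one; near `p` the straight cone lies in an `r`-fold dilate of the curved one.
  have hsub1 : cone T A ⊆ C := by
    rintro y ⟨hyT, hyA⟩
    have hy0 : y ≠ 0 := by
      rintro rfl
      refine ne_zero_of_mem_frontier h0 (hA hyA).2 ?_
      simp [radialProj]
    have hg := gauge_pos_of_ne_zero hc h0 hy0
    have hg1 : gauge T y ≤ 1 := gauge_le_one_of_mem hyT
    have ha := hpos _ hyA
    have hle := (H _ (hA hyA).1 (hA hyA).2).2.1
    have hyeq : y = gauge T y • radialProj T y := (gauge_smul_radialProj hc h0 hy0).symm
    have hin : ⟪ν, y⟫ = gauge T y * ⟪ν, radialProj T y⟫ := by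
      conv_lhs => rw [hyeq]
      rw [inner_smul_right]
    refine ⟨by rw [hin]; positivity, ?_, _, hyA, ?_⟩
    · rw [hin]; nlinarith
    · change (u / ⟪ν, radialProj T y⟫) • radialProj T y = (u / ⟪ν, y⟫) • y
      rw [hin]
      conv_rhs => rw [hyeq]
      rw [smul_smul]
      congr 1
      rw [← hyeq]
      field_simp
  have hsub2 : C ⊆ r • cone T A := by
    rintro y ⟨hy1, hy2, a, ha, hay⟩
    have ha0 := hpos a ha
    have hyeq : y = (⟪ν, y⟫ / ⟪ν, a⟫) • a := by
      have h1 : (⟪ν, y⟫ / u) • ((u / ⟪ν, y⟫) • y) = y := by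
        rw [smul_smul, div_mul_div_cancel₀ hu.ne', div_self hy1.ne', one_smul]
      rw [← hay] at h1
      refine h1.symm.trans ?_
      change (⟪ν, y⟫ / u) • ((u / ⟪ν, a⟫) • a) = _
      rw [smul_smul, div_mul_div_cancel₀ hu.ne']
    have hs : 0 < r⁻¹ * (⟪ν, y⟫ / ⟪ν, a⟫) := by positivity
    rw [mem_smul_set_iff_inv_smul_mem₀ hr0.ne', hyeq, smul_smul]
    refine ⟨?_, ?_⟩
    · refine hconv.smul_mem_of_zero_mem (interior_subset h0) (hcl (hA ha).2) ⟨hs.le, ?_⟩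
      rw [inv_mul_le_iff₀ hr0, mul_one, div_le_iff₀ ha0]
      have := (div_le_iff₀ hr0).1 (H a (hA ha).1 (hA ha).2).1
      linarith
    · rw [mem_preimage, radialProj_smul hs, hproj a ha]
      exact ha
  have v2 : volume C ≤ ENNReal.ofReal r ^ (n + 1) * volume (cone T A) := by
    refine (measure_mono hsub2).trans_eq ?_
    rw [Measure.addHaar_smul_of_nonneg _ hr0.le, finrank_euclideanSpace_fin,
      ENNReal.ofReal_pow hr0.le]
  constructor
  · refine (measure_mono hsub1).trans ?_
    rw [hvol, mul_left_comm]
    gcongr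
  · calc ENNReal.ofReal (u / (n + 1)) * (μHE[n] : Measure (E n)) A
        ≤ ENNReal.ofReal (u / (n + 1)) * (ENNReal.ofReal r ^ n *
          (μHE[n] : Measure (E n)) (ρ '' A)) := by gcongr
      _ = ENNReal.ofReal r ^ n * volume C := by rw [hvol, mul_left_comm]
      _ ≤ ENNReal.ofReal r ^ n * (ENNReal.ofReal r ^ (n + 1) * volume (cone T A)) := by gcongr
      _ = ENNReal.ofReal r ^ (2 * n + 1) * volume (cone T A) := by
          rw [← mul_assoc, ← pow_add]; congr 2; omega

end coneMeasure

/-! ### From local comparison to the exact density of the cone measure. -/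

section coneMeasureGlobal

variable {n : ℕ} {T : Set (E n)}

theorem measurableSet_cone (hc : IsCompact T) (hconv : Convex ℝ T) (h0 : (0 : E n) ∈ interior T)
    {A : Set (E n)} (hA : MeasurableSet A) : MeasurableSet (cone T A) :=
  hc.measurableSet.inter (measurable_radialProj hconv h0 hA)

/-- The density `⟪ν(a), a⟫` differs from its value at `p` by a factor at most `r`. The exponent `2n
+ 2` is `2n + 1` plus this extra factor; the other direction needs only `n + 1`. -/
theorem HasSmoothBoundary.exists_nhds_cone_le (hT : HasSmoothBoundary T)
    (hc : IsCompact T) (hconv : Convex ℝ T) (h0 : (0 : E n) ∈ interior T) {p : E n}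
    (hp : p ∈ frontier T) {r : ℝ} (hr : 1 < r) :
    ∃ V : Set (E n), IsOpen V ∧ p ∈ V ∧ ∀ A ⊆ V ∩ frontier T, MeasurableSet A →
      (n + 1) * volume (cone T A) ≤ ENNReal.ofReal r ^ (2 * n + 2) *
        ∫⁻ a in A, ENNReal.ofReal ⟪gaussMap T a, a⟫ ∂(μHE[n] : Measure (E n)) ∧
      ∫⁻ a in A, ENNReal.ofReal ⟪gaussMap T a, a⟫ ∂(μHE[n] : Measure (E n)) ≤
        ENNReal.ofReal r ^ (2 * n + 2) * ((n + 1) * volume (cone T A)) := by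
  obtain ⟨V, hV, hpV, hu, H⟩ := hT.exists_nhds_volume_cone hc hconv h0 hp hr
  refine ⟨V, hV, hpV, fun A hA hAm => ?_⟩
  obtain ⟨H1, H2⟩ := H A hA hAm
  set u := ⟪gaussMap T p, p⟫ with hudef
  have hr0 : 0 < r := by linarith
  have hR : 1 ≤ ENNReal.ofReal r := by
    rw [← ENNReal.ofReal_one]; exact ENNReal.ofReal_le_ofReal hr.le
  have hn : ((n : ℝ≥0∞) + 1) * ENNReal.ofReal (u / (n + 1)) = ENNReal.ofReal u := by
    have : ((n : ℝ≥0∞) + 1) = ENNReal.ofReal ((n : ℝ) + 1) := by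
      rw [ENNReal.ofReal_add (by positivity) zero_le_one, ENNReal.ofReal_natCast,
        ENNReal.ofReal_one]
    rw [this, ← ENNReal.ofReal_mul (by positivity)]
    congr 1
    field_simp
  have l1 : ENNReal.ofReal u * (μHE[n] : Measure (E n)) A ≤ ENNReal.ofReal r *
      ∫⁻ a in A, ENNReal.ofReal ⟪gaussMap T a, a⟫ ∂(μHE[n] : Measure (E n)) := by
    have : ENNReal.ofReal u = ENNReal.ofReal r * ENNReal.ofReal (u / r) := by
      rw [← ENNReal.ofReal_mul hr0.le, mul_div_cancel₀ _ hr0.ne']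
    rw [this, mul_assoc, ← setLIntegral_const]
    gcongr ENNReal.ofReal r * ?_
    exact setLIntegral_mono' hAm fun a ha =>
      ENNReal.ofReal_le_ofReal (hu a (hA ha).1 (hA ha).2).1
  have l2 : ∫⁻ a in A, ENNReal.ofReal ⟪gaussMap T a, a⟫ ∂(μHE[n] : Measure (E n)) ≤
      ENNReal.ofReal r * (ENNReal.ofReal u * (μHE[n] : Measure (E n)) A) := by
    rw [← mul_assoc, ← ENNReal.ofReal_mul hr0.le, ← setLIntegral_const]
    exact setLIntegral_mono' hAm fun a ha =>
      ENNReal.ofReal_le_ofReal (hu a (hA ha).1 (hA ha).2).2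
  constructor
  · calc ((n : ℝ≥0∞) + 1) * volume (cone T A)
        ≤ (n + 1) * (ENNReal.ofReal r ^ n *
          (ENNReal.ofReal (u / (n + 1)) * (μHE[n] : Measure (E n)) A)) := by gcongr
      _ = ENNReal.ofReal r ^ n * (ENNReal.ofReal u * (μHE[n] : Measure (E n)) A) := by
          rw [← hn]; ring
      _ ≤ ENNReal.ofReal r ^ n * (ENNReal.ofReal r *
          ∫⁻ a in A, ENNReal.ofReal ⟪gaussMap T a, a⟫ ∂(μHE[n] : Measure (E n))) := by gcongr
      _ = ENNReal.ofReal r ^ (n + 1) *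
          ∫⁻ a in A, ENNReal.ofReal ⟪gaussMap T a, a⟫ ∂(μHE[n] : Measure (E n)) := by ring
      _ ≤ _ := by
          gcongr ?_ * _
          exact pow_le_pow_right₀ hR (by omega)
  · calc _ ≤ ENNReal.ofReal r * (ENNReal.ofReal u * (μHE[n] : Measure (E n)) A) := l2
      _ = ENNReal.ofReal r * ((n + 1) *
          (ENNReal.ofReal (u / (n + 1)) * (μHE[n] : Measure (E n)) A)) := by rw [← hn]; ring
      _ ≤ ENNReal.ofReal r * ((n + 1) * (ENNReal.ofReal r ^ (2 * n + 1) * volume (cone T A))) := by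
          gcongr
      _ = _ := by ring

/-- Almost-equality of the two measures on all of the boundary. -/
theorem HasSmoothBoundary.cone_le (hT : HasSmoothBoundary T)
    (hc : IsCompact T) (hconv : Convex ℝ T) (h0 : (0 : E n) ∈ interior T) {r : ℝ} (hr : 1 < r)
    {A : Set (E n)} (hA : A ⊆ frontier T) (hAm : MeasurableSet A) :
    (n + 1) * volume (cone T A) ≤ ENNReal.ofReal r ^ (2 * n + 2) *
        ∫⁻ a in A, ENNReal.ofReal ⟪gaussMap T a, a⟫ ∂(μHE[n] : Measure (E n)) ∧
      ∫⁻ a in A, ENNReal.ofReal ⟪gaussMap T a, a⟫ ∂(μHE[n] : Measure (E n)) ≤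
        ENNReal.ofReal r ^ (2 * n + 2) * ((n + 1) * volume (cone T A)) := by
  have hfr : IsCompact (frontier T) := hc.of_isClosed_subset isClosed_frontier
    hc.isClosed.frontier_subset
  -- The measurable superset `s'` in the predicate allows a set in a union of two good pieces to be
  -- cut measurably, as both sides are additive. Letting `r` tend to `1` afterwards gives equality.
  have key := hfr.induction_on (p := fun s => ∃ s', MeasurableSet s' ∧ s ⊆ s' ∧
      ∀ A ⊆ s' ∩ frontier T, MeasurableSet A →
      (n + 1) * volume (cone T A) ≤ ENNReal.ofReal r ^ (2 * n + 2) *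
        ∫⁻ a in A, ENNReal.ofReal ⟪gaussMap T a, a⟫ ∂(μHE[n] : Measure (E n)) ∧
      ∫⁻ a in A, ENNReal.ofReal ⟪gaussMap T a, a⟫ ∂(μHE[n] : Measure (E n)) ≤
        ENNReal.ofReal r ^ (2 * n + 2) * ((n + 1) * volume (cone T A))) ?_ ?_ ?_ ?_
  · obtain ⟨s', -, hs', h⟩ := key
    exact h A (fun a ha => ⟨hs' (hA ha), hA ha⟩) hAm
  · refine ⟨∅, MeasurableSet.empty, subset_rfl, fun A hA _ => ?_⟩
    rw [empty_inter, subset_empty_iff] at hA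
    subst hA
    simp [cone]
  · rintro s t hst ⟨t', ht', htt', h⟩
    exact ⟨t', ht', hst.trans htt', h⟩
  · rintro s t ⟨s', hs', hss', hs⟩ ⟨t', ht', htt', ht⟩
    refine ⟨s' ∪ t', hs'.union ht', union_subset_union hss' htt', fun A hA hAm => ?_⟩
    obtain ⟨a1, a2⟩ := hs (A ∩ s') (fun x hx => ⟨hx.2, (hA hx.1).2⟩) (hAm.inter hs')
    obtain ⟨b1, b2⟩ := ht (A \ s') (fun x hx => ⟨(hA hx.1).1.resolve_left hx.2, (hA hx.1).2⟩)
      (hAm.diff hs')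
    have e1 : volume (cone T A) = volume (cone T (A ∩ s')) + volume (cone T (A \ s')) := by
      rw [← measure_union _ (measurableSet_cone hc hconv h0 (hAm.diff hs'))]
      · rw [cone, cone, cone, ← inter_union_distrib_left, ← preimage_union, inter_union_sdiff]
      · rw [disjoint_left]
        rintro x ⟨-, hx⟩ ⟨-, hx'⟩
        exact hx'.2 hx.2
    have e2 := lintegral_inter_add_sdiff (μ := (μHE[n] : Measure (E n)))
      (fun a => ENNReal.ofReal ⟪gaussMap T a, a⟫) A hs'
    rw [e1, ← e2, mul_add, mul_add, mul_add]
    exact ⟨add_le_add a1 b1, add_le_add a2 b2⟩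
  · intro x hx
    obtain ⟨V, hV, hxV, h⟩ := hT.exists_nhds_cone_le hc hconv h0 hx hr
    exact ⟨V, mem_nhdsWithin_of_mem_nhds (hV.mem_nhds hxV), V, hV.measurableSet, subset_rfl, h⟩

theorem le_of_forall_one_lt_le_ofReal_pow_mul {x y : ℝ≥0∞} {k : ℕ}
    (h : ∀ r : ℝ, 1 < r → x ≤ ENNReal.ofReal r ^ k * y) : x ≤ y := by
  have h1 : Filter.Tendsto (fun r : ℝ => ENNReal.ofReal r ^ k * y) (nhdsWithin 1 (Ioi 1))
      (nhds (1 * y)) := by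
    refine ENNReal.Tendsto.mul_const ?_ (Or.inl one_ne_zero)
    have : Continuous fun r : ℝ => ENNReal.ofReal r ^ k :=
      (ENNReal.continuous_pow k).comp ENNReal.continuous_ofReal
    simpa using (this.tendsto 1).mono_left nhdsWithin_le_nhds
  rw [one_mul] at h1
  exact ge_of_tendsto h1 (by filter_upwards [self_mem_nhdsWithin] with r hr using h r hr)

/-- The cone measure of a convex body with smooth boundary has density `⟪ν(p), p⟫` with respect to
the surface measure. -/
theorem HasSmoothBoundary.volume_cone_eq (hT : HasSmoothBoundary T)
    (hc : IsCompact T) (hconv : Convex ℝ T) (h0 : (0 : E n) ∈ interior T)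
    {A : Set (E n)} (hA : A ⊆ frontier T) (hAm : MeasurableSet A) :
    (n + 1) * volume (cone T A) =
      ∫⁻ a in A, ENNReal.ofReal ⟪gaussMap T a, a⟫ ∂(μHE[n] : Measure (E n)) :=
  le_antisymm
    (le_of_forall_one_lt_le_ofReal_pow_mul fun _ hr => (hT.cone_le hc hconv h0 hr hA hAm).1)
    (le_of_forall_one_lt_le_ofReal_pow_mul fun _ hr => (hT.cone_le hc hconv h0 hr hA hAm).2)

theorem HasSmoothBoundary.aemeasurable_inner_gaussMap (hT : HasSmoothBoundary T)
    (hc : IsCompact T) (hconv : Convex ℝ T) :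
    AEMeasurable (fun a => ENNReal.ofReal ⟪gaussMap T a, a⟫)
      ((μHE[n] : Measure (E n)).restrict (frontier T)) :=
  (((hT.continuousOn_gaussMap hc hconv).inner continuousOn_id).aemeasurable
    isClosed_frontier.measurableSet).ennreal_ofReal

theorem HasSmoothBoundary.withDensity_eq (hT : HasSmoothBoundary T)
    (hc : IsCompact T) (hconv : Convex ℝ T) (h0 : (0 : E n) ∈ interior T) :
    ((μHE[n] : Measure (E n)).restrict (frontier T)).withDensity
      (fun a => ENNReal.ofReal ⟪gaussMap T a, a⟫) =
      ((n : ℝ≥0∞) + 1) • (volume.restrict T).map (radialProj T) := by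
  have hπ := measurable_radialProj hconv h0
  have hM : MeasurableSet (frontier T) := isClosed_frontier.measurableSet
  ext A hA
  rw [withDensity_apply _ hA, Measure.restrict_restrict hA, Measure.smul_apply, smul_eq_mul,
    Measure.map_apply hπ hA, Measure.restrict_apply (hπ hA),
    ← hT.volume_cone_eq hc hconv h0 inter_subset_right (hA.inter hM)]
  congr 1
  refine measure_congr ?_
  have hne : ∀ᵐ y : E n, y ≠ 0 := by simp [ae_iff]
  filter_upwards [hne] with y hy
  refine propext ⟨fun h => ⟨h.2.1, h.1⟩, fun h => ⟨h.2, h.1, ?_⟩⟩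
  exact radialProj_mem_frontier hc hconv h0 hy

/-- Integration against the cone measure. -/
theorem HasSmoothBoundary.lintegral_mul_inner_gaussMap (hT : HasSmoothBoundary T)
    (hc : IsCompact T) (hconv : Convex ℝ T) (h0 : (0 : E n) ∈ interior T) {F : E n → ℝ≥0∞}
    (hF : AEMeasurable F ((μHE[n] : Measure (E n)).restrict (frontier T))) :
    ∫⁻ a in frontier T, ENNReal.ofReal ⟪gaussMap T a, a⟫ * F a ∂(μHE[n] : Measure (E n)) =
      (n + 1) * ∫⁻ y in T, F (radialProj T y) := by
  have hπ := measurable_radialProj hconv h0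
  have hu := hT.aemeasurable_inner_gaussMap hc hconv
  have h1 := lintegral_withDensity_eq_lintegral_mul₀ hu hF
  rw [hT.withDensity_eq hc hconv h0, lintegral_smul_measure] at h1
  rw [lintegral_map' ?_ hπ.aemeasurable] at h1
  · exact h1.symm
  · have h2 := hF.mono_ac (withDensity_absolutelyContinuous _
      (fun a => ENNReal.ofReal ⟪gaussMap T a, a⟫))
    rw [hT.withDensity_eq hc hconv h0] at h2
    exact h2.mono_ac (Measure.absolutelyContinuous_smul (by simp))

/-- Relatively open nonempty subsets of the boundary have positive area. -/
theorem HasSmoothBoundary.frontier_inter_ne_zero (hT : HasSmoothBoundary T)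
    (hc : IsCompact T) (hconv : Convex ℝ T) (h0 : (0 : E n) ∈ interior T) {p : E n}
    (hp : p ∈ frontier T) {V : Set (E n)} (hV : IsOpen V) (hpV : p ∈ V) :
    (μHE[n] : Measure (E n)) (frontier T ∩ V) ≠ 0 := by
  intro h
  have hp0 := ne_zero_of_mem_frontier h0 hp
  have hcone := hT.volume_cone_eq hc hconv h0 (A := frontier T ∩ V) inter_subset_left
    (isClosed_frontier.measurableSet.inter hV.measurableSet)
  rw [Measure.restrict_eq_zero.2 h, lintegral_zero_measure, mul_eq_zero] at hcone
  have hv : volume (cone T (frontier T ∩ V)) = 0 := hcone.resolve_left (by simp)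
  have hcont : ContinuousAt (radialProj T) p :=
    (hT.hasFDerivAt_radialProj hc hconv h0 hp0).continuousAt
  have hpre : radialProj T ⁻¹' V ∩ {0}ᶜ ∈ nhds p := by
    refine Filter.inter_mem (hcont.preimage_mem_nhds (hV.mem_nhds ?_))
      (isOpen_compl_singleton.mem_nhds hp0)
    rwa [radialProj_of_mem_frontier hconv h0 hp]
  obtain ⟨W, hW, hWo, hpW⟩ := _root_.mem_nhds_iff.1 hpre
  have hpcl : p ∈ closure (interior T) := by
    rw [hconv.closure_interior_eq_closure_of_nonempty_interior ⟨0, h0⟩]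
    exact frontier_subset_closure hp
  have hne : (W ∩ interior T).Nonempty := mem_closure_iff.1 hpcl W hWo hpW
  refine ((hWo.inter isOpen_interior).measure_pos volume hne).ne' (measure_mono_null ?_ hv)
  rintro y ⟨hyW, hyT⟩
  exact ⟨interior_subset hyT, radialProj_mem_frontier hc hconv h0 (hW hyW).2, (hW hyW).1⟩

/-- Locally, area times a positive constant is at most a multiple of a cone volume, and the boundary
is compact; any `r > 1` would serve in place of `2`. -/
theorem HasSmoothBoundary.frontier_lt_top (hT : HasSmoothBoundary T)
    (hc : IsCompact T) (hconv : Convex ℝ T) (h0 : (0 : E n) ∈ interior T) :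
    (μHE[n] : Measure (E n)) (frontier T) < ⊤ := by
  have hfr : IsCompact (frontier T) := hc.of_isClosed_subset isClosed_frontier
    hc.isClosed.frontier_subset
  refine hfr.measure_lt_top_of_nhdsWithin fun p hp => ?_
  obtain ⟨V, hV, hpV, -, H⟩ := hT.exists_nhds_volume_cone hc hconv h0 hp one_lt_two
  obtain ⟨-, H2⟩ := H (V ∩ frontier T) subset_rfl
    (hV.measurableSet.inter isClosed_frontier.measurableSet)
  refine ⟨V ∩ frontier T, Filter.inter_mem (mem_nhdsWithin_of_mem_nhds (hV.mem_nhds hpV))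
    self_mem_nhdsWithin, ?_⟩
  have hu := inner_gaussMap_pos hc hconv h0 hp
  have hlt : ENNReal.ofReal 2 ^ (2 * n + 1) * volume (cone T (V ∩ frontier T)) < ⊤ :=
    ENNReal.mul_lt_top (ENNReal.pow_lt_top ENNReal.ofReal_lt_top)
      ((measure_mono inter_subset_left).trans_lt hc.measure_lt_top)
  refine lt_top_iff_ne_top.2 fun htop => ?_
  rw [htop, ENNReal.mul_top (ENNReal.ofReal_pos.2 (by positivity)).ne'] at H2
  exact hlt.not_ge H2

end coneMeasureGlobal

/-! ### Change of variables by the Gauss map -/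

section changeOfVariables

variable {n : ℕ} {T : Set (E n)}

/-- The sphere measure is the cone measure of the unit ball, which puts both sides of the change of
variables in the same form. -/
theorem map_coe_sphereMeasure (n : ℕ) :
    (sphereMeasure n).map ((↑) : sphere (0 : E n) 1 → E n) =
      ((n : ℝ≥0∞) + 1) • (volume.restrict (ball (0 : E n) 1)).map (fun x => ‖x‖⁻¹ • x) := by
  have hm : Measurable fun x : E n => ‖x‖⁻¹ • x := measurable_norm.inv.smul measurable_id
  ext A hA
  rw [Measure.map_apply measurable_subtype_coe hA,
    Measure.toSphere_apply' _ (measurable_subtype_coe hA), Measure.smul_apply,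
    Measure.map_apply hm hA, Measure.restrict_apply (hm hA), smul_eq_mul,
    finrank_euclideanSpace_fin]
  push_cast
  congr 1
  refine measure_congr ?_
  have hne : ∀ᵐ y : E n, y ≠ 0 := by simp [ae_iff]
  filter_upwards [hne] with y hy
  have hy0 := norm_pos_iff.2 hy
  refine propext ⟨?_, ?_⟩
  · rintro ⟨t, ht, x, ⟨x, hx, rfl⟩, rfl⟩
    have hx1 : ‖(x : E n)‖ = 1 := by simp
    have ht0 : (0 : ℝ) < t := ht.1
    have hn : ‖t • (x : E n)‖ = t := by rw [norm_smul, hx1, Real.norm_of_nonneg ht0.le, mul_one]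
    refine ⟨?_, ?_⟩
    · change ‖t • (x : E n)‖⁻¹ • t • (x : E n) ∈ A
      rw [hn, smul_smul, inv_mul_cancel₀ ht0.ne', one_smul]
      exact hx
    · change t • (x : E n) ∈ ball 0 1
      rw [mem_ball_zero_iff, hn]
      exact ht.2
  · rintro ⟨h1, h2⟩
    have h2' : ‖y‖ < 1 := mem_ball_zero_iff.1 h2
    refine ⟨‖y‖, ⟨hy0, h2'⟩, ‖y‖⁻¹ • y, ⟨⟨‖y‖⁻¹ • y, ?_⟩, h1, rfl⟩, ?_⟩
    · rw [mem_sphere_zero_iff_norm, norm_smul, norm_inv, norm_norm, inv_mul_cancel₀ hy0.ne']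
    · change ‖y‖ • ‖y‖⁻¹ • y = y
      rw [smul_smul, mul_inv_cancel₀ hy0.ne', one_smul]

theorem lintegral_sphereMeasure {ψ : E n → ℝ≥0∞} (hψ : Measurable ψ) :
    ∫⁻ x : sphere (0 : E n) 1, ψ x ∂(sphereMeasure n) =
      (n + 1) * ∫⁻ x in ball (0 : E n) 1, ψ (‖x‖⁻¹ • x) := by
  have hm : Measurable fun x : E n => ‖x‖⁻¹ • x := measurable_norm.inv.smul measurable_id
  rw [← lintegral_map hψ measurable_subtype_coe, map_coe_sphereMeasure, lintegral_smul_measure,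
    lintegral_map hψ hm, smul_eq_mul]

theorem norm_radialGaussMap (hc : IsCompact T) (hconv : Convex ℝ T) (h0 : (0 : E n) ∈ interior T)
    {y : E n} (hy : y ≠ 0) : ‖radialGaussMap T y‖ = gauge T y := by
  rw [radialGaussMap, norm_smul, norm_gaussMap hconv h0 (radialProj_mem_frontier hc hconv h0 hy),
    Real.norm_of_nonneg (gauge_nonneg _), mul_one]

theorem normalize_radialGaussMap (hc : IsCompact T) (hconv : Convex ℝ T)
    (h0 : (0 : E n) ∈ interior T) {y : E n} (hy : y ≠ 0) :
    ‖radialGaussMap T y‖⁻¹ • radialGaussMap T y = gaussMap T (radialProj T y) := by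
  rw [norm_radialGaussMap hc hconv h0 hy, radialGaussMap, smul_smul,
    inv_mul_cancel₀ (gauge_pos_of_ne_zero hc h0 hy).ne', one_smul]

theorem HasSmoothBoundary.radialGaussMap_image (hT : HasSmoothBoundary T)
    (hc : IsCompact T) (hconv : Convex ℝ T) (h0 : (0 : E n) ∈ interior T) :
    radialGaussMap T '' (interior T ∩ {0}ᶜ) = ball 0 1 ∩ {0}ᶜ := by
  have hnhds : T ∈ nhds (0 : E n) := mem_interior_iff_mem_nhds.1 h0
  ext x
  constructor
  · rintro ⟨y, ⟨hyi, hy0⟩, rfl⟩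
    have hy0 : y ≠ 0 := hy0
    refine ⟨?_, ?_⟩
    · rw [mem_ball_zero_iff, norm_radialGaussMap hc hconv h0 hy0]
      exact (gauge_lt_one_iff_mem_interior hconv hnhds).2 hyi
    · refine norm_ne_zero_iff.1 ?_
      rw [norm_radialGaussMap hc hconv h0 hy0]
      exact (gauge_pos_of_ne_zero hc h0 hy0).ne'
  · rintro ⟨hx1, hx0⟩
    have hx0 : x ≠ 0 := hx0
    have hxn := norm_pos_iff.2 hx0
    obtain ⟨q, hq, hqx⟩ := hT.exists_gaussMap_eq hc hconv ⟨0, interior_subset h0⟩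
      (x := ‖x‖⁻¹ • x) (by rw [norm_smul, norm_inv, norm_norm, inv_mul_cancel₀ hxn.ne'])
    have hg : gauge T (‖x‖ • q) = ‖x‖ := by
      rw [gauge_smul_of_nonneg hxn.le, gauge_eq_one_of_mem_frontier hconv h0 hq, smul_eq_mul,
        mul_one]
    refine ⟨‖x‖ • q, ⟨(gauge_lt_one_iff_mem_interior hconv hnhds).1 ?_, ?_⟩, ?_⟩
    · rw [hg]; exact mem_ball_zero_iff.1 hx1
    · exact smul_ne_zero hxn.ne' (ne_zero_of_mem_frontier h0 hq)
    · rw [radialGaussMap, hg, radialProj_smul hxn, radialProj_of_mem_frontier hconv h0 hq, hqx,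
        smul_smul, mul_inv_cancel₀ hxn.ne', one_smul]

/-- The radial Gauss map as a change of variables. -/
theorem HasSmoothBoundary.lintegral_radialGaussMap (hT : HasSmoothBoundary T)
    (hc : IsCompact T) (hconv : Convex ℝ T) (h0 : (0 : E n) ∈ interior T) (ψ : E n → ℝ≥0∞) :
    ∫⁻ y in T, ENNReal.ofReal (gaussCurvature T (radialProj T y) /
        ⟪gaussMap T (radialProj T y), radialProj T y⟫) * ψ (gaussMap T (radialProj T y)) =
      ∫⁻ x in ball (0 : E n) 1, ψ (‖x‖⁻¹ • x) := by
  have hD : ∀ y : E n, y ≠ 0 → HasFDerivAt (radialGaussMap T) (fderiv ℝ (radialGaussMap T) y) y ∧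
      (fderiv ℝ (radialGaussMap T) y).det = gaussCurvature T (radialProj T y) /
        ⟪gaussMap T (radialProj T y), radialProj T y⟫ := by
    intro y hy
    obtain ⟨D, hD, hdet⟩ := hT.exists_hasFDerivAt_radialGaussMap hc hconv h0 hy
    rw [hD.fderiv]
    exact ⟨hD, hdet⟩
  have hKc : ContinuousOn (fun y => gaussCurvature T (radialProj T y)) ({0}ᶜ : Set (E n)) := by
    refine (hT.continuousOn_gaussCurvature hc hconv h0).comp (fun y hy => ?_)
      fun y hy => radialProj_mem_frontier hc hconv h0 hy
    exact (hT.hasFDerivAt_radialProj hc hconv h0 hy).continuousAt.continuousWithinAt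
  set S : Set (E n) := interior T ∩ {0}ᶜ with hS
  have hSm : MeasurableSet S := isOpen_interior.measurableSet.inter
    isOpen_compl_singleton.measurableSet
  -- The part of nonzero curvature. Two points with the same image have the same gauge and the same
  -- normal, so on `P` they coincide. The rest consists of critical points: its image is null and
  -- its Jacobian vanishes.
  set P : Set (E n) := interior T ∩ ({0}ᶜ ∩ (fun y => gaussCurvature T (radialProj T y)) ⁻¹' {0}ᶜ)
    with hP
  have hPm : MeasurableSet P := isOpen_interior.measurableSet.inter
    (hKc.isOpen_inter_preimage isOpen_compl_singleton isOpen_compl_singleton).measurableSet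
  have hPS : P ⊆ S := fun y hy => ⟨hy.1, hy.2.1⟩
  have hinj : InjOn (radialGaussMap T) P := by
    intro y hy z hz h
    have hy0 : y ≠ 0 := hy.2.1
    have hz0 : z ≠ 0 := hz.2.1
    have hg : gauge T y = gauge T z := by
      rw [← norm_radialGaussMap hc hconv h0 hy0, h, norm_radialGaussMap hc hconv h0 hz0]
    have hν : gaussMap T (radialProj T y) = gaussMap T (radialProj T z) := by
      rw [← normalize_radialGaussMap hc hconv h0 hy0, h, normalize_radialGaussMap hc hconv h0 hz0]
    have hπ : radialProj T y = radialProj T z := by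
      by_contra hne
      exact hz.2.2 (hT.gaussCurvature_eq_zero hc hconv h0 (radialProj_mem_frontier hc hconv h0 hy0)
        (radialProj_mem_frontier hc hconv h0 hz0) hne hν)
    rw [← gauge_smul_radialProj hc h0 hy0, hg, hπ, gauge_smul_radialProj hc h0 hz0]
  have hnull : volume (radialGaussMap T '' (S \ P)) = 0 := by
    refine addHaar_image_eq_zero_of_det_fderivWithin_eq_zero volume
      (f' := fderiv ℝ (radialGaussMap T)) (fun y hy => (hD y hy.1.2).1.hasFDerivWithinAt) ?_
    intro y hy
    have hK : gaussCurvature T (radialProj T y) = 0 := by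
      by_contra hne
      exact hy.2 ⟨hy.1.1, hy.1.2, hne⟩
    rw [(hD y hy.1.2).2, hK, zero_div]
  have himg : (radialGaussMap T '' P : Set (E n)) =ᵐ[volume] ball (0 : E n) 1 := by
    have h1 : radialGaussMap T '' P ∪ radialGaussMap T '' (S \ P) = ball 0 1 ∩ {0}ᶜ := by
      rw [← image_union, union_sdiff_cancel hPS, hT.radialGaussMap_image hc hconv h0]
    have hne : ∀ᵐ y : E n, y ≠ 0 := by simp [ae_iff]
    filter_upwards [hne, measure_eq_zero_iff_ae_notMem.1 hnull] with x hx hx'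
    refine propext ⟨fun h => ?_, fun h => ?_⟩
    · have : x ∈ ball (0 : E n) 1 ∩ {0}ᶜ := h1 ▸ Or.inl h
      exact this.1
    · have : x ∈ radialGaussMap T '' P ∪ radialGaussMap T '' (S \ P) := by
        rw [h1]; exact ⟨h, hx⟩
      exact this.resolve_right hx'
  have hTS : T =ᵐ[volume] S := by
    have hne : ∀ᵐ y : E n, y ≠ 0 := by simp [ae_iff]
    have hf := measure_eq_zero_iff_ae_notMem.1 (hconv.addHaar_frontier (μ := volume))
    filter_upwards [hne, hf] with y hy hy'
    refine propext ⟨fun h => ⟨?_, hy⟩, fun h => interior_subset h.1⟩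
    by_contra hi
    exact hy' ⟨subset_closure h, hi⟩
  rw [setLIntegral_congr hTS, ← setLIntegral_congr himg,
    lintegral_image_eq_lintegral_abs_det_fderiv_mul volume hPm
      (fun y hy => (hD y hy.2.1).1.hasFDerivWithinAt) hinj]
  have hzero : ∫⁻ y in S \ P, ENNReal.ofReal (gaussCurvature T (radialProj T y) /
        ⟪gaussMap T (radialProj T y), radialProj T y⟫) * ψ (gaussMap T (radialProj T y)) = 0 := by
    rw [setLIntegral_congr_fun (g := fun _ => 0) (hSm.diff hPm) fun y hy => ?_, lintegral_zero]
    have hK : gaussCurvature T (radialProj T y) = 0 := by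
      by_contra hne
      exact hy.2 ⟨hy.1.1, hy.1.2, hne⟩
    simp [hK]
  rw [← lintegral_inter_add_sdiff _ S hPm, inter_eq_self_of_subset_right hPS, hzero, add_zero]
  refine setLIntegral_congr_fun hPm fun y hy => ?_
  have hy0 : y ≠ 0 := hy.2.1
  have hfr := radialProj_mem_frontier hc hconv h0 hy0
  rw [(hD y hy0).2, normalize_radialGaussMap hc hconv h0 hy0, abs_of_nonneg
    (div_nonneg (hT.gaussCurvature_nonneg hc hconv h0 hfr)
      (inner_gaussMap_pos hc hconv h0 hfr).le)]

/-- The Gauss map pushes `K dσ` forward to the surface measure of the sphere. -/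
theorem HasSmoothBoundary.lintegral_gaussMap_of_zero_mem (hT : HasSmoothBoundary T)
    (hc : IsCompact T) (hconv : Convex ℝ T) (h0 : (0 : E n) ∈ interior T) {ψ : E n → ℝ≥0∞}
    (hψ : Measurable ψ) :
    ∫⁻ a in frontier T, ENNReal.ofReal (gaussCurvature T a) * ψ (gaussMap T a)
        ∂(μHE[n] : Measure (E n)) =
      ∫⁻ x : sphere (0 : E n) 1, ψ x ∂(sphereMeasure n) := by
  have hM : MeasurableSet (frontier T) := isClosed_frontier.measurableSet
  have hu : ContinuousOn (fun a => ⟪gaussMap T a, a⟫) (frontier T) :=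
    (hT.continuousOn_gaussMap hc hconv).inner continuousOn_id
  have hK := hT.continuousOn_gaussCurvature hc hconv h0
  -- The density `⟪ν, a⟫` of the cone measure cancels the denominator of the Jacobian `K / ⟪ν, a⟫`,
  -- leaving `K dσ`.
  rw [lintegral_sphereMeasure hψ, ← hT.lintegral_radialGaussMap hc hconv h0 ψ,
    ← hT.lintegral_mul_inner_gaussMap hc hconv h0 (F := fun a => ENNReal.ofReal
      (gaussCurvature T a / ⟪gaussMap T a, a⟫) * ψ (gaussMap T a))]
  · refine setLIntegral_congr_fun hM fun a ha => ?_
    have hpos := inner_gaussMap_pos hc hconv h0 ha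
    rw [← mul_assoc, ← ENNReal.ofReal_mul hpos.le, mul_div_cancel₀ _ hpos.ne']
  · refine AEMeasurable.mul ?_ ?_
    · exact ((hK.div hu fun a ha => (inner_gaussMap_pos hc hconv h0 ha).ne').aemeasurable
        hM).ennreal_ofReal
    · exact hψ.comp_aemeasurable ((hT.continuousOn_gaussMap hc hconv).aemeasurable hM)

/-- The divergence theorem for the position vector field. -/
theorem HasSmoothBoundary.lintegral_inner_gaussMap (hT : HasSmoothBoundary T)
    (hc : IsCompact T) (hconv : Convex ℝ T) (h0 : (0 : E n) ∈ interior T) :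
    ∫⁻ a in frontier T, ENNReal.ofReal ⟪gaussMap T a, a⟫ ∂(μHE[n] : Measure (E n)) =
      (n + 1) * volume T := by
  have := hT.lintegral_mul_inner_gaussMap hc hconv h0 (F := fun _ => 1) aemeasurable_const
  simpa using this

end changeOfVariables

/-! ### Chow's entropy and the mean logarithm of the support function -/

section entropy

variable {n : ℕ} {Ω : Set (E n)}

theorem isCompact_preimage_add (hc : IsCompact Ω) (c : E n) :
    IsCompact ((fun v => v + c) ⁻¹' Ω) :=
  (Homeomorph.addRight c).isCompact_preimage.2 hc

theorem zero_mem_interior_preimage_add {z : E n} (hz : z ∈ interior Ω) :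
    (0 : E n) ∈ interior ((fun v => v + z) ⁻¹' Ω) := by
  rw [interior_preimage_add]
  simpa using hz

theorem HasSmoothBoundary.lintegral_gaussMap (hΩ : HasSmoothBoundary Ω) (hc : IsCompact Ω)
    (hconv : Convex ℝ Ω) (hne : Ω.Nonempty) {ψ : E n → ℝ≥0∞} (hψ : Measurable ψ) :
    ∫⁻ a in frontier Ω, ENNReal.ofReal (gaussCurvature Ω a) * ψ (gaussMap Ω a)
        ∂(μHE[n] : Measure (E n)) =
      ∫⁻ x : sphere (0 : E n) 1, ψ x ∂(sphereMeasure n) := by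
  obtain ⟨z, hz⟩ := hΩ.nonempty_interior hc hne
  rw [← (hΩ.preimage_add z).lintegral_gaussMap_of_zero_mem (isCompact_preimage_add hc z)
    (hconv.translate_preimage_left z) (zero_mem_interior_preimage_add hz) hψ,
    ← lintegral_frontier_preimage_add z]
  simp_rw [gaussMap_preimage_add, gaussCurvature_preimage_add]

theorem supportFun_gaussMap (hc : IsCompact Ω) (hconv : Convex ℝ Ω)
    (hint : (interior Ω).Nonempty) {p : E n} (hp : p ∈ frontier Ω) (z : E n) :
    supportFun Ω z (gaussMap Ω p) = ⟪gaussMap Ω p, p - z⟫ :=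
  supportFun_eq_inner_of_normal hc (hc.isClosed.frontier_subset hp)
    (isOuterUnitNormal_gaussMap hconv hint hp.2) z

theorem HasSmoothBoundary.lintegral_supportFun_gaussMap (hΩ : HasSmoothBoundary Ω)
    (hc : IsCompact Ω) (hconv : Convex ℝ Ω) {z : E n} (hz : z ∈ interior Ω) :
    ∫⁻ a in frontier Ω, ENNReal.ofReal (supportFun Ω z (gaussMap Ω a))
        ∂(μHE[n] : Measure (E n)) = (n + 1) * volume Ω := by
  have h1 := (hΩ.preimage_add z).lintegral_inner_gaussMap (isCompact_preimage_add hc z)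
    (hconv.translate_preimage_left z) (zero_mem_interior_preimage_add hz)
  rw [measure_preimage_add_right] at h1
  rw [← h1, ← lintegral_frontier_preimage_add z]
  refine setLIntegral_congr_fun isClosed_frontier.measurableSet fun a ha => ?_
  rw [frontier_preimage_add] at ha
  rw [supportFun_gaussMap hc hconv ⟨z, hz⟩ ha, add_sub_cancel_right, gaussMap_preimage_add]

theorem HasSmoothBoundary.continuousOn_gaussCurvature' (hΩ : HasSmoothBoundary Ω)
    (hc : IsCompact Ω) (hconv : Convex ℝ Ω) (hne : Ω.Nonempty) :
    ContinuousOn (gaussCurvature Ω) (frontier Ω) := by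
  obtain ⟨z, hz⟩ := hΩ.nonempty_interior hc hne
  have h1 := (hΩ.preimage_add z).continuousOn_gaussCurvature (isCompact_preimage_add hc z)
    (hconv.translate_preimage_left z) (zero_mem_interior_preimage_add hz)
  rw [frontier_preimage_add] at h1
  refine (h1.comp (f := fun p => p - z) (t := (fun v => v + z) ⁻¹' frontier Ω) (by fun_prop)
    fun p hp => by simpa using hp).congr fun p _ => ?_
  rw [Function.comp_apply, gaussCurvature_preimage_add, sub_add_cancel]

theorem HasSmoothBoundary.gaussCurvature_nonneg' (hΩ : HasSmoothBoundary Ω)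
    (hc : IsCompact Ω) (hconv : Convex ℝ Ω) (hne : Ω.Nonempty) {p : E n} (hp : p ∈ frontier Ω) :
    0 ≤ gaussCurvature Ω p := by
  obtain ⟨z, hz⟩ := hΩ.nonempty_interior hc hne
  have h1 := (hΩ.preimage_add z).gaussCurvature_nonneg (isCompact_preimage_add hc z)
    (hconv.translate_preimage_left z) (zero_mem_interior_preimage_add hz) (q := p - z)
    (by rw [frontier_preimage_add]; simpa using hp)
  rwa [gaussCurvature_preimage_add, sub_add_cancel] at h1

theorem HasSmoothBoundary.measure_frontier_lt_top (hΩ : HasSmoothBoundary Ω)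
    (hc : IsCompact Ω) (hconv : Convex ℝ Ω) (hne : Ω.Nonempty) :
    (μHE[n] : Measure (E n)) (frontier Ω) < ⊤ := by
  obtain ⟨z, hz⟩ := hΩ.nonempty_interior hc hne
  have h1 := (hΩ.preimage_add z).frontier_lt_top (isCompact_preimage_add hc z)
    (hconv.translate_preimage_left z) (zero_mem_interior_preimage_add hz)
  rwa [frontier_preimage_add, measure_preimage_add_right] at h1

theorem HasSmoothBoundary.measure_frontier_inter_ne_zero (hΩ : HasSmoothBoundary Ω)
    (hc : IsCompact Ω) (hconv : Convex ℝ Ω) {p : E n} (hp : p ∈ frontier Ω) {V : Set (E n)}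
    (hV : IsOpen V) (hpV : p ∈ V) : (μHE[n] : Measure (E n)) (frontier Ω ∩ V) ≠ 0 := by
  obtain ⟨z, hz⟩ := hΩ.nonempty_interior hc ⟨p, hc.isClosed.frontier_subset hp⟩
  have h1 := (hΩ.preimage_add z).frontier_inter_ne_zero (isCompact_preimage_add hc z)
    (hconv.translate_preimage_left z) (zero_mem_interior_preimage_add hz) (p := p - z)
    (by rw [frontier_preimage_add]; simpa using hp) (hV.preimage (continuous_add_const z))
    (by simpa using hpV)
  rwa [frontier_preimage_add, ← preimage_inter, measure_preimage_add_right] at h1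

theorem HasSmoothBoundary.integrableOn_frontier (hΩ : HasSmoothBoundary Ω)
    (hc : IsCompact Ω) (hconv : Convex ℝ Ω) (hne : Ω.Nonempty) {f : E n → ℝ}
    (hf : ContinuousOn f (frontier Ω)) :
    IntegrableOn f (frontier Ω) (μHE[n] : Measure (E n)) := by
  have hM : MeasurableSet (frontier Ω) := isClosed_frontier.measurableSet
  have hfr : IsCompact (frontier Ω) := hc.of_isClosed_subset isClosed_frontier
    hc.isClosed.frontier_subset
  obtain ⟨C, hC⟩ := hfr.exists_bound_of_continuousOn hf
  refine ⟨hf.aestronglyMeasurable hM,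
    HasFiniteIntegral.restrict_of_bounded C (hΩ.measure_frontier_lt_top hc hconv hne) ?_⟩
  filter_upwards [ae_restrict_mem hM] with a ha using hC a ha

/-- Change of variables under the Gauss map, for real functions. -/
theorem HasSmoothBoundary.integral_gaussMap (hΩ : HasSmoothBoundary Ω) (hc : IsCompact Ω)
    (hconv : Convex ℝ Ω) (hne : Ω.Nonempty) {ψ : E n → ℝ} (hψ : Measurable ψ) :
    ∫ a in frontier Ω, gaussCurvature Ω a * ψ (gaussMap Ω a) ∂(μHE[n] : Measure (E n)) =
      ∫ x : sphere (0 : E n) 1, ψ x ∂(sphereMeasure n) := by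
  have hM : MeasurableSet (frontier Ω) := isClosed_frontier.measurableSet
  have hν := (hΩ.continuousOn_gaussMap hc hconv).aemeasurable
    (μ := (μHE[n] : Measure (E n))) hM
  have hK := (hΩ.continuousOn_gaussCurvature' hc hconv hne).aemeasurable
    (μ := (μHE[n] : Measure (E n))) hM
  set m := ((μHE[n] : Measure (E n)).restrict (frontier Ω)).withDensity
    (fun a => ENNReal.ofReal (gaussCurvature Ω a)) with hm
  have hνm : AEMeasurable (gaussMap Ω) m := hν.mono_ac (withDensity_absolutelyContinuous _ _)
  have hmap : m.map (gaussMap Ω) =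
      (sphereMeasure n).map ((↑) : sphere (0 : E n) 1 → E n) := by
    refine Measure.ext_of_lintegral _ fun ψ hψ => ?_
    rw [lintegral_map' hψ.aemeasurable hνm, lintegral_map hψ measurable_subtype_coe,
      ← hΩ.lintegral_gaussMap hc hconv hne hψ]
    exact lintegral_withDensity_eq_lintegral_mul₀ hK.ennreal_ofReal (hψ.comp_aemeasurable hν)
  rw [← integral_map (φ := ((↑) : sphere (0 : E n) 1 → E n)) (f := ψ)
    measurable_subtype_coe.aemeasurable hψ.aestronglyMeasurable, ← hmap,
    integral_map hνm hψ.aestronglyMeasurable, hm,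
    integral_withDensity_eq_integral_toReal_smul₀ hK.ennreal_ofReal
      (Filter.Eventually.of_forall fun _ => ENNReal.ofReal_lt_top)]
  refine setIntegral_congr_fun hM fun a ha => ?_
  rw [smul_eq_mul, ENNReal.toReal_ofReal (hΩ.gaussCurvature_nonneg' hc hconv hne ha)]

/-- `log t ≤ t - 1` at `t = b / k`, multiplied by `k`. Points of zero curvature are allowed: there
the expression is just `b`. -/
theorem mul_log_sub_nonneg {k b : ℝ} (hk : 0 ≤ k) (hb : 0 < b) :
    0 ≤ k * Real.log k - k * Real.log b - k + b := by
  rcases hk.eq_or_lt with rfl | hk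
  · simpa using hb.le
  · have h1 := Real.log_le_sub_one_of_pos (div_pos hb hk)
    rw [Real.log_div hb.ne' hk.ne'] at h1
    have h2 := mul_le_mul_of_nonneg_left h1 hk.le
    have h3 : k * (b / k - 1) = b - k := by field_simp
    linarith

theorem eq_of_mul_log_sub_eq_zero {k b : ℝ} (hk : 0 ≤ k) (hb : 0 < b)
    (h : k * Real.log k - k * Real.log b - k + b = 0) : k = b := by
  rcases hk.eq_or_lt with rfl | hk
  · simp at h; exact h.symm
  · by_contra hne
    have h1 := Real.log_lt_sub_one_of_pos (div_pos hb hk) (fun h => hne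
      ((div_eq_one_iff_eq hk.ne').1 h).symm)
    rw [Real.log_div hb.ne' hk.ne'] at h1
    have h2 := mul_lt_mul_of_pos_left h1 hk
    have h3 : k * (b / k - 1) = b - k := by field_simp
    linarith

theorem HasSmoothBoundary.continuousOn_supportFun_gaussMap (hΩ : HasSmoothBoundary Ω)
    (hc : IsCompact Ω) (hconv : Convex ℝ Ω) (hne : Ω.Nonempty) (z : E n) :
    ContinuousOn (fun a => supportFun Ω z (gaussMap Ω a)) (frontier Ω) :=
  (continuous_supportFun hc hne z).comp_continuousOn (hΩ.continuousOn_gaussMap hc hconv)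

theorem supportFun_gaussMap_pos (hc : IsCompact Ω) (hconv : Convex ℝ Ω) {z : E n}
    (hz : z ∈ interior Ω) {p : E n} (hp : p ∈ frontier Ω) :
    0 < supportFun Ω z (gaussMap Ω p) := by
  refine supportFun_pos hc hz (norm_ne_zero_iff.1 ?_)
  rw [(isOuterUnitNormal_gaussMap hconv ⟨z, hz⟩ hp.2).1]
  norm_num

/-- The relative entropy of `K dσ` with respect to the multiple `c u_z(ν) dσ` of the cone measure
that has the same total mass. -/
theorem HasSmoothBoundary.integral_relative_entropy (hΩ : HasSmoothBoundary Ω) (hc : IsCompact Ω)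
    (hconv : Convex ℝ Ω) {z : E n} (hz : z ∈ interior Ω) {c : ℝ} (hc0 : 0 < c)
    (hcV : c * volume.real Ω = volume.real (ball (0 : E n) 1)) :
    ∫ a in frontier Ω, (gaussCurvature Ω a * Real.log (gaussCurvature Ω a) -
        gaussCurvature Ω a * Real.log (c * supportFun Ω z (gaussMap Ω a)) - gaussCurvature Ω a +
        c * supportFun Ω z (gaussMap Ω a)) ∂(μHE[n] : Measure (E n)) =
      sphereArea n * (chowEntropy Ω - meanLogSupport Ω z - Real.log c) := by
  have hne : Ω.Nonempty := ⟨z, interior_subset hz⟩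
  have hM : MeasurableSet (frontier Ω) := isClosed_frontier.measurableSet
  have hK := hΩ.continuousOn_gaussCurvature' hc hconv hne
  have hw := hΩ.continuousOn_supportFun_gaussMap hc hconv hne z
  have hwpos : ∀ a ∈ frontier Ω, 0 < supportFun Ω z (gaussMap Ω a) := fun a ha =>
    supportFun_gaussMap_pos hc hconv hz ha
  have i1 := hΩ.integrableOn_frontier hc hconv hne (f := fun a => gaussCurvature Ω a *
    Real.log (gaussCurvature Ω a)) (Real.continuous_mul_log.comp_continuousOn hK)
  have i2 := hΩ.integrableOn_frontier hc hconv hne (f := fun a => gaussCurvature Ω a *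
    Real.log (c * supportFun Ω z (gaussMap Ω a)))
    (hK.mul ((hw.const_smul c).log fun a ha => (mul_pos hc0 (hwpos a ha)).ne'))
  have i3 := hΩ.integrableOn_frontier hc hconv hne (f := fun a => gaussCurvature Ω a) hK
  have i4 := hΩ.integrableOn_frontier hc hconv hne
    (f := fun a => c * supportFun Ω z (gaussMap Ω a)) (hw.const_smul c)
  have ω0 := (sphereArea_pos (n := n)).ne'
  have e1 : ∫ a in frontier Ω, gaussCurvature Ω a * Real.log (gaussCurvature Ω a)
      ∂(μHE[n] : Measure (E n)) = sphereArea n * chowEntropy Ω := by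
    rw [chowEntropy, ← mul_assoc, mul_one_div_cancel ω0, one_mul]
  have hconst (r : ℝ) : ∫ a in frontier Ω, gaussCurvature Ω a * r ∂(μHE[n] : Measure (E n)) =
      sphereArea n * r := by
    rw [hΩ.integral_gaussMap hc hconv hne (ψ := fun _ => r) measurable_const, integral_const,
      smul_eq_mul, sphereArea]
  have e3 : ∫ a in frontier Ω, gaussCurvature Ω a ∂(μHE[n] : Measure (E n)) = sphereArea n := by
    simpa using hconst 1
  have hlogm : Measurable fun x => Real.log (supportFun Ω z x) :=
    Real.measurable_log.comp (continuous_supportFun hc hne z).measurable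
  have e2 : ∫ a in frontier Ω, gaussCurvature Ω a * Real.log (c * supportFun Ω z (gaussMap Ω a))
      ∂(μHE[n] : Measure (E n)) = sphereArea n * Real.log c +
        sphereArea n * meanLogSupport Ω z := by
    have : ∫ a in frontier Ω, gaussCurvature Ω a * Real.log (c * supportFun Ω z (gaussMap Ω a))
      ∂(μHE[n] : Measure (E n)) = ∫ a in frontier Ω, (gaussCurvature Ω a * Real.log c +
        gaussCurvature Ω a * Real.log (supportFun Ω z (gaussMap Ω a)))
          ∂(μHE[n] : Measure (E n)) := by
      refine setIntegral_congr_fun hM fun a ha => ?_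
      rw [Real.log_mul hc0.ne' (hwpos a ha).ne', mul_add]
    rw [this, integral_add (hΩ.integrableOn_frontier hc hconv hne
        (f := fun a => gaussCurvature Ω a * Real.log c) (hK.mul continuousOn_const))
      (hΩ.integrableOn_frontier hc hconv hne
        (f := fun a => gaussCurvature Ω a * Real.log (supportFun Ω z (gaussMap Ω a)))
        (hK.mul (hw.log fun a ha => (hwpos a ha).ne'))),
      hconst, hΩ.integral_gaussMap hc hconv hne hlogm, meanLogSupport, ← mul_assoc,
      mul_one_div_cancel ω0, one_mul]
  -- The condition on `c` enters here: the comparison measure has mass `c (n+1) V(Ω) = (n+1) V(B(1))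
  -- = ω_n`, equal to that of `K dσ`, so the terms `-K + c u` integrate to zero.
  have e4 : ∫ a in frontier Ω, c * supportFun Ω z (gaussMap Ω a) ∂(μHE[n] : Measure (E n)) =
      sphereArea n := by
    rw [integral_const_mul, integral_eq_lintegral_of_nonneg_ae
      (by filter_upwards [ae_restrict_mem hM] with a ha using (hwpos a ha).le)
      (hw.aestronglyMeasurable hM), hΩ.lintegral_supportFun_gaussMap hc hconv hz,
      ENNReal.toReal_mul, sphereArea_eq, ← hcV, ENNReal.toReal_add (by simp) (by simp)]
    simp only [ENNReal.toReal_natCast, ENNReal.toReal_one, Measure.real]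
    ring
  have i12 : IntegrableOn (fun a => gaussCurvature Ω a * Real.log (gaussCurvature Ω a) -
      gaussCurvature Ω a * Real.log (c * supportFun Ω z (gaussMap Ω a))) (frontier Ω)
      (μHE[n] : Measure (E n)) := i1.sub i2
  have i123 : IntegrableOn (fun a => gaussCurvature Ω a * Real.log (gaussCurvature Ω a) -
      gaussCurvature Ω a * Real.log (c * supportFun Ω z (gaussMap Ω a)) - gaussCurvature Ω a)
      (frontier Ω) (μHE[n] : Measure (E n)) := i12.sub i3
  rw [integral_add i123 i4, integral_sub i12 i3, integral_sub i1 i2, e1, e2, e3, e4]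
  ring

/-- Nonnegativity of the relative entropy with `c = V(B(1)) / V(Ω)`; the term `log c` becomes the
volume correction. -/
theorem HasSmoothBoundary.meanLogSupport_le_chowEntropy (hΩ : HasSmoothBoundary Ω)
    (hc : IsCompact Ω) (hconv : Convex ℝ Ω) {z : E n} (hz : z ∈ interior Ω) :
    meanLogSupport Ω z - Real.log (volume.real Ω / volume.real (ball (0 : E n) 1)) ≤
      chowEntropy Ω := by
  have hne : Ω.Nonempty := ⟨z, interior_subset hz⟩
  have hM : MeasurableSet (frontier Ω) := isClosed_frontier.measurableSet
  have hV : 0 < volume.real Ω := ENNReal.toReal_pos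
    (Measure.measure_pos_of_nonempty_interior volume ⟨z, hz⟩).ne' hc.measure_lt_top.ne
  have hB : 0 < volume.real (ball (0 : E n) 1) := ENNReal.toReal_pos
    (isOpen_ball.measure_pos volume (by simp)).ne' measure_ball_lt_top.ne
  have hc0 : 0 < volume.real (ball (0 : E n) 1) / volume.real Ω := div_pos hB hV
  have h1 := hΩ.integral_relative_entropy hc hconv hz hc0 (div_mul_cancel₀ _ hV.ne')
  have h2 := h1 ▸ setIntegral_nonneg hM fun a ha =>
    mul_log_sub_nonneg (hΩ.gaussCurvature_nonneg' hc hconv hne ha)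
      (mul_pos hc0 (supportFun_gaussMap_pos hc hconv hz ha))
  have h3 := nonneg_of_mul_nonneg_right h2 sphereArea_pos
  rw [← inv_div (volume.real (ball (0 : E n) 1)), Real.log_inv]
  linarith

/-- For equal volumes `c = 1`. The relative entropy density is continuous and nonnegative, and
nonempty relatively open parts of the boundary have positive area, so a zero integral forces
equality at every point, not just almost everywhere. -/
theorem HasSmoothBoundary.chowEntropy_eq_meanLogSupport_iff (hΩ : HasSmoothBoundary Ω)
    (hc : IsCompact Ω) (hconv : Convex ℝ Ω) {z : E n} (hz : z ∈ interior Ω)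
    (hV : volume.real Ω = volume.real (ball (0 : E n) 1)) :
    chowEntropy Ω = meanLogSupport Ω z ↔
      ∀ p ∈ frontier Ω, gaussCurvature Ω p = supportFun Ω z (gaussMap Ω p) := by
  have hne : Ω.Nonempty := ⟨z, interior_subset hz⟩
  have hM : MeasurableSet (frontier Ω) := isClosed_frontier.measurableSet
  have h1 := hΩ.integral_relative_entropy hc hconv hz one_pos (by rw [one_mul, hV])
  have hK := hΩ.continuousOn_gaussCurvature' hc hconv hne
  have hw := hΩ.continuousOn_supportFun_gaussMap hc hconv hne z
  have hwpos : ∀ a ∈ frontier Ω, 0 < supportFun Ω z (gaussMap Ω a) := fun a ha =>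
    supportFun_gaussMap_pos hc hconv hz ha
  simp only [one_mul, Real.log_one, sub_zero] at h1
  set F : E n → ℝ := fun a => gaussCurvature Ω a * Real.log (gaussCurvature Ω a) -
    gaussCurvature Ω a * Real.log (supportFun Ω z (gaussMap Ω a)) - gaussCurvature Ω a +
    supportFun Ω z (gaussMap Ω a) with hF
  have hFc : ContinuousOn F (frontier Ω) :=
    (((Real.continuous_mul_log.comp_continuousOn hK).sub
      (hK.mul (hw.log fun a ha => (hwpos a ha).ne'))).sub hK).add hw
  have hF0 : ∀ a ∈ frontier Ω, 0 ≤ F a := fun a ha =>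
    mul_log_sub_nonneg (hΩ.gaussCurvature_nonneg' hc hconv hne ha) (hwpos a ha)
  constructor
  · intro h
    rw [h, sub_self, mul_zero, setIntegral_eq_zero_iff_of_nonneg_ae
      (by filter_upwards [ae_restrict_mem hM] with a ha using hF0 a ha)
      (hΩ.integrableOn_frontier hc hconv hne hFc)] at h1
    intro p hp
    refine eq_of_mul_log_sub_eq_zero (hΩ.gaussCurvature_nonneg' hc hconv hne hp) (hwpos p hp) ?_
    by_contra hFp
    have hFp : F p ≠ 0 := hFp
    obtain ⟨V, hV, hpV, hVs⟩ := mem_nhdsWithin.1 ((hFc p hp).eventually_ne hFp)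
    refine hΩ.measure_frontier_inter_ne_zero hc hconv hp hV hpV ?_
    rw [Filter.EventuallyEq, ae_restrict_iff' hM] at h1
    refine measure_mono_null (fun a ha => ?_) h1
    intro h
    exact hVs ⟨ha.2, ha.1⟩ (h ha.1)
  · intro h
    have : ∫ a in frontier Ω, F a ∂(μHE[n] : Measure (E n)) = 0 := by
      rw [setIntegral_congr_fun (g := fun _ => 0) hM fun a ha => ?_, integral_zero]
      simp [hF, h a ha]
    rw [this] at h1
    have := (mul_eq_zero.1 h1.symm).resolve_left sphereArea_pos.ne'
    linarith

theorem chowEntropy_closedBall {c : E n} (h : HasSmoothBoundary (closedBall c 1)) :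
    chowEntropy (closedBall c 1) = 0 := by
  rw [chowEntropy, setIntegral_congr_fun (g := fun _ => 0) isClosed_frontier.measurableSet
    fun p hp => ?_, integral_zero, mul_zero]
  rw [gaussCurvature_closedBall h hp, Real.log_one, mul_zero]

theorem HasSmoothBoundary.exists_entropyPoint (hΩ : HasSmoothBoundary Ω) (hc : IsCompact Ω)
    (hconv : Convex ℝ Ω) (hne : Ω.Nonempty) :
    ∃ z ∈ interior Ω, IsEntropyPoint Ω z ∧ (∀ w, IsEntropyPoint Ω w → w = z) ∧
      ∀ w ∈ interior Ω, meanLogSupport Ω w ≤ meanLogSupport Ω z := by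
  have hint := hΩ.nonempty_interior hc hne
  obtain ⟨z, hz, hmax⟩ := hΩ.exists_logIntegral_max hc hconv hne
  have hω : 0 < 1 / sphereArea n := one_div_pos.2 sphereArea_pos
  have hmax' : ∀ w ∈ interior Ω, meanLogSupport Ω w ≤ meanLogSupport Ω z := fun w hw => by
    rw [meanLogSupport_eq, meanLogSupport_eq]
    exact mul_le_mul_of_nonneg_left (hmax w hw) hω.le
  have hgr : IsGreatest (meanLogSupport Ω '' positivePoints Ω) (meanLogSupport Ω z) := by
    rw [positivePoints_eq_interior hc hconv hint]
    exact ⟨mem_image_of_mem _ hz, by rintro _ ⟨w, hw, rfl⟩; exact hmax' w hw⟩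
  have hent : entropy Ω = meanLogSupport Ω z := hgr.csSup_eq
  refine ⟨z, hz, ⟨by rwa [positivePoints_eq_interior hc hconv hint], hent.symm⟩, fun w hw => ?_,
    hmax'⟩
  have hwi : w ∈ interior Ω := by
    have := hw.1
    rwa [positivePoints_eq_interior hc hconv hint] at this
  refine eq_of_logIntegral_eq_max hc hconv hz hwi hmax ?_
  have := hw.2.trans hent
  rw [meanLogSupport_eq, meanLogSupport_eq] at this
  exact mul_left_cancel₀ hω.ne' this

end entropy

end GaussEntropy

end

/-! ### Assembly of the main theorem. -/

theorem mainTheorem9 (n : ℕ) (hn : 1 ≤ n) (Ω : ConvexBody (GaussEntropy.E n))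
    (hΩ : GaussEntropy.HasSmoothBoundary (Ω : Set (GaussEntropy.E n))) :
    (volume (Ω : Set (GaussEntropy.E n)) = volume (closedBall (0 : GaussEntropy.E n) 1) →
      GaussEntropy.entropy (Ω : Set (GaussEntropy.E n)) ≤
          GaussEntropy.chowEntropy (Ω : Set (GaussEntropy.E n)) ∧
      0 ≤ GaussEntropy.entropy (Ω : Set (GaussEntropy.E n)) ∧
      (∃ ze : GaussEntropy.E n,
        GaussEntropy.IsEntropyPoint (Ω : Set (GaussEntropy.E n)) ze ∧
        (∀ z, GaussEntropy.IsEntropyPoint (Ω : Set (GaussEntropy.E n)) z → z = ze) ∧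
        (GaussEntropy.chowEntropy (Ω : Set (GaussEntropy.E n)) =
            GaussEntropy.entropy (Ω : Set (GaussEntropy.E n)) ↔
          ∀ p ∈ frontier (Ω : Set (GaussEntropy.E n)),
            GaussEntropy.gaussCurvature (Ω : Set (GaussEntropy.E n)) p =
              GaussEntropy.supportFun (Ω : Set (GaussEntropy.E n)) ze
                (GaussEntropy.gaussMap (Ω : Set (GaussEntropy.E n)) p))) ∧
      (GaussEntropy.chowEntropy (Ω : Set (GaussEntropy.E n)) = 0 ↔
        ∃ c : GaussEntropy.E n, (Ω : Set (GaussEntropy.E n)) = closedBall c 1)) ∧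
    GaussEntropy.entropy (Ω : Set (GaussEntropy.E n)) -
        Real.log (volume.real (Ω : Set (GaussEntropy.E n)) /
          volume.real (closedBall (0 : GaussEntropy.E n) 1)) ≤
      GaussEntropy.chowEntropy (Ω : Set (GaussEntropy.E n)) := by 
  open GaussEntropy in
  have hc : IsCompact (Ω : Set (E n)) := Ω.isCompact
  have hconv : Convex ℝ (Ω : Set (E n)) := Ω.convex
  have hne : (Ω : Set (E n)).Nonempty := Ω.nonempty
  obtain ⟨z, hz, hze, huniq, hmax⟩ := hΩ.exists_entropyPoint hc hconv hne
  have hcb : volume.real (closedBall (0 : E n) 1) = volume.real (ball (0 : E n) 1) := by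
    rw [Measure.real, Measure.addHaar_closedBall_eq_addHaar_ball, Measure.real]
  have hb := hΩ.meanLogSupport_le_chowEntropy hc hconv hz
  rw [← hcb, hze.2] at hb
  refine ⟨fun hV => ?_, hb⟩
  have hVr : volume.real (Ω : Set (E n)) = volume.real (ball (0 : E n) 1) := by
    rw [← hcb, Measure.real, hV, Measure.real]
  have hle : entropy (Ω : Set (E n)) ≤ chowEntropy (Ω : Set (E n)) := by
    have hB : volume.real (ball (0 : E n) 1) ≠ 0 := (ENNReal.toReal_pos
      (isOpen_ball.measure_pos volume (by simp)).ne' measure_ball_lt_top.ne).ne'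
    rwa [hcb, hVr, div_self hB, Real.log_one, sub_zero] at hb
  obtain ⟨c, hci, hc0, hceq⟩ := exists_meanLogSupport_nonneg hc hconv ⟨z, hz⟩ hV
  have hcE : meanLogSupport (Ω : Set (E n)) c ≤ entropy (Ω : Set (E n)) := hze.2 ▸ hmax c hci
  refine ⟨hle, hc0.trans hcE, ⟨z, hze, huniq, ?_⟩, fun h0 => ⟨c, hceq ?_⟩, ?_⟩
  · rw [← hze.2]
    exact hΩ.chowEntropy_eq_meanLogSupport_iff hc hconv hz hVr
  -- `0 ≤ mean log u_c ≤ 𝓔 ≤ 𝓔_C = 0`, so the equality case at the centroid applies.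
  · linarith
  · rintro ⟨c, h⟩
    rw [h] at hΩ ⊢
    exact chowEntropy_closedBall hΩ
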